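/- **Setting.** On a probability space $(\Omega,\mathcal H,\mathbb P)$ consider a regime process $s=(s_1,\dots,s_T)$ with values in $\{1,\dots,N\}$ and, for every regime $j$, a random $n\times d$ matrix $\Pi_j$ with $d:=l+np$, $\pi_j:=\mathrm{vec}(\Pi_j)$, and a random $n\times n$ matrix $\Sigma_j$. Let $\mathcal F_0\subseteq\mathcal H$ be a $\sigma$-field for which the exogenous vectors $\psi_1,\dots,\psi_T\in\mathbb R^l$ and the initial values $y_{1-p},\dots,y_0\in\mathbb R^n$ are measurable. Suppose that almost surely $$y_u=\Pi_{s_u}\mathsf Y_u+\Sigma_{s_u}^{1/2}\varepsilon_u,\qquad \mathsf Y_u:=(\psi_u',y_{u-1}',\dots,y_{u-p}')',\qquad u=1,\dots,T,$$ where $\Sigma^{1/2}$ is the (lower triangular) Cholesky factor and $\varepsilon_1,\dots,\varepsilon_T$ are i.i.d. $\mathcal N(0,I_n)$, jointly independent of $\mathcal F_0$, $s$, $(\Pi_{s_u})_{u\le T}$ and $(\Sigma_{s_u})_{u\le T}$. For a regime vector $\sigma$ let $\mathcal A_\sigma$ be the set of its distinct entries. Suppose that, conditionally on $s$ and $\mathcal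 F_0$, the pairs $(\Pi_j,\Sigma_j)$, $j\in\mathcal A_s$, are independent, and that for each $j\in\mathcal A_s$ $$\Sigma_j\mid s,\mathcal F_0\sim\mathcal{IW}(\nu_{0,j},V_{0,j}),\qquad \pi_j\mid\Sigma_j,s,\mathcal F_0\sim\mathcal N(\pi_{0,j},\Lambda_{0,j}\otimes\Sigma_j),$$ with non-random $\pi_{0,j}\in\mathbb R^{nd}$, symmetric positive definite $\Lambda_{0,j}$ ($d\times d$) and $V_{0,j}$ ($n\times n$), and $\nu_{0,j}>n-1$. Here $\mathcal{IW}(\nu,V)$ has the density $\frac{|V|^{\nu/2}}{\Gamma_n(\nu/2)2^{n\nu/2}}|S|^{-(\nu+n+1)/2}\exp\{-\frac12\mathrm{tr}(VS^{-1})\}$ on positive definite $S$, with respect to Lebesgue measure $\prod_{i\ge j}dS_{ij}$, and $\Gamma_n(a)=\pi^{n(n-1)/4}\prod_{i=1}^n\Gamma(a+(1-i)/2)$. Fix $t\in\{1,\dots,T-1\}$. Put $\bar y_t:=(y_1,\dots,y_t)$, $\bar s_t:=(s_1,\dots,s_t)$, $\mathcal F_t:=\mathcal F_0\vee\sigma(\bar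 y_t)$, and let $\alpha:=\mathcal A_{\bar s_t}$, $\beta:=\mathcal A_{(s_{t+1},\dots,s_T)}$, $\gamma:=\alpha\cap\beta$, $\delta:=\beta\setminus\alpha$, $\pi_\alpha:=(\pi_j)_{j\in\alpha}$, and likewise $\Sigma_\alpha$, $\pi_\beta$. For a vector $v\in\mathbb R^{nd}$ let $v^\circ$ be the $n\times d$ matrix with $\mathrm{vec}(v^\circ)=v$. For a regime $j$ let $q_j$ be the number of $u\le t$ with $s_u=j$, let $y_j^\circ$ ($n\times q_j$) and $\mathsf Y_j^\circ$ ($d\times q_j$) be the matrices with columns $y_u$ and $\mathsf Y_u$ for these $u$, and put $y_j:=\mathrm{vec}(y_j^\circ)$, $$\Lambda_{j|t}:=\mathsf Y_j^\circ(\mathsf Y_j^\circ)'+\Lambda_{0,j}^{-1},\qquad C_j:=\big(y_j^\circ(\mathsf Y_j^\circ)'+\pi_{0,j}^\circ\Lambda_{0,j}^{-1}\big)\Lambda_{j|t}^{-1},$$ $$\bar B_j:=y_j^\circ(y_j^\circ)'+\pi_{0,j}^\circ\Lambda_{0,j}^{-1}(\pi_{0,j}^\circ)'-C_j\Lambda_{j|t}C_j'.$$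 **Claim.** The matrix $\bar B_j$ is positive semidefinite and equals $$\bar B_j=(y_j^\circ-\pi_{0,j}^\circ\mathsf Y_j^\circ)\big(I_{q_j}+(\mathsf Y_j^\circ)'\Lambda_{0,j}\mathsf Y_j^\circ\big)^{-1}(y_j^\circ-\pi_{0,j}^\circ\mathsf Y_j^\circ)',$$ and the following are conditional densities (with respect to Lebesgue measure). 1. Given $\bar s_t$ and $\mathcal F_0$, the density of $\bar y_t$ is $$f(\bar y_t\mid\bar s_t,\mathcal F_0)=\frac1{\pi^{nt/2}}\prod_{j\in\alpha}\frac{|\Lambda_{0,j}^{-1}|^{n/2}\,\Gamma_n\big((\nu_{0,j}+q_j)/2\big)\,|V_{0,j}|^{\nu_{0,j}/2}}{|\Lambda_{j|t}|^{n/2}\,\Gamma_n(\nu_{0,j}/2)\,|\bar B_j+V_{0,j}|^{(\nu_{0,j}+q_j)/2}}.$$ 2. Given $\Sigma_\alpha$, $\bar s_t$ and $\mathcal F_t$, with $A_j:=\Lambda_{j|t}^{-1}\otimes\Sigma_j$ and $b_j:=(\mathsf Y_j^\circ\otimes\Sigma_j^{-1})y_j+(\Lambda_{0,j}^{-1}\otimes\Sigma_j^{-1})\pi_{0,j}$,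 the density of $\pi_\alpha$ is $$f(\pi_\alpha\mid\Sigma_\alpha,\bar s_t,\mathcal F_t)=\frac{1}{(2\pi)^{nd|\alpha|/2}\prod_{j\in\alpha}|A_j|^{1/2}}\exp\Big\{-\frac12\sum_{j\in\alpha}(\pi_j-A_jb_j)'A_j^{-1}(\pi_j-A_jb_j)\Big\}.$$ 3. Given $\bar s_t$ and $\mathcal F_t$, the density of $\Sigma_\alpha$ (on positive definite matrices) is $$f(\Sigma_\alpha\mid\bar s_t,\mathcal F_t)=\prod_{j\in\alpha}\frac{|\bar B_j+V_{0,j}|^{(\nu_{0,j}+q_j)/2}}{\Gamma_n\big((\nu_{0,j}+q_j)/2\big)2^{n(\nu_{0,j}+q_j)/2}}|\Sigma_j|^{-(\nu_{0,j}+q_j+n+1)/2}\exp\Big\{-\frac12\sum_{j\in\alpha}\mathrm{tr}\big((\bar B_j+V_{0,j})\Sigma_j^{-1}\big)\Big\}.$$ 4. Given $s$ and $\mathcal F_t$, the density of $\pi_\beta$ is the product of matrix-variate Student densities $$f(\pi_\beta^\circ\mid s,\mathcal F_t)=\prod_{j\in\gamma}\frac{|\Lambda_{j|t}|^{n/2}|\bar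 B_j+V_{0,j}|^{-d/2}\Gamma_n\big((\nu_{0,j}+q_j+d)/2\big)}{\pi^{nd/2}\Gamma_n\big((\nu_{0,j}+q_j)/2\big)}\big|I_n+(\bar B_j+V_{0,j})^{-1}(\pi_j^\circ-C_j)\Lambda_{j|t}(\pi_j^\circ-C_j)'\big|^{-(\nu_{0,j}+q_j+d)/2}$$ $$\times\prod_{j\in\delta}\frac{|\Lambda_{0,j}|^{-n/2}|V_{0,j}|^{-d/2}\Gamma_n\big((\nu_{0,j}+d)/2\big)}{\pi^{nd/2}\Gamma_n(\nu_{0,j}/2)}\big|I_n+V_{0,j}^{-1}(\pi_j^\circ-\pi_{0,j}^\circ)\Lambda_{0,j}^{-1}(\pi_j^\circ-\pi_{0,j}^\circ)'\big|^{-(\nu_{0,j}+d)/2}.$$ -/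

import Mathlib

open MeasureTheory ProbabilityTheory Matrix
open scoped Kronecker

/-- Matrices carry the product (entrywise) sigma-algebra. -/
instance matrixMeasurableSpace {a b : Type*} : MeasurableSpace (Matrix a b ℝ) :=
  inferInstanceAs (MeasurableSpace (a → b → ℝ))

namespace MSVAR

/-! ### Distributions of random vectors and matrices -/

/-- The multivariate normal distribution with mean `m` and covariance `S`, as a measure on `ι → ℝ`. -/
noncomputable def mvNormal {ι : Type*} [Fintype ι] [DecidableEq ι] (m : ι → ℝ) (S : Matrix ι ι ℝ) :
    Measure (ι → ℝ) :=
  (multivariateGaussian (WithLp.toLp 2 m) S).map WithLp.ofLp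

/-- The multivariate gamma function `Γ_n`. -/
noncomputable def mvGamma (n : ℕ) (a : ℝ) : ℝ :=
  Real.pi ^ ((n : ℝ) * ((n : ℝ) - 1) / 4) * ∏ i : Fin n, Real.Gamma (a - (i : ℕ) / 2)

/-- The symmetric matrix with prescribed entries on and below the diagonal. -/
def symOfVech (n : ℕ) (v : {ij : Fin n × Fin n // ij.2 ≤ ij.1} → ℝ) : Matrix (Fin n) (Fin n) ℝ :=
  Matrix.of fun i j => if h : j ≤ i then v ⟨(i, j), h⟩ else v ⟨(j, i), (not_le.mp h).le⟩

/-- Lebesgue measure `∏_{i ≥ j} dS_{ij}` on the symmetric matrices, as a measure on all square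
matrices. -/
noncomputable def symVolume (n : ℕ) : Measure (Matrix (Fin n) (Fin n) ℝ) :=
  (volume : Measure ({ij : Fin n × Fin n // ij.2 ≤ ij.1} → ℝ)).map (symOfVech n)

open Classical in
/-- Density of the inverse-Wishart distribution with `ν` degrees of freedom and scale matrix `V`. -/
noncomputable def iwPdf (n : ℕ) (ν : ℝ) (V S : Matrix (Fin n) (Fin n) ℝ) : ℝ :=
  if S.PosDef then
    V.det ^ (ν / 2) / (mvGamma n (ν / 2) * 2 ^ ((n : ℝ) * ν / 2)) *
      S.det ^ (-(ν + n + 1) / 2) * Real.exp (-(1 / 2) * (V * S⁻¹).trace)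
  else 0

/-- The inverse-Wishart distribution. -/
noncomputable def invWishart (n : ℕ) (ν : ℝ) (V : Matrix (Fin n) (Fin n) ℝ) :
    Measure (Matrix (Fin n) (Fin n) ℝ) :=
  (symVolume n).withDensity fun S => ENNReal.ofReal (iwPdf n ν V S)

/-- `L` is the Cholesky factor of `S`. -/
def IsCholeskyFactor {n : ℕ} (L S : Matrix (Fin n) (Fin n) ℝ) : Prop :=
  (∀ i j, i < j → L i j = 0) ∧ (∀ i, 0 < L i i) ∧ L * Lᵀ = S

/-! ### Conditional laws and conditional densities given a sigma-algebra -/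

/-- Under `P`, the conditional law of `X` given the sigma-algebra `m` is `κ`. -/
def HasCondLaw {Ω E : Type*} {mΩ : MeasurableSpace Ω} [MeasurableSpace E] (P : Measure Ω)
    (m : MeasurableSpace Ω) (X : Ω → E) (κ : Ω → Measure E) : Prop :=
  ∀ B, MeasurableSet B →
    P[(X ⁻¹' B).indicator (fun _ => (1 : ℝ)) | m] =ᵐ[P] fun ω => (κ ω).real B

/-- Under `P`, the random element `X` has, conditionally on the sigma-algebra `m`, the density
`x ↦ f ω x` with respect to `ρ`. -/
def HasCondDensity {Ω E : Type*} {mΩ : MeasurableSpace Ω} [MeasurableSpace E] (P : Measure Ω)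
    (m : MeasurableSpace Ω) (X : Ω → E) (ρ : Measure E) (f : Ω → E → ℝ) : Prop :=
  (∀ᵐ ω ∂P, (∀ x, 0 ≤ f ω x) ∧ Integrable (f ω) ρ) ∧
  ∀ B, MeasurableSet B →
    P[(X ⁻¹' B).indicator (fun _ => (1 : ℝ)) | m] =ᵐ[P] fun ω => ∫ x in B, f ω x ∂ρ

/-- Under `P`, the random elements `X i` are conditionally independent given `m`. (Mathlib's
`iCondIndepFun`, which is equivalent, is available on standard Borel spaces only.) -/
def CondIndependent {Ω ι E : Type*} [Fintype ι] {mΩ : MeasurableSpace Ω} [MeasurableSpace E]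
    (P : Measure Ω) (m : MeasurableSpace Ω) (X : ι → Ω → E) : Prop :=
  ∀ B : ι → Set E, (∀ i, MeasurableSet (B i)) →
    P[(⋂ i, X i ⁻¹' B i).indicator (fun _ => (1 : ℝ)) | m] =ᵐ[P]
      fun ω => ∏ i, (P[(X i ⁻¹' B i).indicator (fun _ => (1 : ℝ)) | m]) ω

/-! ### The autoregression: dimensions, regressors, regimes -/

/-- Index set of the `d = l + n p` regressors: `l` exogenous ones, and `p` lags of `n` endogenous
ones. -/
abbrev Reg (n l p : ℕ) : Type := Fin l ⊕ (Fin p × Fin n)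

/-- Vectorised coefficient matrices, `vec Π` with `Π` of size `n × d` (columns stacked). -/
abbrev CoefVec (n l p : ℕ) : Type := Reg n l p × Fin n → ℝ

/-- `v°`, the `n × d` matrix with `vec v° = v`. -/
def circ {n l p : ℕ} (v : CoefVec n l p) : Matrix (Fin n) (Reg n l p) ℝ :=
  Matrix.of fun i k => v (k, i)

/-- Prior hyperparameters of one regime. -/
structure Hyper (n l p : ℕ) where
  /-- prior mean of the vectorised coefficient matrix -/
  pi0 : CoefVec n l p
  /-- prior column covariance -/
  Lam0 : Matrix (Reg n l p) (Reg n l p) ℝ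
  /-- prior degrees of freedom -/
  nu0 : ℝ
  /-- prior scale matrix -/
  V0 : Matrix (Fin n) (Fin n) ℝ
  Lam0_posDef : Lam0.PosDef
  nu0_gt : (n : ℝ) - 1 < nu0
  V0_posDef : V0.PosDef

/-- The values that are known at time `t`: exogenous variables, initial values and endogenous
variables. The index `u : Fin t` stands for the time `u + 1`, and `y0 i` is `y_{-i}`. -/
structure Sample (n l p t : ℕ) where
  psi : Fin t → Fin l → ℝ
  y0 : Fin p → Fin n → ℝ
  y : Fin t → Fin n → ℝ

/-- The first `t` of `T` entries. -/
def firstPart {A : Type*} {T t : ℕ} (h : t ≤ T) (z : Fin T → A) : Fin t → A :=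
  fun u => z (Fin.castLE h u)

section Formulas

variable {n l p t N : ℕ}

/-- `y_{τ - (i + 1)}` at the time `τ = u + 1`. -/
def Sample.lag (x : Sample n l p t) (u : Fin t) (i : Fin p) : Fin n → ℝ :=
  if (i : ℕ) < u then x.y ⟨u - i - 1, by omega⟩ else x.y0 ⟨i - u, by omega⟩

/-- The regressor vector `Y_τ = (ψ_τ', y_{τ-1}', …, y_{τ-p}')'` at the time `τ = u + 1`. -/
def Sample.regressor (x : Sample n l p t) (u : Fin t) : Reg n l p → ℝ :=
  Sum.elim (x.psi u) fun k => x.lag u k.1 k.2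

/-- The set of distinct regimes in a regime vector. -/
def regimes (σ : Fin t → Fin N) : Finset (Fin N) := Finset.univ.image σ

/-- The set of distinct regimes of a regime vector after the time `t`. -/
def futureRegimes {T : ℕ} (t : ℕ) (σ : Fin T → Fin N) : Finset (Fin N) :=
  (Finset.univ.filter fun u : Fin T => t ≤ (u : ℕ)).image σ

/-- The number of times `u` with regime `σ u = j`. -/
def visitCount (σ : Fin t → Fin N) (j : Fin N) : ℕ := Fintype.card {u : Fin t // σ u = j}

/-- The matrix whose columns are the regressors at the times with regime `j`. -/
def regMat (x : Sample n l p t) (σ : Fin t → Fin N) (j : Fin N) :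
    Matrix (Reg n l p) {u : Fin t // σ u = j} ℝ :=
  Matrix.of fun k u => x.regressor u k

/-- The matrix whose columns are the endogenous vectors at the times with regime `j`. -/
def obsMat (x : Sample n l p t) (σ : Fin t → Fin N) (j : Fin N) :
    Matrix (Fin n) {u : Fin t // σ u = j} ℝ :=
  Matrix.of fun i u => x.y u i

variable (H : Fin N → Hyper n l p) (x : Sample n l p t) (σ : Fin t → Fin N) (j : Fin N)

/-- `Λ_{0,j|t} = Y° Y°' + Λ_{0,j}⁻¹`. -/
noncomputable def LamPost : Matrix (Reg n l p) (Reg n l p) ℝ :=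
  regMat x σ j * (regMat x σ j)ᵀ + (H j).Lam0⁻¹

/-- `C_{t,j} = (y° Y°' + π_{0,j}° Λ_{0,j}⁻¹) Λ_{0,j|t}⁻¹`. -/
noncomputable def Cmat : Matrix (Fin n) (Reg n l p) ℝ :=
  (obsMat x σ j * (regMat x σ j)ᵀ + circ (H j).pi0 * (H j).Lam0⁻¹) * (LamPost H x σ j)⁻¹

/-- `B̄_{t,j} = y° y°' + π_{0,j}° Λ_{0,j}⁻¹ π_{0,j}°' - C_{t,j} Λ_{0,j|t} C_{t,j}'`. -/
noncomputable def Bbar : Matrix (Fin n) (Fin n) ℝ :=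
  obsMat x σ j * (obsMat x σ j)ᵀ + circ (H j).pi0 * (H j).Lam0⁻¹ * (circ (H j).pi0)ᵀ
    - Cmat H x σ j * LamPost H x σ j * (Cmat H x σ j)ᵀ

/-- The closed form of `f(ȳ_t | s̄_t = σ, F_0)`. -/
noncomputable def obsPdf : ℝ :=
  1 / Real.pi ^ ((n : ℝ) * t / 2) *
    ∏ j ∈ regimes σ,
      ((H j).Lam0⁻¹.det ^ ((n : ℝ) / 2) * mvGamma n (((H j).nu0 + visitCount σ j) / 2) *
          (H j).V0.det ^ ((H j).nu0 / 2)) /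
        ((LamPost H x σ j).det ^ ((n : ℝ) / 2) * mvGamma n ((H j).nu0 / 2) *
          (Bbar H x σ j + (H j).V0).det ^ (((H j).nu0 + visitCount σ j) / 2))

/-- `A_j = Λ_{0,j|t}⁻¹ ⊗ S`. -/
noncomputable def Amat (S : Matrix (Fin n) (Fin n) ℝ) :
    Matrix (Reg n l p × Fin n) (Reg n l p × Fin n) ℝ :=
  (LamPost H x σ j)⁻¹ ⊗ₖ S

/-- `b_j = (Y° ⊗ S⁻¹) vec y° + (Λ_{0,j}⁻¹ ⊗ S⁻¹) π_{0,j}`. -/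
noncomputable def bvec (S : Matrix (Fin n) (Fin n) ℝ) : CoefVec n l p :=
  (regMat x σ j ⊗ₖ S⁻¹) *ᵥ (obsMat x σ j).vec + ((H j).Lam0⁻¹ ⊗ₖ S⁻¹) *ᵥ (H j).pi0

/-- The closed form of `f(π_α | Σ_α = S, s̄_t = σ, F_t)` at `π_α = v`. -/
noncomputable def coefPdf (S : regimes σ → Matrix (Fin n) (Fin n) ℝ)
    (v : regimes σ → CoefVec n l p) : ℝ :=
  1 / ((2 * Real.pi) ^ ((n : ℝ) * ((l + n * p : ℕ) : ℝ) * (regimes σ).card / 2) *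
      ∏ j : regimes σ, (Amat H x σ j (S j)).det ^ ((1 : ℝ) / 2)) *
    Real.exp (-(1 / 2) * ∑ j : regimes σ,
      (v j - Amat H x σ j (S j) *ᵥ bvec H x σ j (S j)) ⬝ᵥ
        ((Amat H x σ j (S j))⁻¹ *ᵥ (v j - Amat H x σ j (S j) *ᵥ bvec H x σ j (S j))))

open Classical in
/-- The closed form of `f(Σ_α | s̄_t = σ, F_t)` at `Σ_α = S`; it lives on positive definite
matrices. -/
noncomputable def covPdf (S : regimes σ → Matrix (Fin n) (Fin n) ℝ) : ℝ :=
  if ∀ j, (S j).PosDef then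
    (∏ j : regimes σ,
      (Bbar H x σ j + (H j).V0).det ^ (((H j).nu0 + visitCount σ j) / 2) /
        (mvGamma n (((H j).nu0 + visitCount σ j) / 2) *
          2 ^ ((n : ℝ) * ((H j).nu0 + visitCount σ j) / 2)) *
        (S j).det ^ (-((H j).nu0 + visitCount σ j + n + 1) / 2)) *
      Real.exp (-(1 / 2) * ∑ j : regimes σ, ((Bbar H x σ j + (H j).V0) * (S j)⁻¹).trace)
  else 0

/-- Matrix-variate Student density of the coefficient matrix of a regime that has been visited. -/
noncomputable def seenPdf (v : CoefVec n l p) : ℝ :=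
  ((LamPost H x σ j).det ^ ((n : ℝ) / 2) *
      (Bbar H x σ j + (H j).V0).det ^ (-((l + n * p : ℕ) : ℝ) / 2) *
      mvGamma n (((H j).nu0 + visitCount σ j + ((l + n * p : ℕ) : ℝ)) / 2)) /
    (Real.pi ^ ((n : ℝ) * ((l + n * p : ℕ) : ℝ) / 2) *
      mvGamma n (((H j).nu0 + visitCount σ j) / 2)) *
  (1 + (Bbar H x σ j + (H j).V0)⁻¹ * (circ v - Cmat H x σ j) * LamPost H x σ j *
      (circ v - Cmat H x σ j)ᵀ).det ^
    (-((H j).nu0 + visitCount σ j + ((l + n * p : ℕ) : ℝ)) / 2)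

/-- Matrix-variate Student density of the coefficient matrix of a regime not yet visited. -/
noncomputable def unseenPdf (v : CoefVec n l p) : ℝ :=
  ((H j).Lam0.det ^ (-(n : ℝ) / 2) * (H j).V0.det ^ (-((l + n * p : ℕ) : ℝ) / 2) *
      mvGamma n (((H j).nu0 + ((l + n * p : ℕ) : ℝ)) / 2)) /
    (Real.pi ^ ((n : ℝ) * ((l + n * p : ℕ) : ℝ) / 2) * mvGamma n ((H j).nu0 / 2)) *
  (1 + (H j).V0⁻¹ * (circ v - circ (H j).pi0) * (H j).Lam0⁻¹ *
      (circ v - circ (H j).pi0)ᵀ).det ^ (-((H j).nu0 + ((l + n * p : ℕ) : ℝ)) / 2)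

/-- The closed form of `f(π_β° | s = σ, F_t)` at `π_β = v`: the first product is over the future
regimes that have been visited by the time `t`, the second one over the other future regimes. -/
noncomputable def futureCoefPdf {T : ℕ} (ht : t ≤ T) (σ : Fin T → Fin N)
    (v : futureRegimes t σ → CoefVec n l p) : ℝ :=
  (∏ j : (regimes (firstPart ht σ) ∩ futureRegimes t σ : Finset (Fin N)),
      seenPdf H x (firstPart ht σ) j (v ⟨j, (Finset.mem_inter.mp j.2).2⟩)) *
    ∏ j : (futureRegimes t σ \ regimes (firstPart ht σ) : Finset (Fin N)),
      unseenPdf H j (v ⟨j, (Finset.mem_sdiff.mp j.2).1⟩)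

end Formulas

/-! ### The model -/

/-- The Bayesian Markov-switching vector autoregression with the conjugate prior. Here `F0` is the
initial information, `s` the regime process, `ψ` and `y0` the exogenous variables and the initial
values, `Pi j` and `Sig j` the random coefficient and covariance matrices of the regime `j`. No
assumption on the law of `s` (such as the Markov property) is needed. -/
structure IsBayesianMSVAR {Ω : Type*} (F0 : MeasurableSpace Ω) [mΩ : MeasurableSpace Ω]
    (P : Measure Ω) {n l p T N : ℕ} (H : Fin N → Hyper n l p) (s : Fin T → Ω → Fin N)
    (ψ : Fin T → Ω → Fin l → ℝ) (y0 : Fin p → Ω → Fin n → ℝ) (y ε : Fin T → Ω → Fin n → ℝ)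
    (Pi : Fin N → Ω → Matrix (Fin n) (Reg n l p) ℝ)
    (Sig : Fin N → Ω → Matrix (Fin n) (Fin n) ℝ) : Prop where
  F0_le : F0 ≤ mΩ
  measurable_s : ∀ u, Measurable (s u)
  measurable_psi : ∀ u, Measurable[F0] (ψ u)
  measurable_y0 : ∀ i, Measurable[F0] (y0 i)
  measurable_y : ∀ u, Measurable (y u)
  measurable_eps : ∀ u, Measurable (ε u)
  measurable_Pi : ∀ j, Measurable (Pi j)
  measurable_Sig : ∀ j, Measurable (Sig j)
  /-- `ε_1, …, ε_T` are independent standard normal vectors. -/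
  law_eps : P.map (fun ω u => ε u ω) = Measure.pi fun _ : Fin T => mvNormal (0 : Fin n → ℝ) 1
  /-- The noise is independent of the initial information, of `Π_{s_u}`, `Σ_{s_u}` and of the regimes. -/
  indep_eps : Indep (MeasurableSpace.comap (fun ω u => ε u ω) inferInstance)
    (F0 ⊔ MeasurableSpace.comap (fun ω u => (Pi (s u ω) ω, Sig (s u ω) ω)) inferInstance ⊔
      MeasurableSpace.comap (fun ω u => s u ω) inferInstance) P
  /-- `y_t = Π_{s_t} Y_t + Σ_{s_t}^{1/2} ε_t`. -/
  dynamics : ∀ᵐ ω ∂P, ∀ u, ∃ L, IsCholeskyFactor L (Sig (s u ω) ω) ∧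
    y u ω = Pi (s u ω) ω *ᵥ
        (Sample.mk (fun v => ψ v ω) (fun i => y0 i ω) (fun v => y v ω)).regressor u + L *ᵥ ε u ω
  /-- Given the regimes and `F0`, the pairs `(Π_j, Σ_j)` of distinct regimes are independent. -/
  prior_indep : ∀ σ : Fin T → Fin N,
    CondIndependent P[|{ω | (fun u => s u ω) = σ}] F0
      (fun (j : regimes σ) ω => (Pi j ω, Sig j ω))
  /-- Given the regimes and `F0`, `Σ_j` is inverse-Wishart. -/
  prior_Sig : ∀ σ : Fin T → Fin N, ∀ j ∈ regimes σ,
    HasCondLaw P[|{ω | (fun u => s u ω) = σ}] F0 (Sig j)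
      (fun _ => invWishart n (H j).nu0 (H j).V0)
  /-- Given the regimes, `F0` and `Σ_j`, `vec Π_j` is normal. -/
  prior_Pi : ∀ σ : Fin T → Fin N, ∀ j ∈ regimes σ,
    HasCondLaw P[|{ω | (fun u => s u ω) = σ}]
      (F0 ⊔ MeasurableSpace.comap (Sig j) inferInstance) (fun ω => (Pi j ω).vec)
      (fun ω => mvNormal (H j).pi0 ((H j).Lam0 ⊗ₖ Sig j ω))

/-- `F_t`, generated by the initial information and `y_1, …, y_t`. -/
abbrev infoField {Ω : Type*} {n T : ℕ} (F0 : MeasurableSpace Ω) (y : Fin T → Ω → Fin n → ℝ) {t : ℕ}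
    (ht : t ≤ T) : MeasurableSpace Ω :=
  F0 ⊔ MeasurableSpace.comap (fun ω => firstPart ht fun u => y u ω) inferInstance

end MSVAR

/-! The engine is conjugacy. For one regime, the Gaussian likelihood of its observations, the
matrix-normal prior of Π and the inverse-Wishart prior of Σ multiply to a power of |Σ| times the
exponential of a trace against Σ⁻¹, quadratic in Π. Completing the square (`residual_add_prior`)
recentres it at C with weight Λ_{j|t} and leaves the remainder B̄ + V₀. Hence likelihood times prior
is a constant free of (Π, Σ) times another normal-inverse-Wishart density
(`likelihood_mul_priorPdf`). The constant is the regime's factor in the density of the observations;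
the new density is the posterior, with inverse-Wishart and matrix-Student marginals. A regime
without observations has its prior as posterior, so a single formula serves visited and unvisited
regimes.

The constants rest on the total mass of the inverse-Wishart kernel (`lintegral_iwKer`), found by
induction on the dimension. A symmetric matrix is written through its leading block A, its border A
x and its Schur complement z. Once the Jacobian det A is counted, the kernel splits into the kernel
of A with one degree of freedom less, a Gaussian in x given z, and an inverse gamma in z.

On the probabilistic side, given s = τ the parameters are independent of `F0` with the product prior
(`IsBayesianMSVAR.measure_inter_params`), and the noise is independent of both
(`IsBayesianMSVAR.lintegral_eps`). Noise vectors are exchanged for observations one time at a time,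
each by an affine Gaussian change of variables (`lintegral_path`), which yields prior times
likelihood as the joint law. Bayes' rule then gives `HasPosterior`, an integral identity over
`F0`-events for all nonnegative test functions.

The four densities are read off `HasPosterior`: by ignoring the parameters, by disintegrating along
the covariances, and by marginalising to covariances or to coefficients. Conditioning on the first t
regimes alone is a sum over the full regime paths that extend them, as the formula sees only those t
entries. Conditional densities are certified on a generating π-system
(`hasCondDensity_of_measure_inter`). -/

namespace MSVAR

open scoped ENNReal

/-! ### Measurability of matrix operations. -/

section MatrixMeasurability

variable {X : Type*} [MeasurableSpace X] {a b c d : Type*}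

theorem measurable_matrix {f : X → Matrix a b ℝ} (hf : ∀ i j, Measurable fun x => f x i j) :
    Measurable f :=
  measurable_pi_lambda _ fun i => measurable_pi_lambda _ fun j => hf i j

theorem measurable_entry {f : X → Matrix a b ℝ} (hf : Measurable f) (i : a) (j : b) :
    Measurable fun x => f x i j :=
  measurable_pi_apply j |>.comp (measurable_pi_apply i |>.comp hf)

theorem measurable_matrix_add {f g : X → Matrix a b ℝ} (hf : Measurable f) (hg : Measurable g) :
    Measurable fun x => f x + g x :=
  measurable_matrix fun i j => (measurable_entry hf i j).add (measurable_entry hg i j)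

theorem measurable_matrix_sub {f g : X → Matrix a b ℝ} (hf : Measurable f) (hg : Measurable g) :
    Measurable fun x => f x - g x :=
  measurable_matrix fun i j => (measurable_entry hf i j).sub (measurable_entry hg i j)

theorem measurable_matrix_mul [Fintype b] {f : X → Matrix a b ℝ} {g : X → Matrix b c ℝ}
    (hf : Measurable f) (hg : Measurable g) : Measurable fun x => f x * g x := by
  refine measurable_matrix fun i j => ?_
  simp only [Matrix.mul_apply]
  exact Finset.measurable_sum _ fun k _ => (measurable_entry hf i k).mul (measurable_entry hg k j)

theorem measurable_matrix_transpose {f : X → Matrix a b ℝ} (hf : Measurable f) :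
    Measurable fun x => (f x)ᵀ :=
  measurable_matrix fun i j => measurable_entry hf j i

theorem measurable_matrix_kronecker {f : X → Matrix a b ℝ} {g : X → Matrix c d ℝ}
    (hf : Measurable f) (hg : Measurable g) : Measurable fun x => f x ⊗ₖ g x :=
  measurable_matrix fun i j => (measurable_entry hf i.1 j.1).mul (measurable_entry hg i.2 j.2)

theorem measurable_matrix_mulVec [Fintype b] {f : X → Matrix a b ℝ} {g : X → b → ℝ}
    (hf : Measurable f) (hg : Measurable g) : Measurable fun x => f x *ᵥ g x := by
  refine measurable_pi_lambda _ fun i => ?_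
  simp only [Matrix.mulVec, dotProduct]
  exact Finset.measurable_sum _ fun k _ =>
    (measurable_entry hf i k).mul ((measurable_pi_apply k).comp hg)

theorem measurable_dotProduct [Fintype a] {f g : X → a → ℝ} (hf : Measurable f)
    (hg : Measurable g) : Measurable fun x => f x ⬝ᵥ g x := by
  simp only [dotProduct]
  exact Finset.measurable_sum _ fun k _ =>
    ((measurable_pi_apply k).comp hf).mul ((measurable_pi_apply k).comp hg)

theorem measurable_matrix_trace [Fintype a] {f : X → Matrix a a ℝ} (hf : Measurable f) :
    Measurable fun x => (f x).trace := by
  simp only [Matrix.trace, Matrix.diag]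
  exact Finset.measurable_sum _ fun k _ => measurable_entry hf k k

variable [Fintype a] [DecidableEq a]

theorem measurable_matrix_det {f : X → Matrix a a ℝ} (hf : Measurable f) :
    Measurable fun x => (f x).det := by
  simp only [Matrix.det_apply]
  exact Finset.measurable_sum _ fun k _ =>
    (Finset.measurable_prod _ fun i _ => measurable_entry hf _ i).const_smul _

theorem measurable_matrix_inv {f : X → Matrix a a ℝ} (hf : Measurable f) :
    Measurable fun x => (f x)⁻¹ := by
  refine measurable_matrix fun i j => ?_
  simp only [Matrix.inv_def, Ring.inverse_eq_inv', Matrix.smul_apply, smul_eq_mul,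
    Matrix.adjugate_apply]
  refine (measurable_matrix_det hf).inv.mul (measurable_matrix_det ?_)
  refine measurable_matrix fun k l => ?_
  simp only [Matrix.updateRow_apply]
  split_ifs
  · exact measurable_const
  · exact measurable_entry hf k l

/-- Positive definite means positive semidefinite with nonzero determinant; the first condition is
an intersection of closed ones, the second is measurable. -/
theorem measurableSet_posDef : MeasurableSet {S : Matrix a a ℝ | S.PosDef} := by
  have h : {S : Matrix a a ℝ | S.PosDef} =
      {S : Matrix a a ℝ | S.PosSemidef} ∩ {S | S.det ≠ 0} := by
    ext S
    exact ⟨fun h => ⟨h.posSemidef, h.det_pos.ne'⟩, fun h => h.1.posDef_iff_det_ne_zero.2 h.2⟩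
  rw [h]
  refine MeasurableSet.inter ?_ ?_
  · have hc : IsClosed {S : a → a → ℝ | Matrix.PosSemidef (Matrix.of S)} := by
      simp only [Matrix.posSemidef_iff_dotProduct_mulVec, Set.ofPred_and, Set.ofPred_forall]
      refine IsClosed.inter ?_ (isClosed_iInter fun x => ?_)
      · simp only [Matrix.IsHermitian, ← Matrix.ext_iff, Set.ofPred_forall]
        refine isClosed_iInter fun i => isClosed_iInter fun j => ?_
        simp only [Matrix.conjTranspose_apply, Matrix.of_apply, star_trivial]
        exact isClosed_eq (by fun_prop) (by fun_prop)
      · simp only [dotProduct, Matrix.mulVec, Matrix.of_apply]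
        exact isClosed_le (by fun_prop) (by fun_prop)
    exact hc.measurableSet
  · exact measurable_matrix_det measurable_id (measurableSet_singleton (0 : ℝ)).compl

end MatrixMeasurability

/-! ### The reference measure on symmetric matrices. -/

theorem measurable_symOfVech (n : ℕ) : Measurable (symOfVech n) := by
  refine measurable_matrix fun i j => ?_
  simp only [symOfVech, Matrix.of_apply]
  split_ifs <;> exact measurable_pi_apply _

/-- An injective measurable map between standard Borel spaces is an embedding. Its use is to carry
σ-finiteness to `symVolume`, as Tonelli's theorem requires. -/
theorem measurableEmbedding_symOfVech (n : ℕ) : MeasurableEmbedding (symOfVech n) := by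
  have : StandardBorelSpace (Matrix (Fin n) (Fin n) ℝ) :=
    inferInstanceAs (StandardBorelSpace (Fin n → Fin n → ℝ))
  refine (measurable_symOfVech n).measurableEmbedding fun v w h => ?_
  funext ⟨⟨i, j⟩, hij⟩
  have := congrFun (congrFun h i) j
  simpa [symOfVech, show j ≤ i from hij] using this

instance sigmaFinite_symVolume (n : ℕ) : SigmaFinite (symVolume n) :=
  (measurableEmbedding_symOfVech n).sigmaFinite_map

/-! ### Products of measures with densities. -/

section Products

theorem lintegral_fin_prod_eq_prod {n : ℕ} {E : Fin n → Type*}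
    {mE : ∀ i, MeasurableSpace (E i)} {μ : (i : Fin n) → Measure (E i)} [∀ i, SigmaFinite (μ i)]
    (f : (i : Fin n) → E i → ℝ≥0∞) (hf : ∀ i, Measurable (f i)) :
    ∫⁻ x : (i : Fin n) → E i, ∏ i, f i (x i) ∂(Measure.pi μ) = ∏ i, ∫⁻ x, f i x ∂(μ i) := by
  induction n with
  | zero => simp
  | succ n n_ih =>
    rw [← ((measurePreserving_piFinSuccAbove μ 0).symm).lintegral_comp_emb
      (MeasurableEquiv.measurableEmbedding _)]
    simp_rw [MeasurableEquiv.piFinSuccAbove_symm_apply, Fin.insertNthEquiv,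
      Fin.prod_univ_succ, Fin.insertNth_zero, Equiv.coe_fn_mk, Fin.cons_succ,
      Fin.zero_succAbove, Fin.cons_zero]
    rw [← n_ih (fun i => f i.succ) fun i => hf _]
    have hg : Measurable fun x : (i : Fin n) → E i.succ => ∏ i, f i.succ (x i) :=
      Finset.measurable_prod _ fun i _ => (hf _).comp (measurable_pi_apply i)
    have := lintegral_prod_mul (μ := μ 0) (ν := Measure.pi fun i : Fin n => μ i.succ)
      (hf 0).aemeasurable hg.aemeasurable
    exact this

variable {ι : Type*} [Fintype ι] {E : ι → Type*} {mE : ∀ i, MeasurableSpace (E i)}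
  {μ : (i : ι) → Measure (E i)} [∀ i, SigmaFinite (μ i)]

theorem lintegral_fintype_prod_eq_prod (f : (i : ι) → E i → ℝ≥0∞) (hf : ∀ i, Measurable (f i)) :
    ∫⁻ x : (i : ι) → E i, ∏ i, f i (x i) ∂(Measure.pi μ) = ∏ i, ∫⁻ x, f i x ∂(μ i) := by
  let e := (Fintype.equivFin ι).symm
  rw [← (measurePreserving_piCongrLeft _ e).lintegral_comp_emb
    (MeasurableEquiv.measurableEmbedding _)]
  simp_rw [← e.prod_comp, MeasurableEquiv.coe_piCongrLeft, Equiv.piCongrLeft_apply_apply]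
  exact lintegral_fin_prod_eq_prod (fun i => f (e i)) fun i => hf _

/-- A product measure is determined by boxes, and over a box the integral of a product of densities
factorises. -/
theorem pi_withDensity (f : (i : ι) → E i → ℝ≥0∞) (hf : ∀ i, Measurable (f i))
    [∀ i, SigmaFinite ((μ i).withDensity (f i))] :
    Measure.pi (fun i => (μ i).withDensity (f i)) =
      (Measure.pi μ).withDensity fun x => ∏ i, f i (x i) := by
  classical
  refine Measure.pi_eq fun s hs => ?_
  rw [withDensity_apply _ (MeasurableSet.univ_pi hs),
    ← lintegral_indicator (MeasurableSet.univ_pi hs)]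
  -- The indicator of a box is the product of the indicators of its sides, so it can be absorbed
  -- into the factors.
  have : ∀ x : (i : ι) → E i, (Set.univ.pi s).indicator (fun x => ∏ i, f i (x i)) x =
      ∏ i, (s i).indicator (f i) (x i) := by
    intro x
    by_cases hx : x ∈ Set.univ.pi s
    · rw [Set.indicator_of_mem hx]
      exact Finset.prod_congr rfl fun i _ => by
        rw [Set.indicator_of_mem (hx i (Set.mem_univ _))]
    · rw [Set.indicator_of_notMem hx]
      simp only [Set.mem_pi, Set.mem_univ, true_imp_iff, not_forall] at hx
      obtain ⟨i, hi⟩ := hx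
      exact (Finset.prod_eq_zero (Finset.mem_univ i) (Set.indicator_of_notMem hi _)).symm
  simp_rw [this]
  rw [lintegral_fintype_prod_eq_prod _ fun i => (hf i).indicator (hs i)]
  exact Finset.prod_congr rfl fun i _ => by
    rw [lintegral_indicator (hs i), withDensity_apply _ (hs i)]

end Products

/-! ### Multivariate normal densities and affine maps. -/

section Gaussian

variable {ι : Type*} [Fintype ι] [DecidableEq ι]

/-- The density of the multivariate normal distribution. -/
noncomputable def gaussPdf (m : ι → ℝ) (S : Matrix ι ι ℝ) (x : ι → ℝ) : ℝ :=
  (2 * Real.pi) ^ (-(Fintype.card ι : ℝ) / 2) * S.det ^ (-(1 : ℝ) / 2) *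
    Real.exp (-(1 / 2) * ((x - m) ⬝ᵥ (S⁻¹ *ᵥ (x - m))))

theorem gaussPdf_nonneg (m : ι → ℝ) {S : Matrix ι ι ℝ} (hS : S.PosDef) (x : ι → ℝ) :
    0 ≤ gaussPdf m S x := by
  have := hS.det_pos
  unfold gaussPdf
  positivity

theorem measurable_gaussPdf {X : Type*} [MeasurableSpace X] {m x : X → ι → ℝ}
    {S : X → Matrix ι ι ℝ} (hm : Measurable m) (hS : Measurable S) (hx : Measurable x) :
    Measurable fun z => gaussPdf (m z) (S z) (x z) := by
  unfold gaussPdf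
  have h1 := measurable_matrix_det hS
  have h2 := measurable_dotProduct (hx.sub hm)
    (measurable_matrix_mulVec (measurable_matrix_inv hS) (hx.sub hm))
  exact (measurable_const.mul (h1.pow_const _)).mul (Real.measurable_exp.comp (h2.const_mul _))

theorem lintegral_comp_mulVec {L : Matrix ι ι ℝ} (hL : L.det ≠ 0) {f : (ι → ℝ) → ℝ≥0∞}
    (hf : Measurable f) :
    ∫⁻ x, f (L *ᵥ x) = ENNReal.ofReal |L.det|⁻¹ * ∫⁻ x, f x := by
  have h := Real.map_matrix_volume_pi_eq_smul_volume_pi hL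
  have h2 : ∫⁻ x, f x ∂(Measure.map (toLin' L) volume) = ∫⁻ x, f (L *ᵥ x) := by
    rw [lintegral_map hf]
    · rfl
    · exact measurable_matrix_mulVec measurable_const measurable_id
  rw [← h2, h, lintegral_smul_measure, abs_inv, smul_eq_mul]

theorem lintegral_comp_affine {L : Matrix ι ι ℝ} (hL : L.det ≠ 0) (m : ι → ℝ)
    {f : (ι → ℝ) → ℝ≥0∞} (hf : Measurable f) :
    ∫⁻ x, f (m + L *ᵥ x) = ENNReal.ofReal |L.det|⁻¹ * ∫⁻ x, f x := by
  rw [lintegral_comp_mulVec hL (f := fun z => f (m + z)) (by fun_prop),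
    lintegral_add_left_eq_self f m]

/-- Lᵀ (L Lᵀ)⁻¹ L = 1 removes L from the quadratic form, and |det L| cancels det S to the power
-1/2. L need not be triangular: the lemma serves the Cholesky factor as well as the symmetric square
root. -/
theorem gaussPdf_affine {L S : Matrix ι ι ℝ} (hLS : L * Lᵀ = S) (hL : L.det ≠ 0)
    (m x : ι → ℝ) : |L.det| * gaussPdf m S (m + L *ᵥ x) = gaussPdf 0 1 x := by
  have hd : S.det = |L.det| ^ 2 := by rw [← hLS, det_mul, det_transpose, sq_abs, sq]
  have hp : 0 < |L.det| := abs_pos.2 hL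
  have hq : (L *ᵥ x) ⬝ᵥ (S⁻¹ *ᵥ (L *ᵥ x)) = x ⬝ᵥ x := by
    have hu : IsUnit L.det := isUnit_iff_ne_zero.2 hL
    have hu' : IsUnit Lᵀ.det := by rwa [det_transpose]
    rw [← hLS, Matrix.mul_inv_rev, mulVec_mulVec, Matrix.mul_assoc, nonsing_inv_mul _ hu,
      Matrix.mul_one, dotProduct_comm, dotProduct_mulVec, vecMul_mulVec, ← mulVec_transpose,
      ← Matrix.transpose_nonsing_inv, transpose_transpose]
    simp [nonsing_inv_mul _ hu]
  have h1 : |L.det| * S.det ^ (-(1 : ℝ) / 2) = 1 := by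
    rw [hd, ← Real.rpow_natCast, ← Real.rpow_mul hp.le]
    norm_num
    rw [Real.rpow_neg_one, mul_inv_cancel₀ hp.ne']
  unfold gaussPdf
  simp only [add_sub_cancel_left, hq, det_one, Real.one_rpow, mul_one, sub_zero, inv_one,
    one_mulVec]
  calc _ = (|L.det| * S.det ^ (-(1 : ℝ) / 2)) * ((2 * Real.pi) ^ (-(Fintype.card ι : ℝ) / 2) *
        Real.exp (-(1 / 2) * (x ⬝ᵥ x))) := by ring
    _ = _ := by rw [h1, one_mul]

theorem pi_gaussianReal_eq_withDensity :
    Measure.pi (fun _ : ι => gaussianReal 0 1) =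
      volume.withDensity fun x => ENNReal.ofReal (gaussPdf (0 : ι → ℝ) 1 x) := by
  have h := gaussianReal_of_var_ne_zero 0 (one_ne_zero (α := NNReal))
  have : SigmaFinite ((volume : Measure ℝ).withDensity (gaussianPDF 0 1)) := by
    rw [← h]; infer_instance
  rw [h, pi_withDensity _ fun _ => measurable_gaussianPDF 0 1, volume_pi]
  congr 1
  ext x
  simp only [gaussianPDF]
  rw [← ENNReal.ofReal_prod_of_nonneg fun i _ => gaussianPDFReal_nonneg _ _ _]
  congr 1
  simp only [gaussianPDFReal, Finset.prod_mul_distrib, gaussPdf, Finset.prod_const,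
    ← Real.exp_sum]
  congr 1
  · simp only [NNReal.coe_one, mul_one, det_one, Real.one_rpow, Finset.card_univ]
    rw [Real.sqrt_eq_rpow, ← Real.rpow_neg (by positivity), ← Real.rpow_natCast,
      ← Real.rpow_mul (by positivity)]
    congr 1
    ring
  · congr 1
    simp only [dotProduct, inv_one, one_mulVec, Finset.mul_sum]
    refine Finset.sum_congr rfl fun i _ => ?_
    simp
    ring

theorem lintegral_gaussPdf_zero_one :
    ∫⁻ x, ENNReal.ofReal (gaussPdf (0 : ι → ℝ) 1 x) = 1 := by
  have h : (Measure.pi (fun _ : ι => gaussianReal 0 1)) Set.univ = 1 := measure_univ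
  rwa [pi_gaussianReal_eq_withDensity, withDensity_apply _ MeasurableSet.univ,
    Measure.restrict_univ] at h

/-- An invertible affine image of a standard normal vector is normal. -/
theorem lintegral_gauss_affine {L S : Matrix ι ι ℝ} (hLS : L * Lᵀ = S) (hL : L.det ≠ 0)
    (m : ι → ℝ) {f : (ι → ℝ) → ℝ≥0∞} (hf : Measurable f) :
    ∫⁻ x, f (m + L *ᵥ x) * ENNReal.ofReal (gaussPdf 0 1 x) =
      ∫⁻ x, f x * ENNReal.ofReal (gaussPdf m S x) := by
  have hp : 0 < |L.det| := abs_pos.2 hL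
  have hm : Measurable fun x => f x * ENNReal.ofReal (gaussPdf m S x) :=
    hf.mul (measurable_gaussPdf measurable_const measurable_const measurable_id).ennreal_ofReal
  have key := lintegral_comp_affine hL m hm
  have : ∀ x, f (m + L *ᵥ x) * ENNReal.ofReal (gaussPdf 0 1 x) = ENNReal.ofReal |L.det| *
      (f (m + L *ᵥ x) * ENNReal.ofReal (gaussPdf m S (m + L *ᵥ x))) := by
    intro x
    rw [← gaussPdf_affine hLS hL m x, ENNReal.ofReal_mul hp.le]
    ring
  simp_rw [this]
  rw [lintegral_const_mul', key, ← mul_assoc, ← ENNReal.ofReal_mul hp.le, mul_inv_cancel₀ hp.ne',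
    ENNReal.ofReal_one, one_mul]
  exact ENNReal.ofReal_ne_top

theorem mvNormal_zero_one :
    mvNormal (0 : ι → ℝ) 1 = volume.withDensity fun x => ENNReal.ofReal (gaussPdf 0 1 x) := by
  rw [mvNormal, WithLp.toLp_zero, multivariateGaussian_zero_one, ← map_pi_eq_stdGaussian,
    Measure.map_map (by fun_prop) (by fun_prop), ← pi_gaussianReal_eq_withDensity]
  exact Measure.map_id

open scoped MatrixOrder in
-- The symmetric root is the factor to use here because `multivariateGaussian` is built as an affine
-- image under it.
theorem exists_mul_transpose_of_posDef {S : Matrix ι ι ℝ} (hS : S.PosDef) :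
    CFC.sqrt S * (CFC.sqrt S)ᵀ = S ∧ (CFC.sqrt S).det ≠ 0 := by
  have h1 : CFC.sqrt S * CFC.sqrt S = S := CFC.sqrt_mul_sqrt_self S hS.posSemidef.nonneg
  have h2 : (CFC.sqrt S)ᵀ = CFC.sqrt S := by
    have := (CFC.sqrt_nonneg S).posSemidef.isHermitian
    rwa [Matrix.IsHermitian, conjTranspose_eq_transpose_of_trivial] at this
  refine ⟨by rw [h2, h1], fun h => hS.det_pos.ne' ?_⟩
  rw [← h1, det_mul, h, zero_mul]

open scoped MatrixOrder in
-- The law is an affine image of the standard normal one, so the affine change of variables yields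
-- its density. Positive definiteness makes the root invertible.
theorem mvNormal_eq_withDensity (m : ι → ℝ) {S : Matrix ι ι ℝ} (hS : S.PosDef) :
    mvNormal m S = volume.withDensity fun x => ENNReal.ofReal (gaussPdf m S x) := by
  obtain ⟨h1, h2⟩ := exists_mul_transpose_of_posDef hS
  have e : mvNormal m S = (mvNormal (0 : ι → ℝ) 1).map fun x => m + CFC.sqrt S *ᵥ x := by
    have hmeas : Measurable fun x : ι → ℝ => m + CFC.sqrt S *ᵥ x :=
      measurable_const.add (measurable_matrix_mulVec measurable_const measurable_id)
    rw [mvNormal, mvNormal, WithLp.toLp_zero, multivariateGaussian_zero_one, multivariateGaussian,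
      Measure.map_map (by fun_prop) (by fun_prop), Measure.map_map hmeas (by fun_prop)]
    congr 1
  have hmeas : Measurable fun x : ι → ℝ => m + CFC.sqrt S *ᵥ x :=
    measurable_const.add (measurable_matrix_mulVec measurable_const measurable_id)
  have hg : Measurable fun x => ENNReal.ofReal (gaussPdf (0 : ι → ℝ) 1 x) :=
    (measurable_gaussPdf measurable_const measurable_const measurable_id).ennreal_ofReal
  have hg' : Measurable fun x => ENNReal.ofReal (gaussPdf m S x) :=
    (measurable_gaussPdf measurable_const measurable_const measurable_id).ennreal_ofReal
  refine Measure.ext_of_lintegral _ fun f hf => ?_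
  rw [e, lintegral_map hf hmeas, mvNormal_zero_one,
    lintegral_withDensity_eq_lintegral_mul _ hg
      (show Measurable fun x => f (m + CFC.sqrt S *ᵥ x) from hf.comp hmeas),
    lintegral_withDensity_eq_lintegral_mul _ hg' hf]
  simp only [Pi.mul_apply]
  simp_rw [mul_comm (ENNReal.ofReal _)]
  exact lintegral_gauss_affine h1 h2 m hf

theorem lintegral_gaussPdf (m : ι → ℝ) {S : Matrix ι ι ℝ} (hS : S.PosDef) :
    ∫⁻ x, ENNReal.ofReal (gaussPdf m S x) = 1 := by
  obtain ⟨h1, h2⟩ := exists_mul_transpose_of_posDef hS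
  have := lintegral_gauss_affine h1 h2 m (f := fun _ => 1) measurable_const
  simp only [one_mul] at this
  rw [← this, lintegral_gaussPdf_zero_one]

end Gaussian

/-! ### Bordered matrices and Schur complements. -/

section Arrow

variable {ι : Type*} [Fintype ι] [DecidableEq ι]

/-- The unit lower block-triangular matrix with last row `(x', 1)`. -/
def unitLower (x : ι → ℝ) : Matrix (ι ⊕ Unit) (ι ⊕ Unit) ℝ :=
  fromBlocks 1 0 (replicateRow Unit x) 1

/-- The block-diagonal matrix with blocks `A` and `z`. -/
def blockDiag (A : Matrix ι ι ℝ) (z : ℝ) : Matrix (ι ⊕ Unit) (ι ⊕ Unit) ℝ :=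
  fromBlocks A 0 0 (Matrix.of fun _ _ => z)

/-- The bordered matrix with leading block `A`, border `A x` and Schur complement `z`. -/
def bordered (A : Matrix ι ι ℝ) (x : ι → ℝ) (z : ℝ) : Matrix (ι ⊕ Unit) (ι ⊕ Unit) ℝ :=
  fromBlocks A (replicateCol Unit (A *ᵥ x)) (replicateRow Unit (A *ᵥ x))
    (Matrix.of fun _ _ => z + x ⬝ᵥ A *ᵥ x)

/-- Block LDLᵀ factorisation. It explains the choice of the border as A x: determinant, inverse and
definiteness then depend on x only through a unipotent congruence. -/
theorem bordered_eq {A : Matrix ι ι ℝ} (hA : Aᵀ = A) (x : ι → ℝ) (z : ℝ) :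
    bordered A x z = unitLower x * blockDiag A z * (unitLower x)ᵀ := by
  simp only [bordered, unitLower, blockDiag, fromBlocks_transpose, fromBlocks_multiply]
  congr 1
  · simp
  · ext i j
    simp [Matrix.mul_apply, mulVec, dotProduct]
  · simp only [Matrix.mul_one, Matrix.mul_zero, Matrix.one_mul, add_zero, transpose_one,
      transpose_zero]
    ext i j
    simp only [replicateRow_apply, Matrix.mul_apply, mulVec, dotProduct]
    refine Finset.sum_congr rfl fun k _ => ?_
    rw [mul_comm, ← congrFun (congrFun hA k) j, transpose_apply]
  · simp only [Matrix.mul_one, Matrix.mul_zero, Matrix.one_mul, add_zero, zero_add,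
      transpose_one]
    ext i j
    simp only [Matrix.add_apply, Matrix.mul_apply, of_apply, replicateRow_apply, transpose_apply,
      dotProduct, mulVec, Finset.mul_sum, Finset.sum_mul]
    rw [add_comm, Finset.sum_comm]
    congr 1
    exact Finset.sum_congr rfl fun k _ => Finset.sum_congr rfl fun l _ => by ring

theorem unitLower_mul (x y : ι → ℝ) : unitLower x * unitLower y = unitLower (x + y) := by
  simp only [unitLower, fromBlocks_multiply]
  congr 1
  · simp
  · simp
  · ext i j; simp
  · simp

theorem unitLower_zero : unitLower (0 : ι → ℝ) = 1 := by
  rw [unitLower, ← fromBlocks_one]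
  congr 1

theorem det_unitLower (x : ι → ℝ) : (unitLower x).det = 1 := by
  rw [unitLower, det_fromBlocks_zero₁₂]; simp

theorem det_blockDiag (A : Matrix ι ι ℝ) (z : ℝ) : (blockDiag A z).det = A.det * z := by
  rw [blockDiag, det_fromBlocks_zero₁₂]; simp

theorem det_bordered {A : Matrix ι ι ℝ} (hA : Aᵀ = A) (x : ι → ℝ) (z : ℝ) :
    (bordered A x z).det = A.det * z := by
  rw [bordered_eq hA, det_mul, det_mul, det_transpose, det_unitLower, det_blockDiag]; ring

theorem unitLower_inv (x : ι → ℝ) : (unitLower x)⁻¹ = unitLower (-x) :=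
  inv_eq_right_inv (by rw [unitLower_mul, add_neg_cancel, unitLower_zero])

theorem blockDiag_inv {A : Matrix ι ι ℝ} (hA : IsUnit A.det) {z : ℝ} (hz : z ≠ 0) :
    (blockDiag A z)⁻¹ = blockDiag A⁻¹ z⁻¹ := by
  refine inv_eq_right_inv ?_
  simp only [blockDiag, fromBlocks_multiply]
  rw [← fromBlocks_one]
  congr 1
  · simp [mul_nonsing_inv _ hA]
  · simp
  · simp
  · ext i j
    simp [Matrix.mul_apply, mul_inv_cancel₀ hz]

theorem transpose_eq_self {A : Matrix ι ι ℝ} (hA : A.PosDef) : Aᵀ = A := by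
  have := hA.isHermitian
  rwa [Matrix.IsHermitian, conjTranspose_eq_transpose_of_trivial] at this

/-- The inverse is a congruence of the block-diagonal inverse by the unipotent matrix of -x. By
cyclicity of the trace this congruence can be applied to the other factor, where it shifts y to y -
x. The outcome is quadratic in x, hence Gaussian once exponentiated. -/
theorem trace_bordered_mul_inv {A B : Matrix ι ι ℝ} (hA : A.PosDef) (hB : Bᵀ = B)
    (x y : ι → ℝ) {z : ℝ} (hz : z ≠ 0) (w : ℝ) :
    (bordered B y w * (bordered A x z)⁻¹).trace =
      (B * A⁻¹).trace + (w + (y - x) ⬝ᵥ B *ᵥ (y - x)) / z := by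
  have hAs := transpose_eq_self hA
  have hu : IsUnit A.det := isUnit_iff_ne_zero.2 hA.det_pos.ne'
  have e1 : (bordered A x z)⁻¹ =
      (unitLower (-x))ᵀ * blockDiag A⁻¹ z⁻¹ * unitLower (-x) := by
    rw [bordered_eq hAs, Matrix.mul_inv_rev, Matrix.mul_inv_rev, blockDiag_inv hu hz,
      ← Matrix.transpose_nonsing_inv, unitLower_inv, Matrix.mul_assoc]
  have e2 : (bordered B y w * (bordered A x z)⁻¹).trace =
      (bordered B (y - x) w * blockDiag A⁻¹ z⁻¹).trace := by
    rw [e1, bordered_eq hB, bordered_eq hB, ← Matrix.mul_assoc, Matrix.trace_mul_comm,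
      show y - x = -x + y by abel, ← unitLower_mul, transpose_mul]
    simp only [Matrix.mul_assoc]
  rw [e2, bordered, blockDiag, fromBlocks_multiply]
  simp [Matrix.trace, Matrix.mul_apply, div_eq_mul_inv, Fintype.sum_sum_type]

theorem posDef_blockDiag_iff {A : Matrix ι ι ℝ} (hA : A.PosDef) (z : ℝ) :
    (blockDiag A z).PosDef ↔ 0 < z := by
  constructor
  · intro h
    have := h.diag_pos (i := Sum.inr ())
    simpa [blockDiag] using this
  · intro hz
    rw [posDef_iff_dotProduct_mulVec]
    constructor
    · rw [blockDiag, isHermitian_fromBlocks_iff]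
      exact ⟨hA.1, by simp, by simp, by ext; simp⟩
    · intro v hv
      have e : star v ⬝ᵥ (blockDiag A z *ᵥ v) =
          (v ∘ Sum.inl) ⬝ᵥ (A *ᵥ (v ∘ Sum.inl)) + z * v (Sum.inr ()) ^ 2 := by
        simp [blockDiag, dotProduct, mulVec, Fintype.sum_sum_type]
        ring
      rw [e]
      by_cases h0 : v ∘ Sum.inl = 0
      · have h1 : v (Sum.inr ()) ≠ 0 := by
          intro h1
          refine hv (funext fun i => ?_)
          rcases i with i | i
          · exact congrFun h0 i
          · exact h1
        rw [h0]
        simp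
        positivity
      · have := hA.dotProduct_mulVec_pos h0
        simp only [star_trivial] at this
        positivity

/-- Definiteness is invariant under the invertible congruence of `bordered_eq`, so only the Schur
complement matters. -/
theorem posDef_bordered_iff {A : Matrix ι ι ℝ} (hA : A.PosDef) (x : ι → ℝ) (z : ℝ) :
    (bordered A x z).PosDef ↔ 0 < z := by
  have hu : IsUnit (unitLower x) := (Matrix.isUnit_iff_isUnit_det _).2 (by simp [det_unitLower])
  rw [bordered_eq (transpose_eq_self hA), ← posDef_blockDiag_iff hA,
    ← conjTranspose_eq_transpose_of_trivial]
  exact hu.posDef_star_right_conjugate_iff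

/-- Solving A y = border, possible because the leading block is positive definite, gives y; w is the
Schur complement. -/
theorem eq_bordered {V : Matrix (ι ⊕ Unit) (ι ⊕ Unit) ℝ} (hV : V.PosDef) :
    V.toBlocks₁₁.PosDef ∧ ∃ y w, 0 < w ∧ V = bordered V.toBlocks₁₁ y w := by
  have h1 : V.toBlocks₁₁.PosDef := hV.submatrix Sum.inl_injective
  have hu : IsUnit V.toBlocks₁₁.det := isUnit_iff_ne_zero.2 h1.det_pos.ne'
  have hVs := transpose_eq_self hV
  refine ⟨h1, V.toBlocks₁₁⁻¹ *ᵥ fun i => V (Sum.inl i) (Sum.inr ()), V (Sum.inr ()) (Sum.inr ()) -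
    (V.toBlocks₁₁⁻¹ *ᵥ fun i => V (Sum.inl i) (Sum.inr ())) ⬝ᵥ
      fun i => V (Sum.inl i) (Sum.inr ()), ?_⟩
  set y := V.toBlocks₁₁⁻¹ *ᵥ fun i => V (Sum.inl i) (Sum.inr ()) with hy
  have hAy : V.toBlocks₁₁ *ᵥ y = fun i => V (Sum.inl i) (Sum.inr ()) := by
    rw [hy, mulVec_mulVec, mul_nonsing_inv _ hu, one_mulVec]
  have e : V = bordered V.toBlocks₁₁ y (V (Sum.inr ()) (Sum.inr ()) - y ⬝ᵥ
      fun i => V (Sum.inl i) (Sum.inr ())) := by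
    rw [bordered, hAy]
    ext i j
    rcases i with i | i <;> rcases j with j | j
    · rfl
    · rfl
    · simpa using congrFun (congrFun hVs (Sum.inl j)) (Sum.inr ())
    · simp
  refine ⟨?_, e⟩
  rw [← posDef_bordered_iff h1 y, ← e]
  exact hV

end Arrow

/-! ### The inverse gamma integral. -/

section ScalarIntegral

/-- The substitution z ↦ 1/z turns it into the gamma integral. -/
theorem lintegral_inverse_gamma {a b : ℝ} (ha : 0 < a) (hb : 0 < b) :
    ∫⁻ z in Set.Ioi (0 : ℝ), ENNReal.ofReal (z ^ (-a - 1) * Real.exp (-(b / z))) =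
      ENNReal.ofReal (Real.Gamma a * b ^ (-a)) := by
  have h1 := integral_comp_rpow_Ioi (fun t : ℝ => t ^ (a - 1) * Real.exp (-(b * t)))
    (p := -1) (by norm_num)
  rw [Real.integral_rpow_mul_exp_neg_mul_Ioi ha hb] at h1
  have h2 : ∫ z in Set.Ioi (0 : ℝ), z ^ (-a - 1) * Real.exp (-(b / z)) =
      (1 / b) ^ a * Real.Gamma a := by
    rw [← h1]
    refine setIntegral_congr_fun measurableSet_Ioi fun z (hz : 0 < z) => ?_
    simp only [abs_neg, abs_one, one_mul, smul_eq_mul]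
    rw [Real.rpow_neg_one, ← mul_assoc, Real.inv_rpow hz.le, ← Real.rpow_neg hz.le,
      ← Real.rpow_add hz, div_eq_mul_inv]
    congr 2
    ring
  have hpos : 0 < (1 / b) ^ a * Real.Gamma a :=
    mul_pos (Real.rpow_pos_of_pos (by positivity) _) (Real.Gamma_pos_of_pos ha)
  have hint : IntegrableOn (fun z : ℝ => z ^ (-a - 1) * Real.exp (-(b / z))) (Set.Ioi 0) := by
    -- The Bochner integral of a non-integrable function is 0 by convention, whereas the value just
    -- computed is positive.
    by_contra h
    rw [integral_undef h] at h2
    exact hpos.ne h2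
  rw [← ofReal_integral_eq_lintegral_ofReal hint, h2]
  · congr 1
    rw [one_div, Real.inv_rpow hb.le, Real.rpow_neg hb.le, mul_comm]
  · refine (ae_restrict_iff' measurableSet_Ioi).2 (.of_forall fun z (hz : 0 < z) => ?_)
    simp only [Pi.zero_apply]
    positivity

end ScalarIntegral

/-! ### The inverse-Wishart kernel and its last row. -/

section Kernel

open Classical in
/-- The inverse-Wishart density without its normalising constant, for a general exponent. -/
noncomputable def iwKer {ι : Type*} [Fintype ι] [DecidableEq ι] (r : ℝ) (V S : Matrix ι ι ℝ) : ℝ :=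
  if S.PosDef then S.det ^ r * Real.exp (-(1 / 2) * (V * S⁻¹).trace) else 0

variable {ι : Type*} [Fintype ι] [DecidableEq ι]

theorem iwKer_nonneg (r : ℝ) (V S : Matrix ι ι ℝ) : 0 ≤ iwKer r V S := by
  unfold iwKer
  split_ifs with h
  · have := h.det_pos
    positivity
  · exact le_rfl

theorem measurable_iwKer {X : Type*} [MeasurableSpace X] (r : ℝ) {V S : X → Matrix ι ι ℝ}
    (hV : Measurable V) (hS : Measurable S) : Measurable fun x => iwKer r (V x) (S x) := by
  unfold iwKer
  refine Measurable.ite (hS measurableSet_posDef) ?_ measurable_const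
  exact ((measurable_matrix_det hS).pow_const _).mul (Real.measurable_exp.comp
    ((measurable_matrix_trace (measurable_matrix_mul hV (measurable_matrix_inv hS))).const_mul _))

theorem iwKer_submatrix {κ : Type*} [Fintype κ] [DecidableEq κ] (e : κ ≃ ι) (r : ℝ)
    (V S : Matrix ι ι ℝ) : iwKer r (V.submatrix e e) (S.submatrix e e) = iwKer r V S := by
  have h : (S.submatrix e e).PosDef ↔ S.PosDef :=
    ⟨fun h => by simpa using h.submatrix e.symm.injective, fun h => h.submatrix e.injective⟩
  unfold iwKer
  rw [inv_submatrix_equiv, submatrix_mul_equiv, det_submatrix_equiv_self]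
  have ht : ((V * S⁻¹).submatrix e e).trace = (V * S⁻¹).trace :=
    Fintype.sum_equiv e _ _ fun i => rfl
  by_cases hS : S.PosDef
  · rw [if_pos (h.2 hS), if_pos hS, ht]
  · rw [if_neg (fun h' => hS (h.1 h')), if_neg hS]

/-- In the coordinates (A, x, z) determinant and trace separate: what remains is an inverse gamma
factor in z and a Gaussian factor in x with covariance z B⁻¹. -/
theorem iwKer_bordered (r : ℝ) {A B : Matrix ι ι ℝ} (hA : A.PosDef) (hB : Bᵀ = B)
    (x y : ι → ℝ) (z w : ℝ) :
    iwKer r (bordered B y w) (bordered A x z) =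
      (Set.Ioi (0 : ℝ)).indicator (fun z => A.det ^ r * z ^ r *
        (Real.exp (-(1 / 2) * (B * A⁻¹).trace) *
          Real.exp (-(w / 2 / z)) * Real.exp (-(1 / 2) * ((y - x) ⬝ᵥ B *ᵥ (y - x) / z)))) z := by
  unfold iwKer
  simp only [posDef_bordered_iff hA]
  by_cases hz : 0 < z
  · rw [if_pos hz, Set.indicator_of_mem (show z ∈ Set.Ioi (0 : ℝ) from hz),
      det_bordered (transpose_eq_self hA), Real.mul_rpow hA.det_pos.le hz.le,
      trace_bordered_mul_inv hA hB _ _ hz.ne', ← Real.exp_add, ← Real.exp_add]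
    congr 2
    ring
  · rw [if_neg hz, Set.indicator_of_notMem (show z ∉ Set.Ioi (0 : ℝ) from hz)]

/-- Up to normalisation the integrand is the normal density with mean y and covariance z B⁻¹. -/
theorem lintegral_exp_quadratic {B : Matrix ι ι ℝ} (hB : B.PosDef) (y : ι → ℝ) {z : ℝ}
    (hz : 0 < z) :
    ∫⁻ x : ι → ℝ, ENNReal.ofReal (Real.exp (-(1 / 2) * ((y - x) ⬝ᵥ B *ᵥ (y - x) / z))) =
      ENNReal.ofReal ((2 * Real.pi) ^ ((Fintype.card ι : ℝ) / 2) * z ^ ((Fintype.card ι : ℝ) / 2) *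
        B.det ^ (-(1 : ℝ) / 2)) := by
  have hd := hB.det_pos
  have hu : IsUnit B.det := isUnit_iff_ne_zero.2 hd.ne'
  have hS : (z • B⁻¹).PosDef := hB.inv.smul hz
  have hSi : (z • B⁻¹)⁻¹ = z⁻¹ • B := by
    refine inv_eq_right_inv ?_
    rw [Matrix.smul_mul, Matrix.mul_smul, nonsing_inv_mul _ hu, smul_smul,
      mul_inv_cancel₀ hz.ne', one_smul]
  have hdet : (z • B⁻¹).det ^ (-(1 : ℝ) / 2) =
      z ^ (-((Fintype.card ι : ℝ) / 2)) * B.det ^ ((1 : ℝ) / 2) := by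
    rw [det_smul, det_nonsing_inv, Ring.inverse_eq_inv', Real.mul_rpow (by positivity)
      (by positivity), ← Real.rpow_natCast, ← Real.rpow_mul hz.le, Real.inv_rpow hd.le,
      ← Real.rpow_neg hd.le]
    congr 2 <;> ring
  have h := lintegral_gaussPdf y hS
  have e : ∀ x : ι → ℝ, ENNReal.ofReal (Real.exp (-(1 / 2) * ((y - x) ⬝ᵥ B *ᵥ (y - x) / z))) =
      ENNReal.ofReal ((2 * Real.pi) ^ ((Fintype.card ι : ℝ) / 2) *
        z ^ ((Fintype.card ι : ℝ) / 2) * B.det ^ (-(1 : ℝ) / 2)) *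
        ENNReal.ofReal (gaussPdf y (z • B⁻¹) x) := by
    intro x
    rw [← ENNReal.ofReal_mul (by positivity), gaussPdf, hdet, hSi]
    congr 1
    have e1 : (x - y) ⬝ᵥ ((z⁻¹ • B) *ᵥ (x - y)) = (y - x) ⬝ᵥ B *ᵥ (y - x) / z := by
      rw [← neg_sub y x, mulVec_neg, neg_dotProduct, dotProduct_neg, neg_neg, smul_mulVec,
        dotProduct_smul, smul_eq_mul]
      ring
    rw [e1]
    have c1 : (2 * Real.pi) ^ ((Fintype.card ι : ℝ) / 2) *
        (2 * Real.pi) ^ (-(Fintype.card ι : ℝ) / 2) = 1 := by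
      rw [← Real.rpow_add (by positivity)]; ring_nf; simp
    have c2 : z ^ ((Fintype.card ι : ℝ) / 2) * z ^ (-((Fintype.card ι : ℝ) / 2)) = 1 := by
      rw [← Real.rpow_add hz]; ring_nf; simp
    have c3 : B.det ^ (-(1 : ℝ) / 2) * B.det ^ ((1 : ℝ) / 2) = 1 := by
      rw [← Real.rpow_add hd]; ring_nf; simp
    set E := Real.exp (-(1 / 2) * ((y - x) ⬝ᵥ B *ᵥ (y - x) / z))
    calc E = ((2 * Real.pi) ^ ((Fintype.card ι : ℝ) / 2) *
        (2 * Real.pi) ^ (-(Fintype.card ι : ℝ) / 2)) *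
        (z ^ ((Fintype.card ι : ℝ) / 2) * z ^ (-((Fintype.card ι : ℝ) / 2))) *
        (B.det ^ (-(1 : ℝ) / 2) * B.det ^ ((1 : ℝ) / 2)) * E := by
          rw [c1, c2, c3, one_mul, one_mul, one_mul]
      _ = _ := by ring
  simp_rw [e]
  rw [lintegral_const_mul' _ _ ENNReal.ofReal_ne_top, h, mul_one]

/-- Integrating the inverse-Wishart kernel over the last row and column. -/
theorem lintegral_iwKer_bordered {A B : Matrix ι ι ℝ} (hA : A.PosDef) (hB : B.PosDef)
    (y : ι → ℝ) {w : ℝ} (hw : 0 < w) {ν : ℝ} (hν : 0 < ν) :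
    ∫⁻ z : ℝ, ∫⁻ x : ι → ℝ, ENNReal.ofReal
        (iwKer (-(ν + Fintype.card ι + 2) / 2) (bordered B y w) (bordered A x z)) =
      ENNReal.ofReal (A.det ^ (-(ν + Fintype.card ι + 2) / 2) *
        Real.exp (-(1 / 2) * (B * A⁻¹).trace) *
        ((2 * Real.pi) ^ ((Fintype.card ι : ℝ) / 2) * B.det ^ (-(1 : ℝ) / 2) *
          (Real.Gamma (ν / 2) * (w / 2) ^ (-(ν / 2))))) := by
  have hAd := hA.det_pos
  have hBd := hB.det_pos
  set r := -(ν + Fintype.card ι + 2) / 2 with hr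
  set K := A.det ^ r * Real.exp (-(1 / 2) * (B * A⁻¹).trace) *
    ((2 * Real.pi) ^ ((Fintype.card ι : ℝ) / 2) * B.det ^ (-(1 : ℝ) / 2)) with hK
  have hK0 : 0 ≤ K := by positivity
  have e : ∀ z : ℝ, ∫⁻ x : ι → ℝ, ENNReal.ofReal
        (iwKer r (bordered B y w) (bordered A x z)) =
      (Set.Ioi (0 : ℝ)).indicator (fun z => ENNReal.ofReal K *
        ENNReal.ofReal (z ^ (-(ν / 2) - 1) * Real.exp (-(w / 2 / z)))) z := by
    intro z
    simp_rw [iwKer_bordered r hA (transpose_eq_self hB)]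
    by_cases hz : 0 < z
    · have hz' : z ∈ Set.Ioi (0 : ℝ) := hz
      simp_rw [Set.indicator_of_mem hz']
      have e2 : ∀ x : ι → ℝ, ENNReal.ofReal (A.det ^ r * z ^ r *
          (Real.exp (-(1 / 2) * (B * A⁻¹).trace) * Real.exp (-(w / 2 / z)) *
            Real.exp (-(1 / 2) * ((y - x) ⬝ᵥ B *ᵥ (y - x) / z)))) =
          ENNReal.ofReal (A.det ^ r * z ^ r *
          (Real.exp (-(1 / 2) * (B * A⁻¹).trace) * Real.exp (-(w / 2 / z)))) *
          ENNReal.ofReal (Real.exp (-(1 / 2) * ((y - x) ⬝ᵥ B *ᵥ (y - x) / z))) := by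
        intro x
        rw [← ENNReal.ofReal_mul (by positivity)]
        congr 1
        ring
      simp_rw [e2]
      rw [lintegral_const_mul' _ _ ENNReal.ofReal_ne_top, lintegral_exp_quadratic hB y hz,
        ← ENNReal.ofReal_mul (by positivity), ← ENNReal.ofReal_mul hK0]
      congr 1
      -- The Gaussian integral contributes z to the power k/2, with k the size of A; since r + k/2 =
      -- -ν/2 - 1, an inverse gamma integrand of shape ν/2 and scale w/2 is left.
      have : z ^ (-(ν / 2) - 1) = z ^ r * z ^ ((Fintype.card ι : ℝ) / 2) := by
        rw [← Real.rpow_add hz, hr]; congr 1; ring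
      rw [this, hK]
      ring
    · have hz' : z ∉ Set.Ioi (0 : ℝ) := hz
      simp_rw [Set.indicator_of_notMem hz']
      simp
  simp_rw [e]
  rw [lintegral_indicator measurableSet_Ioi, lintegral_const_mul' _ _ ENNReal.ofReal_ne_top,
    lintegral_inverse_gamma (by positivity) (by positivity), ← ENNReal.ofReal_mul hK0, hK]
  congr 1
  ring

end Kernel

/-! ### Splitting off the last row of a lower triangle. -/

section Split

/-- The index set of the entries on and below the diagonal. -/
abbrev LowerIdx (n : ℕ) : Type := {ij : Fin n × Fin n // ij.2 ≤ ij.1}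

/-- Splitting off the last row of a lower triangle. -/
def lowerIdxSplitFun (n : ℕ) : LowerIdx n ⊕ (Fin n ⊕ Unit) → LowerIdx (n + 1)
  | Sum.inl ij => ⟨(ij.1.1.castSucc, ij.1.2.castSucc), ij.2⟩
  | Sum.inr (Sum.inl j) => ⟨(Fin.last n, j.castSucc), Fin.le_last _⟩
  | Sum.inr (Sum.inr _) => ⟨(Fin.last n, Fin.last n), le_rfl⟩

theorem lowerIdxSplitFun_bijective (n : ℕ) : Function.Bijective (lowerIdxSplitFun n) := by
  constructor
  · rintro (⟨⟨i, j⟩, h⟩ | j | _) (⟨⟨i', j'⟩, h'⟩ | j' | _) e <;>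
      simp_all [lowerIdxSplitFun, Fin.castSucc_ne_last, (Fin.castSucc_ne_last _).symm]
  · rintro ⟨⟨i, j⟩, h⟩
    induction i using Fin.lastCases with
    | last =>
      induction j using Fin.lastCases with
      | last => exact ⟨Sum.inr (Sum.inr ()), rfl⟩
      | cast j => exact ⟨Sum.inr (Sum.inl j), rfl⟩
    | cast i =>
      induction j using Fin.lastCases with
      | last => exact absurd h (not_le.2 (Fin.castSucc_lt_last i))
      | cast j => exact ⟨Sum.inl ⟨(i, j), h⟩, rfl⟩

/-- Splitting off the last row of a lower triangle, as an equivalence. -/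
noncomputable def lowerIdxSplit (n : ℕ) : LowerIdx n ⊕ (Fin n ⊕ Unit) ≃ LowerIdx (n + 1) :=
  Equiv.ofBijective _ (lowerIdxSplitFun_bijective n)

/-- Tonelli after a relabelling of coordinates: u is the smaller triangle, s the last row without
its diagonal entry, c that entry. -/
theorem lintegral_lowerIdx_succ (n : ℕ) {F : (LowerIdx (n + 1) → ℝ) → ℝ≥0∞} (hF : Measurable F) :
    ∫⁻ v, F v = ∫⁻ u : LowerIdx n → ℝ, ∫⁻ s : Fin n → ℝ, ∫⁻ c : ℝ,
      F fun k => Sum.elim u (Sum.elim s fun _ => c) ((lowerIdxSplit n).symm k) := by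
  let G : (LowerIdx n ⊕ (Fin n ⊕ Unit) → ℝ) → ℝ≥0∞ :=
    fun v => F fun k => v ((lowerIdxSplit n).symm k)
  have hG : Measurable G := hF.comp (measurable_pi_lambda _ fun k => measurable_pi_apply _)
  have e1 : ∫⁻ v, F v = ∫⁻ v, G v := by
    rw [← (volume_measurePreserving_piCongrLeft (fun _ => ℝ) (lowerIdxSplit n)).lintegral_comp hF]
    refine lintegral_congr fun v => ?_
    congr 1
    funext k
    obtain ⟨k, rfl⟩ := (lowerIdxSplit n).surjective k
    rw [MeasurableEquiv.coe_piCongrLeft, Equiv.piCongrLeft_apply_apply, Equiv.symm_apply_apply]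
  rw [e1, ← (volume_measurePreserving_sumPiEquivProdPi_symm
    (fun _ : LowerIdx n ⊕ (Fin n ⊕ Unit) => ℝ)).lintegral_comp hG, Measure.volume_eq_prod]
  refine (lintegral_prod _ (hG.comp (MeasurableEquiv.measurable _)).aemeasurable).trans ?_
  refine lintegral_congr fun u => ?_
  have hm : Measurable fun p : Fin n ⊕ Unit → ℝ => G (Sum.elim u p) := by
    refine hG.comp (measurable_pi_lambda _ fun k => ?_)
    rcases k with k | k
    · exact measurable_const
    · exact measurable_pi_apply _
  have e2 : ∀ p : Fin n ⊕ Unit → ℝ, G ((MeasurableEquiv.sumPiEquivProdPi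
      (fun _ : LowerIdx n ⊕ (Fin n ⊕ Unit) => ℝ)).symm (u, p)) = G (Sum.elim u p) := by
    intro p
    congr 1
  refine (lintegral_congr e2).trans ?_
  rw [← (volume_measurePreserving_sumPiEquivProdPi_symm
    (fun _ : Fin n ⊕ Unit => ℝ)).lintegral_comp hm, Measure.volume_eq_prod]
  refine (lintegral_prod _ (hm.comp (MeasurableEquiv.measurable _)).aemeasurable).trans ?_
  refine lintegral_congr fun s => ?_
  have hm2 : Measurable fun p : Unit → ℝ => G (Sum.elim u (Sum.elim s p)) := by
    refine hG.comp (measurable_pi_lambda _ fun k => ?_)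
    rcases k with k | k | k
    · exact measurable_const
    · exact measurable_const
    · exact measurable_pi_apply _
  have e3 : ∀ p : Unit → ℝ, G (Sum.elim u ((MeasurableEquiv.sumPiEquivProdPi
      (fun _ : Fin n ⊕ Unit => ℝ)).symm (s, p))) = G (Sum.elim u (Sum.elim s p)) := by
    intro p
    congr 2
  refine (lintegral_congr e3).trans ?_
  rw [← (volume_preserving_funUnique Unit ℝ).symm.lintegral_comp hm2]
  rfl

/-- The last index is singled out. -/
def finSuccSplit (n : ℕ) : Fin n ⊕ Unit ≃ Fin (n + 1) where
  toFun := Sum.elim Fin.castSucc fun _ => Fin.last n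
  invFun := Fin.lastCases (Sum.inr ()) Sum.inl
  left_inv := by rintro (i | i) <;> simp
  right_inv i := by induction i using Fin.lastCases <;> simp

/-- Links the triangular coordinates to block matrices, which are indexed by a sum type; hence the
reindexing. -/
theorem symOfVech_succ (n : ℕ) (u : LowerIdx n → ℝ) (s : Fin n → ℝ) (c : ℝ) :
    (symOfVech (n + 1) fun k =>
      Sum.elim u (Sum.elim s fun _ => c) ((lowerIdxSplit n).symm k)).submatrix
        (finSuccSplit n) (finSuccSplit n) =
      fromBlocks (symOfVech n u) (replicateCol Unit s) (replicateRow Unit s)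
        (Matrix.of fun _ _ => c) := by
  have key : ∀ k, Sum.elim u (Sum.elim s fun _ => c) ((lowerIdxSplit n).symm
      (lowerIdxSplitFun n k)) = Sum.elim u (Sum.elim s fun _ => c) k := by
    intro k
    rw [show lowerIdxSplitFun n k = lowerIdxSplit n k from rfl, Equiv.symm_apply_apply]
  ext i j
  rcases i with i | i <;> rcases j with j | j
  · simp only [submatrix_apply, finSuccSplit, Equiv.coe_fn_mk, Sum.elim_inl, symOfVech, of_apply,
      fromBlocks_apply₁₁, Fin.castSucc_le_castSucc_iff]
    split_ifs with h
    · exact key (Sum.inl ⟨(i, j), h⟩)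
    · exact key (Sum.inl ⟨(j, i), (not_le.1 h).le⟩)
  · simp only [submatrix_apply, finSuccSplit, Equiv.coe_fn_mk, Sum.elim_inl, Sum.elim_inr,
      symOfVech, of_apply, fromBlocks_apply₁₂]
    rw [dif_neg (not_le.2 (Fin.castSucc_lt_last i))]
    exact key (Sum.inr (Sum.inl i))
  · simp only [submatrix_apply, finSuccSplit, Equiv.coe_fn_mk, Sum.elim_inl, Sum.elim_inr,
      symOfVech, of_apply, fromBlocks_apply₂₁]
    rw [dif_pos (Fin.castSucc_lt_last j).le]
    exact key (Sum.inr (Sum.inl j))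
  · simp only [submatrix_apply, finSuccSplit, Equiv.coe_fn_mk, Sum.elim_inr,
      symOfVech, of_apply, fromBlocks_apply₂₂]
    rw [dif_pos le_rfl]
    exact key (Sum.inr (Sum.inr ()))

end Split

/-! ### The multivariate gamma function and the inverse-Wishart constant. -/

theorem mvGamma_pos (n : ℕ) {a : ℝ} (ha : ((n : ℝ) - 1) / 2 < a) : 0 < mvGamma n a := by
  refine mul_pos (by positivity) (Finset.prod_pos fun i _ => Real.Gamma_pos_of_pos ?_)
  have : ((i : ℕ) : ℝ) + 1 ≤ n := by exact_mod_cast i.2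
  linarith

/-- The factor i = 0 is split off and the remaining arguments drop by 1/2. This matches the
induction on the dimension, in which ν becomes ν - 1. -/
theorem mvGamma_succ (n : ℕ) (a : ℝ) :
    mvGamma (n + 1) a = Real.pi ^ ((n : ℝ) / 2) * Real.Gamma a * mvGamma n (a - 1 / 2) := by
  unfold mvGamma
  rw [Fin.prod_univ_succ]
  have e : ∀ i : Fin n, Real.Gamma (a - ((i.succ : Fin (n + 1)) : ℕ) / 2) =
      Real.Gamma (a - 1 / 2 - (i : ℕ) / 2) := by
    intro i
    congr 1
    simp only [Fin.val_succ]
    push_cast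
    ring
  simp only [e]
  have e2 : Real.pi ^ (((n + 1 : ℕ) : ℝ) * (((n + 1 : ℕ) : ℝ) - 1) / 4) =
      Real.pi ^ ((n : ℝ) / 2) * Real.pi ^ ((n : ℝ) * ((n : ℝ) - 1) / 4) := by
    rw [← Real.rpow_add Real.pi_pos]
    congr 1
    push_cast
    ring
  rw [e2]
  simp
  ring

/-- The normalising constant of the inverse-Wishart distribution. -/
theorem lintegral_iwKer (n : ℕ) : ∀ {ν : ℝ}, (n : ℝ) - 1 < ν →
    ∀ {V : Matrix (Fin n) (Fin n) ℝ}, V.PosDef →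
    ∫⁻ S, ENNReal.ofReal (iwKer (-(ν + n + 1) / 2) V S) ∂symVolume n =
      ENNReal.ofReal (mvGamma n (ν / 2) * 2 ^ ((n : ℝ) * ν / 2) * V.det ^ (-(ν / 2))) := by
  have hmeas : ∀ (m : ℕ) (r : ℝ) (V : Matrix (Fin m) (Fin m) ℝ),
      Measurable fun S => ENNReal.ofReal (iwKer r V S) := fun m r V =>
    (measurable_iwKer r measurable_const measurable_id).ennreal_ofReal
  induction n with
  | zero =>
    intro ν _ V _
    rw [symVolume, lintegral_map (hmeas _ _ _) (measurable_symOfVech 0)]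
    -- In dimension zero the only matrix is the identity, which is positive definite, with
    -- determinant 1 and trace 0.
    have : ∀ S : Matrix (Fin 0) (Fin 0) ℝ, iwKer (-(ν + (0 : ℕ) + 1) / 2) V S = 1 := by
      intro S
      have hS : S.PosDef := by
        rw [Subsingleton.elim S 1]; exact Matrix.PosDef.one
      rw [iwKer, if_pos hS]
      simp [Matrix.trace]
    simp_rw [this]
    simp [mvGamma, volume_pi, Measure.pi_of_empty]
  | succ n ih =>
    intro ν hν V hV
    push_cast at hν
    have hν0 : 0 < ν := by
      have : (0 : ℝ) ≤ n := Nat.cast_nonneg n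
      linarith
    set V' := V.submatrix (finSuccSplit n) (finSuccSplit n) with hV'
    have hVp : V'.PosDef := hV.submatrix (finSuccSplit n).injective
    obtain ⟨hB, y, w, hw, hVe⟩ := eq_bordered hVp
    set B := V'.toBlocks₁₁
    have hBd := hB.det_pos
    have hdet : V.det = B.det * w := by
      rw [← det_submatrix_equiv_self (finSuccSplit n) V, ← hV', hVe,
        det_bordered (transpose_eq_self hB)]
    rw [symVolume, lintegral_map (hmeas _ _ _) (measurable_symOfVech _)]
    refine (lintegral_lowerIdx_succ n ((hmeas _ _ _).comp (measurable_symOfVech _))).trans ?_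
    set r : ℝ := -(ν + (n + 1 : ℕ) + 1) / 2 with hr
    have hr' : r = -(ν + Fintype.card (Fin n) + 2) / 2 := by
      rw [hr, Fintype.card_fin]; push_cast; ring
    set K : ℝ := (2 * Real.pi) ^ ((n : ℝ) / 2) * B.det ^ (-(1 : ℝ) / 2) *
      (Real.Gamma (ν / 2) * (w / 2) ^ (-(ν / 2))) with hK
    have hK0 : 0 ≤ K := by positivity
    have inner : ∀ u : LowerIdx n → ℝ, ∫⁻ s : Fin n → ℝ, ∫⁻ c : ℝ,
        ENNReal.ofReal (iwKer r V (symOfVech (n + 1) fun k =>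
          Sum.elim u (Sum.elim s fun _ => c) ((lowerIdxSplit n).symm k))) =
        ENNReal.ofReal (iwKer (-(ν - 1 + n + 1) / 2) B (symOfVech n u)) * ENNReal.ofReal K := by
      intro u
      set A := symOfVech n u with hA
      have e1 : ∀ s c, iwKer r V (symOfVech (n + 1) fun k =>
          Sum.elim u (Sum.elim s fun _ => c) ((lowerIdxSplit n).symm k)) =
          iwKer r (bordered B y w) (fromBlocks A (replicateCol Unit s) (replicateRow Unit s)
            (Matrix.of fun _ _ => c)) := by
        intro s c
        rw [← iwKer_submatrix (finSuccSplit n), symOfVech_succ, ← hV', ← hVe]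
      simp_rw [e1]
      by_cases hAp : A.PosDef
      · have hAd := hAp.det_pos
        have hm : Measurable fun p : (Fin n → ℝ) × ℝ => ENNReal.ofReal (iwKer r (bordered B y w)
            (fromBlocks A (replicateCol Unit p.1) (replicateRow Unit p.1)
              (Matrix.of fun _ _ => p.2))) := by
          refine (measurable_iwKer r measurable_const ?_).ennreal_ofReal
          refine measurable_matrix fun i j => ?_
          rcases i with i | i <;> rcases j with j | j
          · exact measurable_const
          · exact (measurable_pi_apply i).comp measurable_fst
          · exact (measurable_pi_apply j).comp measurable_fst
          · exact measurable_snd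
        have hbm : Measurable fun p : (Fin n → ℝ) × ℝ =>
            ENNReal.ofReal (iwKer r (bordered B y w) (bordered A p.1 p.2)) := by
          refine (measurable_iwKer r measurable_const ?_).ennreal_ofReal
          have h1 : Measurable fun p : (Fin n → ℝ) × ℝ => A *ᵥ p.1 :=
            measurable_matrix_mulVec measurable_const measurable_fst
          refine measurable_matrix fun i j => ?_
          rcases i with i | i <;> rcases j with j | j
          · exact measurable_const
          · exact (measurable_pi_apply i).comp h1
          · exact (measurable_pi_apply j).comp h1
          · exact measurable_snd.add (measurable_dotProduct measurable_fst h1)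
        -- The border is substituted as s = A x, at the price of the Jacobian det A.
        have e2 := lintegral_comp_mulVec hAd.ne' (Measurable.lintegral_prod_right' (ν := volume) hm)
        have e3 : ∀ x : Fin n → ℝ, ∫⁻ c : ℝ, ENNReal.ofReal (iwKer r (bordered B y w)
            (fromBlocks A (replicateCol Unit (A *ᵥ x)) (replicateRow Unit (A *ᵥ x))
              (Matrix.of fun _ _ => c))) =
            ∫⁻ z : ℝ, ENNReal.ofReal (iwKer r (bordered B y w) (bordered A x z)) := by
          intro x
          -- For fixed x, the corner entry is translated to the Schur complement coordinate: c = z +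
          -- xᵀ A x.
          rw [← lintegral_add_right_eq_self _ (x ⬝ᵥ A *ᵥ x)]
          rfl
        simp only at e2
        simp_rw [e3] at e2
        -- The Gaussian variance depends on z, so x has to be integrated first.
        rw [lintegral_lintegral_swap hbm.aemeasurable, hr',
          lintegral_iwKer_bordered hAp hB y hw hν0, ← hr', abs_of_pos hAd,
          Fintype.card_fin] at e2
        have e4 : ∀ X : ℝ≥0∞, X = ENNReal.ofReal A.det * (ENNReal.ofReal A.det⁻¹ * X) := by
          intro X
          rw [← mul_assoc, ← ENNReal.ofReal_mul hAd.le, mul_inv_cancel₀ hAd.ne',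
            ENNReal.ofReal_one, one_mul]
        rw [e4 (∫⁻ s : Fin n → ℝ, _), ← e2, ← ENNReal.ofReal_mul hAd.le,
          ← ENNReal.ofReal_mul (iwKer_nonneg _ _ _), iwKer, if_pos hAp]
        congr 1
        -- The Jacobian raises the exponent of det A by one, from r to the exponent belonging to
        -- dimension n and ν - 1 degrees of freedom.
        have e5 : A.det ^ (-(ν - 1 + n + 1) / 2) = A.det * A.det ^ r := by
          rw [← Real.rpow_one_add' hAd.le]
          · congr 1
            rw [hr]; push_cast; ring
          · rw [hr]
            push_cast
            have : (0 : ℝ) ≤ n := Nat.cast_nonneg n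
            linarith
        rw [e5, hK]
        ring
      · rw [iwKer, if_neg hAp]
        -- A positive definite matrix has a positive definite leading block, so nothing is
        -- contributed when A is not.
        have e6 : ∀ s c, iwKer r (bordered B y w) (fromBlocks A (replicateCol Unit s)
            (replicateRow Unit s) (Matrix.of fun _ _ => c)) = 0 := by
          intro s c
          rw [iwKer, if_neg]
          intro h
          exact hAp (h.submatrix (e := Sum.inl) Sum.inl_injective)
        simp_rw [e6]
        simp
    simp only [Function.comp_def] at *
    simp_rw [inner]
    have hih := ih (ν := ν - 1) (by linarith) hB
    rw [symVolume, lintegral_map (hmeas _ _ _) (measurable_symOfVech _)] at hih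
    rw [lintegral_mul_const' _ _ ENNReal.ofReal_ne_top, hih,
      ← ENNReal.ofReal_mul' hK0]
    congr 1
    rw [mvGamma_succ, hdet, hK, Real.mul_rpow hBd.le hw.le, Real.mul_rpow (by norm_num)
      Real.pi_pos.le, Real.div_rpow hw.le (by norm_num)]
    have t1 : B.det ^ (-(ν / 2)) = B.det ^ (-((ν - 1) / 2)) * B.det ^ (-(1 : ℝ) / 2) := by
      rw [← Real.rpow_add hBd]; congr 1; ring
    have t2 : (2 : ℝ) ^ (((n + 1 : ℕ) : ℝ) * ν / 2) =
        2 ^ ((n : ℝ) * (ν - 1) / 2) * 2 ^ ((n : ℝ) / 2) / 2 ^ (-(ν / 2)) := by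
      rw [← Real.rpow_add (by norm_num), ← Real.rpow_sub (by norm_num)]
      congr 1
      push_cast
      ring
    rw [t1, t2, show ν / 2 - 1 / 2 = (ν - 1) / 2 by ring]
    ring

/-! ### Completing the square; the matrix B̄. -/

section Algebra

variable {n l p t N : ℕ} (H : Fin N → Hyper n l p) (x : Sample n l p t) (σ : Fin t → Fin N)
  (j : Fin N)

theorem posSemidef_mul_transpose {a b : Type*} [Fintype a] [Fintype b] (A : Matrix a b ℝ) :
    (A * Aᵀ).PosSemidef := by
  rw [← conjTranspose_eq_transpose_of_trivial]
  exact posSemidef_self_mul_conjTranspose A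

theorem LamPost_posDef : (LamPost H x σ j).PosDef :=
  (H j).Lam0_posDef.inv.posSemidef_add (posSemidef_mul_transpose _)

theorem isUnit_det {ι : Type*} [Fintype ι] [DecidableEq ι] {A : Matrix ι ι ℝ} (hA : A.PosDef) :
    IsUnit A.det := isUnit_iff_ne_zero.2 hA.det_pos.ne'

theorem Cmat_mul_LamPost : Cmat H x σ j * LamPost H x σ j =
    obsMat x σ j * (regMat x σ j)ᵀ + circ (H j).pi0 * (H j).Lam0⁻¹ := by
  rw [Cmat, Matrix.mul_assoc, nonsing_inv_mul _ (isUnit_det (LamPost_posDef H x σ j)),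
    Matrix.mul_one]

theorem LamPost_mul_Cmat_transpose : LamPost H x σ j * (Cmat H x σ j)ᵀ =
    regMat x σ j * (obsMat x σ j)ᵀ + (H j).Lam0⁻¹ * (circ (H j).pi0)ᵀ := by
  have h := congrArg Matrix.transpose (Cmat_mul_LamPost H x σ j)
  rwa [transpose_mul, transpose_eq_self (LamPost_posDef H x σ j), transpose_add, transpose_mul,
    transpose_mul, transpose_transpose, transpose_eq_self (H j).Lam0_posDef.inv] at h

/-- Completing the square in the coefficient matrix. -/
theorem residual_add_prior (Q : Matrix (Fin n) (Reg n l p) ℝ) :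
    (obsMat x σ j - Q * regMat x σ j) * (obsMat x σ j - Q * regMat x σ j)ᵀ +
        (Q - circ (H j).pi0) * (H j).Lam0⁻¹ * (Q - circ (H j).pi0)ᵀ =
      (Q - Cmat H x σ j) * LamPost H x σ j * (Q - Cmat H x σ j)ᵀ + Bbar H x σ j := by
  have e : (Q - Cmat H x σ j) * LamPost H x σ j * (Q - Cmat H x σ j)ᵀ =
      Q * LamPost H x σ j * Qᵀ - Q * (LamPost H x σ j * (Cmat H x σ j)ᵀ) -
        (Cmat H x σ j * LamPost H x σ j) * Qᵀ +
        Cmat H x σ j * LamPost H x σ j * (Cmat H x σ j)ᵀ := by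
    simp only [Matrix.sub_mul, Matrix.mul_sub, transpose_sub, Matrix.mul_assoc]
    abel
  rw [Bbar, e, Cmat_mul_LamPost, LamPost_mul_Cmat_transpose, LamPost]
  simp only [Matrix.sub_mul, Matrix.mul_sub, transpose_sub, transpose_mul, Matrix.mul_add,
    Matrix.add_mul, Matrix.mul_assoc]
  abel

theorem one_add_posDef {q : Type*} [Fintype q] [DecidableEq q] {a : Type*} [Fintype a]
    {A : Matrix a a ℝ} (hA : A.PosSemidef) (Y : Matrix a q ℝ) : (1 + Yᵀ * A * Y).PosDef := by
  refine Matrix.PosDef.one.add_posSemidef ?_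
  rw [← conjTranspose_eq_transpose_of_trivial]
  exact hA.conjTranspose_mul_mul_same Y

/-- Evaluating the completed square at the prior mean kills the prior term. With C - π₀° = R Yᵀ
Λ_{j|t}⁻¹ it leaves R (1 - Yᵀ Λ_{j|t}⁻¹ Y) Rᵀ, and the middle factor is the required inverse by the
Woodbury identity. -/
theorem Bbar_eq : Bbar H x σ j =
    (obsMat x σ j - circ (H j).pi0 * regMat x σ j) *
      (1 + (regMat x σ j)ᵀ * (H j).Lam0 * regMat x σ j)⁻¹ *
      (obsMat x σ j - circ (H j).pi0 * regMat x σ j)ᵀ := by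
  have hL := isUnit_det (LamPost_posDef H x σ j)
  have hL0 := isUnit_det (H j).Lam0_posDef
  set Y := regMat x σ j with hY
  set L := LamPost H x σ j with hLdef
  set R := obsMat x σ j - circ (H j).pi0 * Y with hR
  have hinv : (1 + Yᵀ * (H j).Lam0 * Y)⁻¹ = 1 - Yᵀ * L⁻¹ * Y := by
    refine inv_eq_left_inv ?_
    -- Replacing Y Yᵀ by the difference of posterior and prior precision makes the cross term
    -- telescope.
    have e1 : Y * Yᵀ = L - (H j).Lam0⁻¹ := by rw [hLdef, LamPost]; abel
    have e2 : Yᵀ * L⁻¹ * Y * (Yᵀ * (H j).Lam0 * Y) =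
        Yᵀ * (H j).Lam0 * Y - Yᵀ * L⁻¹ * Y := by
      calc Yᵀ * L⁻¹ * Y * (Yᵀ * (H j).Lam0 * Y)
          = Yᵀ * (L⁻¹ * (Y * Yᵀ) * (H j).Lam0) * Y := by simp only [Matrix.mul_assoc]
        _ = _ := by
          rw [e1, Matrix.mul_sub, nonsing_inv_mul _ hL, Matrix.sub_mul, Matrix.one_mul,
            Matrix.mul_assoc L⁻¹, nonsing_inv_mul _ hL0, Matrix.mul_one, Matrix.mul_sub,
            Matrix.sub_mul]
    rw [Matrix.sub_mul, Matrix.mul_add, Matrix.mul_add, e2]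
    simp
  have hC : Cmat H x σ j - circ (H j).pi0 = R * Yᵀ * L⁻¹ := by
    have : (Cmat H x σ j - circ (H j).pi0) * L = R * Yᵀ := by
      rw [Matrix.sub_mul, hLdef, Cmat_mul_LamPost, LamPost, hR]
      simp only [Matrix.mul_add, Matrix.sub_mul, Matrix.mul_assoc, ← hY]
      abel
    rw [← this, Matrix.mul_assoc, mul_nonsing_inv _ hL, Matrix.mul_one]
  have key := residual_add_prior H x σ j (circ (H j).pi0)
  rw [sub_self, Matrix.zero_mul, Matrix.zero_mul, add_zero, ← neg_sub (Cmat H x σ j), ← hY, ← hR,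
    hC, ← hLdef] at key
  rw [hinv, ← sub_eq_of_eq_add' key]
  simp only [Matrix.mul_sub, Matrix.sub_mul, Matrix.mul_one, transpose_neg, transpose_mul,
    transpose_transpose, Matrix.neg_mul, Matrix.mul_neg, neg_neg]
  rw [Matrix.mul_assoc (R * Yᵀ) L⁻¹ L, nonsing_inv_mul _ hL, Matrix.mul_one, hLdef,
    transpose_eq_self (LamPost_posDef H x σ j).inv]
  simp only [Matrix.mul_assoc]

/-- Invisible in the definition, which is a difference; the second expression is a congruence of a
positive definite matrix. -/
theorem Bbar_posSemidef : (Bbar H x σ j).PosSemidef := by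
  rw [Bbar_eq, ← conjTranspose_eq_transpose_of_trivial (obsMat x σ j - _)]
  exact (one_add_posDef (H j).Lam0_posDef.posSemidef _).inv.posSemidef.mul_mul_conjTranspose_same _

theorem Bbar_add_posDef : (Bbar H x σ j + (H j).V0).PosDef :=
  (H j).V0_posDef.posSemidef_add (Bbar_posSemidef H x σ j)

end Algebra

/-! ### Normal-inverse-Wishart and matrix-Student densities. -/

section Densities

variable {n l p : ℕ}

theorem vec_circ (v : CoefVec n l p) : (circ v).vec = v := rfl

theorem circ_vec (M : Matrix (Fin n) (Reg n l p) ℝ) : circ M.vec = M := rfl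

theorem circ_sub (v w : CoefVec n l p) : circ (v - w) = circ v - circ w := rfl

theorem card_reg : (Fintype.card (Reg n l p) : ℝ) = ((l + n * p : ℕ) : ℝ) := by
  simp [mul_comm]

/-- The vec identity (K ⊗ S)⁻¹ vec M = vec(S⁻¹ M K⁻¹) turns the quadratic form into a trace, which
can be added to the inverse-Wishart exponent. -/
theorem dotProduct_kronecker_inv {K : Matrix (Reg n l p) (Reg n l p) ℝ} (hK : K.PosDef)
    (S : Matrix (Fin n) (Fin n) ℝ) (v : CoefVec n l p) :
    v ⬝ᵥ ((K ⊗ₖ S)⁻¹ *ᵥ v) = (S⁻¹ * (circ v * K⁻¹ * (circ v)ᵀ)).trace := by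
  have h : (K ⊗ₖ S)⁻¹ *ᵥ (circ v).vec = (S⁻¹ * circ v * K⁻¹).vec := by
    rw [inv_kronecker, kronecker_mulVec_vec, transpose_eq_self hK.inv]
  calc v ⬝ᵥ ((K ⊗ₖ S)⁻¹ *ᵥ v) = (circ v).vec ⬝ᵥ ((K ⊗ₖ S)⁻¹ *ᵥ (circ v).vec) := rfl
    _ = _ := by
      rw [h, vec_dotProduct_vec, trace_mul_comm]
      simp only [Matrix.mul_assoc]

/-- The matrix-normal form of the density, with the determinant of the Kronecker product separated
into powers of |K| and |S|. -/
theorem gaussPdf_kronecker (m : CoefVec n l p) {K : Matrix (Reg n l p) (Reg n l p) ℝ}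
    (hK : K.PosDef) {S : Matrix (Fin n) (Fin n) ℝ} (hS : S.PosDef) (v : CoefVec n l p) :
    gaussPdf m (K ⊗ₖ S) v =
      (2 * Real.pi) ^ (-((n : ℝ) * ((l + n * p : ℕ) : ℝ) / 2)) *
        (K.det ^ (-((n : ℝ) / 2)) * S.det ^ (-(((l + n * p : ℕ) : ℝ) / 2))) *
        Real.exp (-(1 / 2) *
          (S⁻¹ * ((circ v - circ m) * K⁻¹ * (circ v - circ m)ᵀ)).trace) := by
  have hKd := hK.det_pos
  have hSd := hS.det_pos
  have hdet : (K ⊗ₖ S).det ^ (-(1 : ℝ) / 2) =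
      K.det ^ (-((n : ℝ) / 2)) * S.det ^ (-(((l + n * p : ℕ) : ℝ) / 2)) := by
    rw [det_kronecker, Real.mul_rpow (by positivity) (by positivity), ← Real.rpow_natCast,
      ← Real.rpow_natCast, ← Real.rpow_mul hKd.le, ← Real.rpow_mul hSd.le, card_reg,
      Fintype.card_fin]
    congr 2 <;> ring
  rw [gaussPdf, dotProduct_kronecker_inv hK, circ_sub, hdet, Fintype.card_prod, Nat.cast_mul,
    card_reg, Fintype.card_fin]
  congr 3
  ring

/-- The normal-inverse-Wishart density. -/
noncomputable def niwPdf (m : CoefVec n l p) (K : Matrix (Reg n l p) (Reg n l p) ℝ) (ν : ℝ)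
    (V : Matrix (Fin n) (Fin n) ℝ) (v : CoefVec n l p) (S : Matrix (Fin n) (Fin n) ℝ) : ℝ :=
  gaussPdf m (K ⊗ₖ S) v * iwPdf n ν V S

theorem iwPdf_of_posDef (ν : ℝ) (V : Matrix (Fin n) (Fin n) ℝ) {S : Matrix (Fin n) (Fin n) ℝ}
    (hS : S.PosDef) : iwPdf n ν V S =
      V.det ^ (ν / 2) / (mvGamma n (ν / 2) * 2 ^ ((n : ℝ) * ν / 2)) *
        S.det ^ (-(ν + n + 1) / 2) * Real.exp (-(1 / 2) * (V * S⁻¹).trace) :=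
  if_pos hS

theorem iwPdf_of_not_posDef (ν : ℝ) (V : Matrix (Fin n) (Fin n) ℝ) {S : Matrix (Fin n) (Fin n) ℝ}
    (hS : ¬ S.PosDef) : iwPdf n ν V S = 0 :=
  if_neg hS

theorem iwPdf_eq (ν : ℝ) (V S : Matrix (Fin n) (Fin n) ℝ) : iwPdf n ν V S =
    V.det ^ (ν / 2) / (mvGamma n (ν / 2) * 2 ^ ((n : ℝ) * ν / 2)) *
      iwKer (-(ν + n + 1) / 2) V S := by
  by_cases hS : S.PosDef
  · rw [iwPdf_of_posDef _ _ hS, iwKer, if_pos hS, mul_assoc]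
  · rw [iwPdf_of_not_posDef _ _ hS, iwKer, if_neg hS, mul_zero]

theorem iwPdf_nonneg {ν : ℝ} (hν : (n : ℝ) - 1 < ν) {V : Matrix (Fin n) (Fin n) ℝ}
    (hV : V.PosDef) (S : Matrix (Fin n) (Fin n) ℝ) : 0 ≤ iwPdf n ν V S := by
  have := hV.det_pos
  have := mvGamma_pos n (a := ν / 2) (by linarith)
  have := iwKer_nonneg (-(ν + n + 1) / 2) V S
  rw [iwPdf_eq]
  positivity

theorem measurable_iwPdf {X : Type*} [MeasurableSpace X] (ν : ℝ)
    {V S : X → Matrix (Fin n) (Fin n) ℝ} (hV : Measurable V) (hS : Measurable S) :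
    Measurable fun x => iwPdf n ν (V x) (S x) := by
  simp only [iwPdf_eq]
  exact (((measurable_matrix_det hV).pow_const _).div_const _).mul (measurable_iwKer _ hV hS)

theorem lintegral_iwPdf {ν : ℝ} (hν : (n : ℝ) - 1 < ν) {V : Matrix (Fin n) (Fin n) ℝ}
    (hV : V.PosDef) : ∫⁻ S, ENNReal.ofReal (iwPdf n ν V S) ∂symVolume n = 1 := by
  have h1 := hV.det_pos
  have h2 := mvGamma_pos n (a := ν / 2) (by linarith)
  simp_rw [iwPdf_eq, ENNReal.ofReal_mul (show 0 ≤ V.det ^ (ν / 2) /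
    (mvGamma n (ν / 2) * 2 ^ ((n : ℝ) * ν / 2)) by positivity)]
  rw [lintegral_const_mul' _ _ ENNReal.ofReal_ne_top, lintegral_iwKer n hν hV,
    ← ENNReal.ofReal_mul (by positivity), Real.rpow_neg h1.le, ← ENNReal.ofReal_one]
  congr 1
  field_simp

theorem niwPdf_nonneg (m : CoefVec n l p) {K : Matrix (Reg n l p) (Reg n l p) ℝ}
    (hK : K.PosDef) {ν : ℝ} (hν : (n : ℝ) - 1 < ν) {V : Matrix (Fin n) (Fin n) ℝ}
    (hV : V.PosDef) (v : CoefVec n l p) (S : Matrix (Fin n) (Fin n) ℝ) :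
    0 ≤ niwPdf m K ν V v S := by
  by_cases hS : S.PosDef
  · exact mul_nonneg (gaussPdf_nonneg _ (hK.kronecker hS) _) (iwPdf_nonneg hν hV _)
  · rw [niwPdf, iwPdf_of_not_posDef _ _ hS, mul_zero]

theorem measurable_niwPdf {X : Type*} [MeasurableSpace X] {m v : X → CoefVec n l p}
    {K : X → Matrix (Reg n l p) (Reg n l p) ℝ} (ν : ℝ) {V S : X → Matrix (Fin n) (Fin n) ℝ}
    (hm : Measurable m) (hK : Measurable K) (hV : Measurable V) (hv : Measurable v)
    (hS : Measurable S) : Measurable fun x => niwPdf (m x) (K x) ν (V x) (v x) (S x) :=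
  (measurable_gaussPdf hm (measurable_matrix_kronecker hK hS) hv).mul (measurable_iwPdf ν hV hS)

theorem lintegral_niwPdf_coef (m : CoefVec n l p) {K : Matrix (Reg n l p) (Reg n l p) ℝ}
    (hK : K.PosDef) (ν : ℝ) (V S : Matrix (Fin n) (Fin n) ℝ) :
    ∫⁻ v, ENNReal.ofReal (niwPdf m K ν V v S) = ENNReal.ofReal (iwPdf n ν V S) := by
  by_cases hS : S.PosDef
  · simp_rw [niwPdf, ENNReal.ofReal_mul (gaussPdf_nonneg m (hK.kronecker hS) _)]
    rw [lintegral_mul_const' _ _ ENNReal.ofReal_ne_top, lintegral_gaussPdf m (hK.kronecker hS),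
      one_mul]
  · simp [niwPdf, iwPdf_of_not_posDef _ _ hS]

/-- The matrix-variate Student density. -/
noncomputable def studentPdf (C : Matrix (Fin n) (Reg n l p) ℝ)
    (L : Matrix (Reg n l p) (Reg n l p) ℝ) (ν : ℝ) (V : Matrix (Fin n) (Fin n) ℝ)
    (v : CoefVec n l p) : ℝ :=
  (L.det ^ ((n : ℝ) / 2) * V.det ^ (-((l + n * p : ℕ) : ℝ) / 2) *
      mvGamma n ((ν + ((l + n * p : ℕ) : ℝ)) / 2)) /
    (Real.pi ^ ((n : ℝ) * ((l + n * p : ℕ) : ℝ) / 2) * mvGamma n (ν / 2)) *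
  (1 + V⁻¹ * (circ v - C) * L * (circ v - C)ᵀ).det ^ (-(ν + ((l + n * p : ℕ) : ℝ)) / 2)

/-- For fixed coefficients the normal exponent is itself a trace against S⁻¹: it enlarges the scale
matrix, and the power of |S| in front adds d degrees of freedom. -/
theorem niwPdf_eq_iwKer (C : Matrix (Fin n) (Reg n l p) ℝ)
    {L : Matrix (Reg n l p) (Reg n l p) ℝ} (hL : L.PosDef) (ν : ℝ)
    {V : Matrix (Fin n) (Fin n) ℝ} (v : CoefVec n l p) (S : Matrix (Fin n) (Fin n) ℝ) :
    niwPdf C.vec L⁻¹ ν V v S =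
      ((2 * Real.pi) ^ (-((n : ℝ) * ((l + n * p : ℕ) : ℝ) / 2)) * L.det ^ ((n : ℝ) / 2) *
        (V.det ^ (ν / 2) / (mvGamma n (ν / 2) * 2 ^ ((n : ℝ) * ν / 2)))) *
      iwKer (-((ν + ((l + n * p : ℕ) : ℝ)) + n + 1) / 2)
        (V + (circ v - C) * L * (circ v - C)ᵀ) S := by
  have hLd := hL.det_pos
  rw [niwPdf]
  by_cases hS : S.PosDef
  · have hSd := hS.det_pos
    rw [iwPdf_of_posDef _ _ hS, iwKer, if_pos hS, gaussPdf_kronecker _ hL.inv hS, circ_vec,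
      nonsing_inv_nonsing_inv _ (isUnit_det hL), det_nonsing_inv, Ring.inverse_eq_inv',
      Real.inv_rpow hLd.le, ← Real.rpow_neg hLd.le, neg_neg, Matrix.add_mul, trace_add, mul_add,
      Real.exp_add, trace_mul_comm S⁻¹]
    have e : S.det ^ (-((ν + ((l + n * p : ℕ) : ℝ)) + n + 1) / 2) =
        S.det ^ (-(((l + n * p : ℕ) : ℝ) / 2)) * S.det ^ (-(ν + n + 1) / 2) := by
      rw [← Real.rpow_add hSd]; congr 1; ring
    rw [e]
    ring
  · rw [iwPdf_of_not_posDef _ _ hS, iwKer, if_neg hS, mul_zero, mul_zero]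

/-- Integrating the covariance matrix out of a normal-inverse-Wishart density. -/
theorem lintegral_niwPdf_cov (C : Matrix (Fin n) (Reg n l p) ℝ)
    {L : Matrix (Reg n l p) (Reg n l p) ℝ} (hL : L.PosDef) {ν : ℝ} (hν : (n : ℝ) - 1 < ν)
    {V : Matrix (Fin n) (Fin n) ℝ} (hV : V.PosDef) (v : CoefVec n l p) :
    ∫⁻ S, ENNReal.ofReal (niwPdf C.vec L⁻¹ ν V v S) ∂symVolume n =
      ENNReal.ofReal (studentPdf C L ν V v) := by
  have hLd := hL.det_pos
  have hVd := hV.det_pos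
  have hg := mvGamma_pos n (a := ν / 2) (by linarith)
  set d : ℝ := ((l + n * p : ℕ) : ℝ) with hd
  have hd0 : 0 ≤ d := Nat.cast_nonneg _
  have hq : ((circ v - C) * L * (circ v - C)ᵀ).PosSemidef := by
    rw [← conjTranspose_eq_transpose_of_trivial]
    exact hL.posSemidef.mul_mul_conjTranspose_same _
  have hW : (V + (circ v - C) * L * (circ v - C)ᵀ).PosDef := hV.add_posSemidef hq
  -- Taking V out of the determinant produces the factor |1 + V⁻¹ ⋯| of the Student density.
  have hdet : (V + (circ v - C) * L * (circ v - C)ᵀ).det =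
      V.det * (1 + V⁻¹ * (circ v - C) * L * (circ v - C)ᵀ).det := by
    rw [← det_mul, Matrix.mul_add, Matrix.mul_one]
    simp only [← Matrix.mul_assoc]
    rw [mul_nonsing_inv _ (isUnit_det hV), Matrix.one_mul]
  have hpos : 0 < (1 + V⁻¹ * (circ v - C) * L * (circ v - C)ᵀ).det := by
    have := hW.det_pos
    rw [hdet] at this
    exact (mul_pos_iff_of_pos_left hVd).1 this
  simp_rw [niwPdf_eq_iwKer C hL]
  rw [← hd]
  have hc : 0 ≤ (2 * Real.pi) ^ (-((n : ℝ) * d / 2)) * L.det ^ ((n : ℝ) / 2) *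
        (V.det ^ (ν / 2) / (mvGamma n (ν / 2) * 2 ^ ((n : ℝ) * ν / 2))) := by positivity
  simp_rw [ENNReal.ofReal_mul hc]
  rw [lintegral_const_mul' _ _ ENNReal.ofReal_ne_top, lintegral_iwKer n (by linarith) hW,
    ← ENNReal.ofReal_mul hc, hdet, studentPdf, ← hd]
  congr 1
  have e1 : (2 * Real.pi) ^ (-((n : ℝ) * d / 2)) =
      2 ^ (-((n : ℝ) * d / 2)) * (Real.pi ^ ((n : ℝ) * d / 2))⁻¹ := by
    rw [Real.mul_rpow (by norm_num) Real.pi_pos.le, Real.rpow_neg Real.pi_pos.le]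
  have e2 : (2 : ℝ) ^ ((n : ℝ) * (ν + d) / 2) = 2 ^ ((n : ℝ) * ν / 2) * 2 ^ ((n : ℝ) * d / 2) := by
    rw [← Real.rpow_add (by norm_num)]; congr 1; ring
  have e3 : (2 : ℝ) ^ (-((n : ℝ) * d / 2)) * 2 ^ ((n : ℝ) * d / 2) = 1 := by
    rw [← Real.rpow_add (by norm_num)]; simp
  have e4 : V.det ^ (-((ν + d) / 2)) = (V.det ^ (ν / 2))⁻¹ * V.det ^ (-d / 2) := by
    rw [← Real.rpow_neg hVd.le, ← Real.rpow_add hVd]; congr 1; ring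
  rw [Real.mul_rpow hVd.le hpos.le, e1, e2, e4, neg_div]
  have h2 : (0 : ℝ) < 2 ^ ((n : ℝ) * ν / 2) := by positivity
  have hv2 : (0 : ℝ) < V.det ^ (ν / 2) := by positivity
  field_simp
  linear_combination mvGamma n ((ν + d) / 2) * e3

theorem studentPdf_nonneg (C : Matrix (Fin n) (Reg n l p) ℝ)
    {L : Matrix (Reg n l p) (Reg n l p) ℝ} (hL : L.PosDef) {ν : ℝ} (hν : (n : ℝ) - 1 < ν)
    {V : Matrix (Fin n) (Fin n) ℝ} (hV : V.PosDef) (v : CoefVec n l p) :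
    0 ≤ studentPdf C L ν V v := by
  have hLd := hL.det_pos
  have hVd := hV.det_pos
  have hg := mvGamma_pos n (a := ν / 2) (by linarith)
  have hg2 := mvGamma_pos n (a := (ν + ((l + n * p : ℕ) : ℝ)) / 2) (by
    have : (0 : ℝ) ≤ ((l + n * p : ℕ) : ℝ) := Nat.cast_nonneg _
    linarith)
  have hq : ((circ v - C) * L * (circ v - C)ᵀ).PosSemidef := by
    rw [← conjTranspose_eq_transpose_of_trivial]
    exact hL.posSemidef.mul_mul_conjTranspose_same _
  have hW := (hV.add_posSemidef hq).det_pos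
  have hdet : (V + (circ v - C) * L * (circ v - C)ᵀ).det =
      V.det * (1 + V⁻¹ * (circ v - C) * L * (circ v - C)ᵀ).det := by
    rw [← det_mul, Matrix.mul_add, Matrix.mul_one]
    simp only [← Matrix.mul_assoc]
    rw [mul_nonsing_inv _ (isUnit_det hV), Matrix.one_mul]
  rw [hdet] at hW
  have hpos := (mul_pos_iff_of_pos_left hVd).1 hW
  unfold studentPdf
  positivity

end Densities

/-! ### Bayes' formula for one regime and the closed forms. -/

section Posterior

variable {n l p t N : ℕ} (H : Fin N → Hyper n l p) (x : Sample n l p t) (σ : Fin t → Fin N)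
  (j : Fin N)

/-- The prior density of the parameters of one regime. -/
noncomputable def priorPdf (v : CoefVec n l p) (S : Matrix (Fin n) (Fin n) ℝ) : ℝ :=
  niwPdf (H j).pi0 (H j).Lam0 (H j).nu0 (H j).V0 v S

/-- The posterior density of the parameters of one regime. -/
noncomputable def postPdf (v : CoefVec n l p) (S : Matrix (Fin n) (Fin n) ℝ) : ℝ :=
  niwPdf (Cmat H x σ j).vec (LamPost H x σ j)⁻¹ ((H j).nu0 + visitCount σ j)
    (Bbar H x σ j + (H j).V0) v S

/-- The contribution of one regime to the marginal density of the observations. -/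
noncomputable def obsFactor : ℝ :=
  Real.pi ^ (-((n : ℝ) * visitCount σ j / 2)) *
    (((H j).Lam0⁻¹.det ^ ((n : ℝ) / 2) * mvGamma n (((H j).nu0 + visitCount σ j) / 2) *
          (H j).V0.det ^ ((H j).nu0 / 2)) /
        ((LamPost H x σ j).det ^ ((n : ℝ) / 2) * mvGamma n ((H j).nu0 / 2) *
          (Bbar H x σ j + (H j).V0).det ^ (((H j).nu0 + visitCount σ j) / 2)))

theorem nuPost_gt : (n : ℝ) - 1 < (H j).nu0 + visitCount σ j := by
  have h1 := (H j).nu0_gt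
  have h2 : (0 : ℝ) ≤ visitCount σ j := Nat.cast_nonneg _
  linarith

theorem obsFactor_nonneg : 0 ≤ obsFactor H x σ j := by
  have h1 := mvGamma_pos n (a := ((H j).nu0 + visitCount σ j) / 2) (by
    have := nuPost_gt H σ j; linarith)
  have h2 := mvGamma_pos n (a := (H j).nu0 / 2) (by have := (H j).nu0_gt; linarith)
  have h3 := (H j).V0_posDef.det_pos
  have h4 := (Bbar_add_posDef H x σ j).det_pos
  have h5 := (LamPost_posDef H x σ j).det_pos
  have h6 := (H j).Lam0_posDef.inv.det_pos
  unfold obsFactor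
  positivity

theorem priorPdf_nonneg (v : CoefVec n l p) (S : Matrix (Fin n) (Fin n) ℝ) :
    0 ≤ priorPdf H j v S :=
  niwPdf_nonneg _ (H j).Lam0_posDef (H j).nu0_gt (H j).V0_posDef _ _

/-- The quadratic forms of the residual columns add up to one trace. -/
theorem prod_gaussPdf_eq {q : Type*} [Fintype q] {a : Type*} [Fintype a]
    (Q : Matrix (Fin n) a ℝ) (Y : Matrix a q ℝ) (y : Matrix (Fin n) q ℝ)
    {S : Matrix (Fin n) (Fin n) ℝ} (hS : S.PosDef) :
    ∏ u, gaussPdf (Q *ᵥ fun k => Y k u) S (fun i => y i u) =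
      (2 * Real.pi) ^ (-((n : ℝ) * Fintype.card q / 2)) *
        S.det ^ (-((Fintype.card q : ℝ) / 2)) *
        Real.exp (-(1 / 2) * (S⁻¹ * ((y - Q * Y) * (y - Q * Y)ᵀ)).trace) := by
  have hSd := hS.det_pos
  have htr : (S⁻¹ * ((y - Q * Y) * (y - Q * Y)ᵀ)).trace =
      ∑ u, ((fun i => y i u) - Q *ᵥ fun k => Y k u) ⬝ᵥ
        (S⁻¹ *ᵥ ((fun i => y i u) - Q *ᵥ fun k => Y k u)) := by
    rw [← Matrix.mul_assoc, trace_mul_comm]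
    rfl
  simp only [gaussPdf, Finset.prod_mul_distrib, Finset.prod_const, ← Real.exp_sum, htr,
    Finset.mul_sum, Finset.card_univ, Fintype.card_fin]
  rw [← Real.rpow_natCast, ← Real.rpow_natCast, ← Real.rpow_mul (by positivity),
    ← Real.rpow_mul hSd.le]
  congr 3
  · ring
  · ring

/-- Bookkeeping for Bayes' formula: determinant powers, gamma values and powers of 2 and π become
opaque symbols, and `hE` is the completed square in exponential form. -/
theorem normalizing_constants_identity
    {z1 z2 z3 z4 z5 z6 z7 z8 z9 z10 z11 z12 z13 E1 E2 E3 E4 E5 : ℝ}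
    (h2 : z2 ≠ 0) (h5 : z5 ≠ 0) (h6 : z6 ≠ 0) (h12 : z12 ≠ 0)
    (hE : E1 * E2 * E3 = E4 * E5) :
    z2 * z3 * z9 * E1 * (z1 * (z7 * z10) * E2 * (z8 / (z13 * (z2 * z4)) * z11 * E3)) =
      z3 * (z7 * z12 * z8 / (z5 * z13 * z6)) *
        (z1 * (z5 * z10) * E4 * (z6 / (z12 * z4) * (z9 * z11) * E5)) := by
  simp only [div_eq_mul_inv, mul_inv]
  calc _ = (z2 * z2⁻¹) * (z1 * z3 * z7 * z8 * z9 * z10 * z11 * z13⁻¹ * z4⁻¹) *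
        (E1 * E2 * E3) := by ring
    _ = (z5 * z5⁻¹) * (z6 * z6⁻¹) * (z12 * z12⁻¹) *
        (z1 * z3 * z7 * z8 * z9 * z10 * z11 * z13⁻¹ * z4⁻¹) * (E4 * E5) := by
      rw [hE, mul_inv_cancel₀ h2, mul_inv_cancel₀ h5, mul_inv_cancel₀ h6, mul_inv_cancel₀ h12]
      ring
    _ = _ := by ring

/-- Bayes' formula for the parameters of one regime. -/
theorem likelihood_mul_priorPdf (v : CoefVec n l p) (S : Matrix (Fin n) (Fin n) ℝ) :
    (∏ u : {u : Fin t // σ u = j}, gaussPdf (circ v *ᵥ x.regressor u) S (x.y u)) *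
        priorPdf H j v S = obsFactor H x σ j * postPdf H x σ j v S := by
  by_cases hS : S.PosDef
  swap
  · rw [priorPdf, postPdf, niwPdf, niwPdf, iwPdf_of_not_posDef _ _ hS, iwPdf_of_not_posDef _ _ hS]
    ring
  have hSd := hS.det_pos
  have hL := LamPost_posDef H x σ j
  have hLd := hL.det_pos
  have hL0d := (H j).Lam0_posDef.det_pos
  have hBd := (Bbar_add_posDef H x σ j).det_pos
  have hVd := (H j).V0_posDef.det_pos
  have hg := mvGamma_pos n (a := ((H j).nu0 + visitCount σ j) / 2) (by
    have := nuPost_gt H σ j; linarith)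
  have hg0 := mvGamma_pos n (a := (H j).nu0 / 2) (by have := (H j).nu0_gt; linarith)
  have hlik := prod_gaussPdf_eq (circ v) (regMat x σ j) (obsMat x σ j) hS
  have hlik' : (∏ u : {u : Fin t // σ u = j}, gaussPdf (circ v *ᵥ x.regressor u) S (x.y u)) =
      ∏ u, gaussPdf (circ v *ᵥ fun k => regMat x σ j k u) S (fun i => obsMat x σ j i u) := rfl
  have hq : (Fintype.card {u : Fin t // σ u = j} : ℝ) = visitCount σ j := rfl
  rw [hlik', hlik, hq, priorPdf, postPdf, niwPdf, niwPdf, gaussPdf_kronecker _ (H j).Lam0_posDef hS,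
    gaussPdf_kronecker _ hL.inv hS, iwPdf_of_posDef _ _ hS, iwPdf_of_posDef _ _ hS, circ_vec,
    nonsing_inv_nonsing_inv _ (isUnit_det hL), det_nonsing_inv, Ring.inverse_eq_inv',
    Real.inv_rpow hLd.le, ← Real.rpow_neg hLd.le, neg_neg, obsFactor, det_nonsing_inv,
    Ring.inverse_eq_inv', Real.inv_rpow hL0d.le, ← Real.rpow_neg hL0d.le]
  set q : ℝ := (visitCount σ j : ℝ)
  set d : ℝ := ((l + n * p : ℕ) : ℝ)
  set ν := (H j).nu0
  have hexp : Real.exp (-(1 / 2) * (S⁻¹ * ((obsMat x σ j - circ v * regMat x σ j) *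
        (obsMat x σ j - circ v * regMat x σ j)ᵀ)).trace) *
      Real.exp (-(1 / 2) * (S⁻¹ * ((circ v - circ (H j).pi0) * (H j).Lam0⁻¹ *
        (circ v - circ (H j).pi0)ᵀ)).trace) * Real.exp (-(1 / 2) * ((H j).V0 * S⁻¹).trace) =
      Real.exp (-(1 / 2) * (S⁻¹ * ((circ v - Cmat H x σ j) * LamPost H x σ j *
        (circ v - Cmat H x σ j)ᵀ)).trace) *
      Real.exp (-(1 / 2) * ((Bbar H x σ j + (H j).V0) * S⁻¹).trace) := by
    -- The completed square is a matrix identity; multiplying by S⁻¹ and taking traces compares the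
    -- exponents.
    have h := congrArg (fun M => (S⁻¹ * M).trace) (residual_add_prior H x σ j (circ v))
    simp only [Matrix.mul_add, trace_add] at h
    rw [← Real.exp_add, ← Real.exp_add, ← Real.exp_add, Matrix.add_mul, trace_add,
      trace_mul_comm (Bbar H x σ j)]
    congr 1
    linear_combination (-(1 / 2)) * h
  set E1 := Real.exp (-(1 / 2) * (S⁻¹ * ((obsMat x σ j - circ v * regMat x σ j) *
        (obsMat x σ j - circ v * regMat x σ j)ᵀ)).trace)
  set E2 := Real.exp (-(1 / 2) * (S⁻¹ * ((circ v - circ (H j).pi0) * (H j).Lam0⁻¹ *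
        (circ v - circ (H j).pi0)ᵀ)).trace)
  set E3 := Real.exp (-(1 / 2) * ((H j).V0 * S⁻¹).trace)
  set E4 := Real.exp (-(1 / 2) * (S⁻¹ * ((circ v - Cmat H x σ j) * LamPost H x σ j *
        (circ v - Cmat H x σ j)ᵀ)).trace)
  set E5 := Real.exp (-(1 / 2) * ((Bbar H x σ j + (H j).V0) * S⁻¹).trace)
  have p1 : (2 * Real.pi) ^ (-((n : ℝ) * q / 2)) =
      2 ^ (-((n : ℝ) * q / 2)) * Real.pi ^ (-((n : ℝ) * q / 2)) :=
    Real.mul_rpow (by norm_num) Real.pi_pos.le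
  have p2 : (2 : ℝ) ^ (-((n : ℝ) * q / 2)) * 2 ^ ((n : ℝ) * (ν + q) / 2) =
      2 ^ ((n : ℝ) * ν / 2) := by
    rw [← Real.rpow_add (by norm_num)]; congr 1; ring
  have p3 : S.det ^ (-(q / 2)) * S.det ^ (-(ν + n + 1) / 2) = S.det ^ (-(ν + q + n + 1) / 2) := by
    rw [← Real.rpow_add hSd]; congr 1; ring
  rw [p1, ← p2, ← p3]
  have q2 : (0 : ℝ) < 2 ^ (-((n : ℝ) * q / 2)) := by positivity
  have q3 : 0 < (LamPost H x σ j).det ^ ((n : ℝ) / 2) := by positivity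
  have q4 : 0 < (Bbar H x σ j + (H j).V0).det ^ ((ν + q) / 2) := by positivity
  exact normalizing_constants_identity q2.ne' q3.ne' q4.ne' hg.ne' hexp

theorem sum_visitCount : ∑ j ∈ regimes σ, visitCount σ j = t := by
  have := Finset.card_eq_sum_card_image σ (Finset.univ : Finset (Fin t))
  rw [Finset.card_univ, Fintype.card_fin] at this
  conv_rhs => rw [this]
  refine Finset.sum_congr rfl fun j _ => ?_
  rw [visitCount, Fintype.card_subtype]

/-- The visit counts sum to t, so the global power of π can be distributed over the regimes. -/
theorem obsPdf_eq : obsPdf H x σ = ∏ j ∈ regimes σ, obsFactor H x σ j := by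
  have e : Real.pi ^ (-((n : ℝ) * t / 2)) =
      ∏ j ∈ regimes σ, Real.pi ^ (-((n : ℝ) * visitCount σ j / 2)) := by
    rw [← Real.rpow_sum_of_pos Real.pi_pos]
    congr 1
    rw [Finset.sum_neg_distrib, ← Finset.sum_div, ← Finset.mul_sum, ← Nat.cast_sum,
      sum_visitCount]
  simp only [obsFactor]
  rw [Finset.prod_mul_distrib, ← e, Real.rpow_neg Real.pi_pos.le, obsPdf, one_div]

theorem obsPdf_nonneg : 0 ≤ obsPdf H x σ := by
  rw [obsPdf_eq]
  exact Finset.prod_nonneg fun j _ => obsFactor_nonneg H x σ j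

theorem isEmpty_visits {σ : Fin t → Fin N} {j : Fin N} (hj : j ∉ regimes σ) :
    IsEmpty {u : Fin t // σ u = j} :=
  ⟨fun u => hj (Finset.mem_image.2 ⟨u.1, Finset.mem_univ _, u.2⟩)⟩

theorem visitCount_eq_zero {σ : Fin t → Fin N} {j : Fin N} (hj : j ∉ regimes σ) :
    visitCount σ j = 0 := by
  have := isEmpty_visits hj
  exact Fintype.card_eq_zero

theorem mul_eq_zero_of_isEmpty {a b c : Type*} [Fintype b] [IsEmpty b] (A : Matrix a b ℝ)
    (B : Matrix b c ℝ) : A * B = 0 := by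
  ext i k
  simp [Matrix.mul_apply]

/-- The data matrices of an unvisited regime have no columns, so their products vanish. This and the
next lemmas show that such a regime keeps its prior hyperparameters. -/
theorem LamPost_of_notMem {j : Fin N} (hj : j ∉ regimes σ) :
    LamPost H x σ j = (H j).Lam0⁻¹ := by
  have := isEmpty_visits hj
  have h : regMat x σ j * (regMat x σ j)ᵀ = 0 := mul_eq_zero_of_isEmpty _ _
  rw [LamPost, h, zero_add]

theorem Cmat_of_notMem {j : Fin N} (hj : j ∉ regimes σ) :
    Cmat H x σ j = circ (H j).pi0 := by
  have := isEmpty_visits hj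
  have h : obsMat x σ j * (regMat x σ j)ᵀ = 0 := mul_eq_zero_of_isEmpty _ _
  rw [Cmat, h, zero_add, LamPost_of_notMem H x σ hj, Matrix.mul_assoc,
    mul_nonsing_inv _ (isUnit_det (H j).Lam0_posDef.inv), Matrix.mul_one]

theorem Bbar_of_notMem {j : Fin N} (hj : j ∉ regimes σ) : Bbar H x σ j = 0 := by
  have := isEmpty_visits hj
  have h : obsMat x σ j * (obsMat x σ j)ᵀ = 0 := mul_eq_zero_of_isEmpty _ _
  rw [Bbar, h, zero_add, LamPost_of_notMem H x σ hj,
    Cmat_of_notMem H x σ hj, sub_self]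

theorem obsFactor_of_notMem {j : Fin N} (hj : j ∉ regimes σ) : obsFactor H x σ j = 1 := by
  have hg0 := mvGamma_pos n (a := (H j).nu0 / 2) (by have := (H j).nu0_gt; linarith)
  have h1 := (H j).Lam0_posDef.inv.det_pos
  have h2 := (H j).V0_posDef.det_pos
  have h3 : 0 < (H j).Lam0⁻¹.det ^ ((n : ℝ) / 2) := by positivity
  have h4 : 0 < (H j).V0.det ^ ((H j).nu0 / 2) := by positivity
  rw [obsFactor, visitCount_eq_zero hj, LamPost_of_notMem H x σ hj, Bbar_of_notMem H x σ hj]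
  simp only [Nat.cast_zero, add_zero, mul_zero, zero_div, neg_zero, Real.rpow_zero, one_mul,
    zero_add]
  field_simp

/-- Unvisited regimes contribute the factor 1, so Bayes' rule can be run on any larger set of
regimes, in particular on all regimes of a full path. -/
theorem prod_obsFactor {J : Finset (Fin N)} (hJ : regimes σ ⊆ J) :
    ∏ j ∈ J, obsFactor H x σ j = obsPdf H x σ := by
  rw [obsPdf_eq]
  exact (Finset.prod_subset hJ fun j _ hj => obsFactor_of_notMem H x σ hj).symm

theorem seenPdf_eq (v : CoefVec n l p) : seenPdf H x σ j v =
    studentPdf (Cmat H x σ j) (LamPost H x σ j) ((H j).nu0 + visitCount σ j)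
      (Bbar H x σ j + (H j).V0) v := rfl

theorem seenPdf_nonneg (v : CoefVec n l p) : 0 ≤ seenPdf H x σ j v := by
  rw [seenPdf_eq]
  exact studentPdf_nonneg _ (LamPost_posDef H x σ j) (nuPost_gt H σ j) (Bbar_add_posDef H x σ j) _

theorem unseenPdf_eq {j : Fin N} (hj : j ∉ regimes σ) (v : CoefVec n l p) :
    unseenPdf H j v = seenPdf H x σ j v := by
  have h := (H j).Lam0_posDef.det_pos
  rw [unseenPdf, seenPdf, visitCount_eq_zero hj, LamPost_of_notMem H x σ hj,
    Bbar_of_notMem H x σ hj, Cmat_of_notMem H x σ hj, Nat.cast_zero, add_zero, zero_add,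
    det_nonsing_inv, Ring.inverse_eq_inv', Real.inv_rpow h.le, neg_div, Real.rpow_neg h.le]

/-- The densities of seen and unseen regimes are one formula evaluated with or without data, so the
products over γ and δ merge into a product over β. -/
theorem futureCoefPdf_eq {T : ℕ} (ht : t ≤ T) (τ : Fin T → Fin N)
    (v : futureRegimes t τ → CoefVec n l p) :
    futureCoefPdf H x ht τ v =
      ∏ j : futureRegimes t τ, seenPdf H x (firstPart ht τ) j (v j) := by
  classical
  -- The factor is extended to all regimes so that the product can be split along α; the value 1
  -- outside β is never met.
  let g : Fin N → ℝ := fun j => if h : j ∈ futureRegimes t τ then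
    seenPdf H x (firstPart ht τ) j (v ⟨j, h⟩) else 1
  have e1 : ∏ j : futureRegimes t τ, seenPdf H x (firstPart ht τ) j (v j) =
      ∏ j ∈ futureRegimes t τ, g j := by
    rw [← Finset.prod_coe_sort (futureRegimes t τ) g]
    refine Finset.prod_congr rfl fun j _ => ?_
    simp [g]
  rw [e1, futureCoefPdf, ← Finset.prod_inter_mul_prod_sdiff (futureRegimes t τ)
    (regimes (firstPart ht τ))]
  congr 1
  · rw [Finset.inter_comm (futureRegimes t τ), ← Finset.prod_coe_sort _ g]
    refine Finset.prod_congr rfl fun j _ => ?_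
    simp [g, (Finset.mem_inter.mp j.2).2]
  · rw [← Finset.prod_coe_sort _ g]
    refine Finset.prod_congr rfl fun j _ => ?_
    simp only [g, dif_pos (Finset.mem_sdiff.mp j.2).1]
    exact unseenPdf_eq H x _ (Finset.mem_sdiff.mp j.2).2 _

/-- In A_j b_j the factors S and S⁻¹ cancel, so the posterior mean does not depend on the
covariance. -/
theorem Amat_mulVec_bvec {S : Matrix (Fin n) (Fin n) ℝ} (hS : S.PosDef) :
    Amat H x σ j S *ᵥ bvec H x σ j S = (Cmat H x σ j).vec := by
  have e : bvec H x σ j S = (S⁻¹ * (obsMat x σ j * (regMat x σ j)ᵀ +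
      circ (H j).pi0 * (H j).Lam0⁻¹)).vec := by
    rw [bvec, ← vec_circ (H j).pi0, kronecker_mulVec_vec, kronecker_mulVec_vec, ← vec_add,
      transpose_eq_self (H j).Lam0_posDef.inv, Matrix.mul_add, Matrix.mul_assoc, Matrix.mul_assoc]
    rfl
  rw [e, Amat, kronecker_mulVec_vec, transpose_eq_self (LamPost_posDef H x σ j).inv,
    ← Matrix.mul_assoc S, mul_nonsing_inv _ (isUnit_det hS), Matrix.one_mul]
  rfl

theorem coefPdf_eq {S : regimes σ → Matrix (Fin n) (Fin n) ℝ} (hS : ∀ j, (S j).PosDef)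
    (v : regimes σ → CoefVec n l p) : coefPdf H x σ S v =
      ∏ j : regimes σ, gaussPdf (Cmat H x σ j).vec ((LamPost H x σ j)⁻¹ ⊗ₖ S j) (v j) := by
  have hA : ∀ j : regimes σ, Amat H x σ j (S j) *ᵥ bvec H x σ j (S j) = (Cmat H x σ j).vec :=
    fun j => Amat_mulVec_bvec H x σ j (hS j)
  simp only [gaussPdf, Finset.prod_mul_distrib, Finset.prod_const, ← Real.exp_sum]
  rw [coefPdf]
  simp only [hA, Finset.mul_sum]
  have hd : ∀ j : regimes σ, 0 < (Amat H x σ j (S j)).det := fun j =>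
    ((LamPost_posDef H x σ j).inv.kronecker (hS j)).det_pos
  congr 1
  rw [one_div, mul_inv, ← Finset.prod_inv_distrib]
  congr 1
  · rw [← Real.rpow_neg (by positivity), ← Real.rpow_natCast, ← Real.rpow_mul (by positivity),
      Fintype.card_prod, Nat.cast_mul, card_reg, Fintype.card_fin, Finset.card_univ,
      Fintype.card_coe]
    congr 1
    ring
  · refine Finset.prod_congr rfl fun j _ => ?_
    rw [← Real.rpow_neg (hd j).le, neg_div]
    rfl

/-- If one matrix is not positive definite, its inverse-Wishart factor vanishes, in agreement with
the global case distinction. -/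
theorem covPdf_eq (S : regimes σ → Matrix (Fin n) (Fin n) ℝ) : covPdf H x σ S =
    ∏ j : regimes σ, iwPdf n ((H j).nu0 + visitCount σ j) (Bbar H x σ j + (H j).V0) (S j) := by
  rw [covPdf]
  split_ifs with h
  · simp only [iwPdf_of_posDef _ _ (h _)]
    rw [Finset.prod_mul_distrib (g := fun j : regimes σ =>
      Real.exp (-(1 / 2) * ((Bbar H x σ j + (H j).V0) * (S j)⁻¹).trace)), ← Real.exp_sum,
      Finset.mul_sum]
  · simp only [not_forall] at h
    obtain ⟨j, hj⟩ := h
    exact (Finset.prod_eq_zero (Finset.mem_univ j) (iwPdf_of_not_posDef _ _ hj)).symm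

end Posterior

/-! ### Uniqueness and measurability of the Cholesky factor. -/

section Cholesky

variable {n : ℕ}

theorem mul_transpose_apply_of_lower {L : Matrix (Fin n) (Fin n) ℝ}
    (hL : ∀ i j, i < j → L i j = 0) (i j : Fin n) :
    (L * Lᵀ) i j = ∑ k ∈ Finset.univ.filter (· < j), L i k * L j k + L i j * L j j := by
  rw [Matrix.mul_apply, ← Finset.sum_filter_add_sum_filter_not Finset.univ (· < j)]
  congr 1
  refine (Finset.sum_eq_single_of_mem j (by simp) fun k hk hkj => ?_).trans rfl
  have : j < k := lt_of_le_of_ne (by simpa using hk) (Ne.symm hkj)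
  rw [transpose_apply, hL j k this, mul_zero]

/-- Strong induction on columns: once the earlier ones agree, column j of L Lᵀ fixes L i j * L j j.
The case i = j with positive diagonals fixes L j j, and division gives the rest. -/
theorem IsCholeskyFactor.unique {L M S : Matrix (Fin n) (Fin n) ℝ} (hL : IsCholeskyFactor L S)
    (hM : IsCholeskyFactor M S) : L = M := by
  have key : ∀ j, ∀ i, L i j = M i j := by
    intro j
    induction j using WellFoundedLT.induction with
    | ind j ih =>
      have e : ∀ i, L i j * L j j = M i j * M j j := by
        intro i
        have h1 := mul_transpose_apply_of_lower hL.1 i j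
        have h2 := mul_transpose_apply_of_lower hM.1 i j
        rw [hL.2.2] at h1
        rw [hM.2.2] at h2
        have h3 : ∑ k ∈ Finset.univ.filter (· < j), L i k * L j k =
            ∑ k ∈ Finset.univ.filter (· < j), M i k * M j k :=
          Finset.sum_congr rfl fun k hk => by
            rw [ih k (by simpa using hk) i, ih k (by simpa using hk) j]
        linarith
      have hd : L j j = M j j := by
        have := e j
        nlinarith [hL.2.1 j, hM.2.1 j]
      intro i
      have := e i
      rw [hd] at this
      exact mul_right_cancel₀ (hM.2.1 j).ne' this
  ext i j
  exact key j i

theorem IsCholeskyFactor.det_ne_zero {L S : Matrix (Fin n) (Fin n) ℝ}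
    (hL : IsCholeskyFactor L S) : L.det ≠ 0 := by
  rw [det_of_isLowerTriangular L fun i j hij => hL.1 i j hij]
  exact Finset.prod_ne_zero_iff.2 fun i _ => (hL.2.1 i).ne'

/-- There is a measurable map that sends a matrix to its Cholesky factor. -/
theorem exists_measurable_cholesky (n : ℕ) :
    ∃ c : Matrix (Fin n) (Fin n) ℝ → Matrix (Fin n) (Fin n) ℝ, Measurable c ∧
      ∀ L S, IsCholeskyFactor L S → c S = L := by
  have : StandardBorelSpace (Matrix (Fin n) (Fin n) ℝ) :=
    inferInstanceAs (StandardBorelSpace (Fin n → Fin n → ℝ))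
  let C : Set (Matrix (Fin n) (Fin n) ℝ) :=
    {L | (∀ i j, i < j → L i j = 0) ∧ ∀ i, 0 < L i i}
  have hC : MeasurableSet C := by
    have e : C = (⋂ i, ⋂ j, ⋂ _ : i < j, {L : Matrix (Fin n) (Fin n) ℝ | L i j = 0}) ∩
        ⋂ i, {L : Matrix (Fin n) (Fin n) ℝ | 0 < L i i} := by
      ext L; simp [C]
    rw [e]
    refine MeasurableSet.inter ?_ ?_
    · exact MeasurableSet.iInter fun i => MeasurableSet.iInter fun j => MeasurableSet.iInter
        fun _ => measurable_entry measurable_id i j (measurableSet_singleton 0)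
    · exact MeasurableSet.iInter fun i => measurable_entry measurable_id i i measurableSet_Ioi
  have : StandardBorelSpace C := hC.standardBorel
  let f : C → Matrix (Fin n) (Fin n) ℝ := fun L => L.1 * L.1ᵀ
  have hf : Measurable f := measurable_matrix_mul measurable_subtype_coe
    (measurable_matrix_transpose measurable_subtype_coe)
  have hinj : Function.Injective f := fun L M h =>
    Subtype.ext (IsCholeskyFactor.unique ⟨L.2.1, L.2.2, h⟩ ⟨M.2.1, M.2.2, rfl⟩)
  -- L ↦ L Lᵀ is injective on triangular matrices with positive diagonal, hence a measurable
  -- embedding of standard Borel spaces, and its inverse extends measurably to all matrices.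
  obtain ⟨c, hc, hcf⟩ := (hf.measurableEmbedding hinj).exists_measurable_extend
    (measurable_subtype_coe (p := (· ∈ C))) fun _ => ⟨0⟩
  refine ⟨c, hc, fun L S h => ?_⟩
  have := congrFun hcf ⟨L, h.1, h.2.1⟩
  simpa [f, h.2.2] using this

end Cholesky

/-! ### The law of a path driven by a Gaussian recursion. -/

section Path

variable {n t : ℕ} {Ω X : Type*} [MeasurableSpace Ω] [MeasurableSpace X]

/-- The density of a path of which the first `k` coordinates are driven by the recursion and the
other ones are standard normal. -/
noncomputable def hybridPdf (m : Fin t → X → (Fin t → Fin n → ℝ) → Fin n → ℝ)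
    (S : Fin t → X → Matrix (Fin n) (Fin n) ℝ) (k : ℕ) (r : X) (z : Fin t → Fin n → ℝ) : ℝ≥0∞ :=
  ∏ u : Fin t, ENNReal.ofReal (if (u : ℕ) < k then gaussPdf (m u r z) (S u r) (z u)
    else gaussPdf 0 1 (z u))

theorem measurable_hybridPdf {m : Fin t → X → (Fin t → Fin n → ℝ) → Fin n → ℝ}
    {S : Fin t → X → Matrix (Fin n) (Fin n) ℝ}
    (hm : ∀ u, Measurable fun q : X × (Fin t → Fin n → ℝ) => m u q.1 q.2)
    (hS : ∀ u, Measurable (S u)) (k : ℕ) :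
    Measurable fun q : X × (Fin t → Fin n → ℝ) => hybridPdf m S k q.1 q.2 := by
  refine Finset.measurable_prod _ fun u _ => Measurable.ennreal_ofReal ?_
  have hz : Measurable fun q : X × (Fin t → Fin n → ℝ) => q.2 u :=
    (measurable_pi_apply u).comp measurable_snd
  split_ifs
  · exact measurable_gaussPdf (hm u) ((hS u).comp measurable_fst) hz
  · exact measurable_gaussPdf measurable_const measurable_const hz

/-- The factors of `hybridPdf` at the coordinates other than `k`. -/
noncomputable def hybridRest (m : Fin t → X → (Fin t → Fin n → ℝ) → Fin n → ℝ)
    (S : Fin t → X → Matrix (Fin n) (Fin n) ℝ) (k : Fin t) (r : X) (z : Fin t → Fin n → ℝ) :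
    ℝ≥0∞ :=
  ∏ u ∈ Finset.univ.erase k, ENNReal.ofReal (if u < k then
    gaussPdf (m u r z) (S u r) (z u) else gaussPdf 0 1 (z u))

/-- Coordinate k occurs in no other factor: the earlier conditional means look strictly backwards,
and the later factors are still standard normal. -/
theorem hybridPdf_update {m : Fin t → X → (Fin t → Fin n → ℝ) → Fin n → ℝ}
    {S : Fin t → X → Matrix (Fin n) (Fin n) ℝ}
    (hdep : ∀ u r z z', (∀ v < u, z v = z' v) → m u r z = m u r z')
    (k : Fin t) (r : X) (z : Fin t → Fin n → ℝ) (x : Fin n → ℝ) :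
    hybridPdf m S k r (Function.update z k x) =
      ENNReal.ofReal (gaussPdf 0 1 x) * hybridRest m S k r z := by
  unfold hybridPdf hybridRest
  rw [← Finset.mul_prod_erase _ _ (Finset.mem_univ k), if_neg (lt_irrefl _),
    Function.update_self]
  congr 1
  refine Finset.prod_congr rfl fun u hu => ?_
  rw [Function.update_of_ne (Finset.ne_of_mem_erase hu)]
  by_cases h : u < k
  · rw [if_pos h, if_pos (Fin.lt_def.1 h), hdep u r _ z fun v hv =>
      Function.update_of_ne (hv.trans h).ne _ _]
  · rw [if_neg h, if_neg (fun h' => h (Fin.lt_def.2 h'))]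

theorem hybridPdf_succ_update {m : Fin t → X → (Fin t → Fin n → ℝ) → Fin n → ℝ}
    {S : Fin t → X → Matrix (Fin n) (Fin n) ℝ}
    (hdep : ∀ u r z z', (∀ v < u, z v = z' v) → m u r z = m u r z')
    (k : Fin t) (r : X) (z : Fin t → Fin n → ℝ) (x : Fin n → ℝ) :
    hybridPdf m S ((k : ℕ) + 1) r (Function.update z k x) =
      ENNReal.ofReal (gaussPdf (m k r z) (S k r) x) * hybridRest m S k r z := by
  unfold hybridPdf hybridRest
  rw [← Finset.mul_prod_erase _ _ (Finset.mem_univ k), if_pos (Nat.lt_succ_self _),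
    Function.update_self, hdep k r _ z fun v hv => Function.update_of_ne hv.ne _ _]
  congr 1
  refine Finset.prod_congr rfl fun u hu => ?_
  have hne := Finset.ne_of_mem_erase hu
  have hne' : (u : ℕ) ≠ k := fun h => hne (Fin.ext h)
  rw [Function.update_of_ne hne]
  by_cases h : u < k
  · have h1 := Fin.lt_def.1 h
    rw [if_pos h, if_pos (by omega), hdep u r _ z fun v hv =>
      Function.update_of_ne (hv.trans h).ne _ _]
  · have h1 : ¬ (u : ℕ) < k := fun h' => h (Fin.lt_def.2 h')
    rw [if_neg h, if_neg (by omega)]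

theorem measurable_path_step {m : Fin t → X → (Fin t → Fin n → ℝ) → Fin n → ℝ}
    (hm : ∀ u, Measurable fun q : X × (Fin t → Fin n → ℝ) => m u q.1 q.2)
    {L : Fin t → X → Matrix (Fin n) (Fin n) ℝ} (hL : ∀ u, Measurable (L u)) (k : Fin t) :
    Measurable fun q : X × (Fin t → Fin n → ℝ) =>
      Function.update q.2 k (m k q.1 q.2 + L k q.1 *ᵥ q.2 k) := by
  refine measurable_pi_lambda _ fun u => ?_
  by_cases hu : u = k
  · subst hu
    simp only [Function.update_self]
    exact (hm _).add (measurable_matrix_mulVec ((hL _).comp measurable_fst)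
      ((measurable_pi_apply _).comp measurable_snd))
  · simp only [Function.update_of_ne hu]
    exact (measurable_pi_apply u).comp measurable_snd

/-- One noise vector is exchanged for one observation. The other coordinates stay fixed, and in
coordinate k the map is affine because its mean and its factor do not depend on that coordinate. -/
theorem lintegral_hybridPdf_succ {m : Fin t → X → (Fin t → Fin n → ℝ) → Fin n → ℝ}
    {S L : Fin t → X → Matrix (Fin n) (Fin n) ℝ}
    (hm : ∀ u, Measurable fun q : X × (Fin t → Fin n → ℝ) => m u q.1 q.2)
    (hS : ∀ u, Measurable (S u)) (hL : ∀ u, Measurable (L u))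
    (hdep : ∀ u r z z', (∀ v < u, z v = z' v) → m u r z = m u r z')
    (k : Fin t) (r : X) (hLS : L k r * (L k r)ᵀ = S k r) (hLd : (L k r).det ≠ 0)
    {F : (Fin t → Fin n → ℝ) → ℝ≥0∞} (hF : Measurable F) :
    ∫⁻ z, F (Function.update z k (m k r z + L k r *ᵥ z k)) * hybridPdf m S k r z =
      ∫⁻ z, F z * hybridPdf m S ((k : ℕ) + 1) r z := by
  have hp : ∀ i : ℕ, Measurable (hybridPdf m S i r) := fun i =>
    (measurable_hybridPdf hm hS i).of_uncurry_left (f := hybridPdf m S i) (x := r)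
  have hstep : Measurable fun z : Fin t → Fin n → ℝ =>
      Function.update z k (m k r z + L k r *ᵥ z k) :=
    (measurable_path_step hm hL k).comp measurable_prodMk_left
  rw [volume_pi]
  -- It is enough to compare the integrals over coordinate k alone, for every value of the others.
  refine lintegral_eq_of_lmarginal_eq {k} ((hF.comp hstep).mul (hp _)) (hF.mul (hp _)) ?_
  rw [lmarginal_singleton, lmarginal_singleton]
  funext z
  have hmk : ∀ x, m k r (Function.update z k x) = m k r z := fun x =>
    hdep k r _ _ fun v hv => Function.update_of_ne hv.ne _ _
  have hFu : Measurable fun x => F (Function.update z k x) := hF.comp (measurable_update z)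
  have hg : ∀ (a : Fin n → ℝ) (S : Matrix (Fin n) (Fin n) ℝ),
      Measurable fun x => ENNReal.ofReal (gaussPdf a S x) := fun a S =>
    (measurable_gaussPdf measurable_const measurable_const measurable_id).ennreal_ofReal
  calc ∫⁻ x, F (Function.update (Function.update z k x) k
        (m k r (Function.update z k x) + L k r *ᵥ Function.update z k x k)) *
          hybridPdf m S k r (Function.update z k x)
      = ∫⁻ x, F (Function.update z k (m k r z + L k r *ᵥ x)) *
          ENNReal.ofReal (gaussPdf 0 1 x) * hybridRest m S k r z := by
        refine lintegral_congr fun x => ?_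
        rw [hybridPdf_update hdep, hmk, Function.update_self, Function.update_idem, mul_assoc]
    _ = (∫⁻ x, F (Function.update z k x) * ENNReal.ofReal (gaussPdf (m k r z) (S k r) x)) *
          hybridRest m S k r z := by
        have haff : Measurable fun x : Fin n → ℝ => m k r z + L k r *ᵥ x :=
          measurable_const.add (measurable_matrix_mulVec measurable_const measurable_id)
        have h1 : Measurable fun x => F (Function.update z k (m k r z + L k r *ᵥ x)) *
            ENNReal.ofReal (gaussPdf 0 1 x) := (hFu.comp haff).mul (hg _ _)
        rw [lintegral_mul_const _ h1, lintegral_gauss_affine hLS hLd (m k r z) hFu]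
    _ = ∫⁻ x, F (Function.update z k x) *
          hybridPdf m S ((k : ℕ) + 1) r (Function.update z k x) := by
        have h1 : Measurable fun x => F (Function.update z k x) *
            ENNReal.ofReal (gaussPdf (m k r z) (S k r) x) := hFu.mul (hg _ _)
        rw [← lintegral_mul_const _ h1]
        refine lintegral_congr fun x => ?_
        rw [hybridPdf_succ_update hdep, mul_assoc]

/-- The joint law of the parameters and of a path that is driven by a Gaussian recursion. -/
theorem lintegral_path {μ : Measure Ω} {R : Ω → X}
    {y ε : Ω → Fin t → Fin n → ℝ}
    (hlaw : ∀ F : X × (Fin t → Fin n → ℝ) → ℝ≥0∞, Measurable F →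
      ∫⁻ ω, F (R ω, ε ω) ∂μ =
        ∫⁻ ω, ∫⁻ z, F (R ω, z) * ∏ u, ENNReal.ofReal (gaussPdf 0 1 (z u)) ∂volume ∂μ)
    {m : Fin t → X → (Fin t → Fin n → ℝ) → Fin n → ℝ}
    {S L : Fin t → X → Matrix (Fin n) (Fin n) ℝ}
    (hm : ∀ u, Measurable fun q : X × (Fin t → Fin n → ℝ) => m u q.1 q.2)
    (hS : ∀ u, Measurable (S u)) (hL : ∀ u, Measurable (L u))
    (hdep : ∀ u r z z', (∀ v < u, z v = z' v) → m u r z = m u r z')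
    (hLS : ∀ᵐ ω ∂μ, ∀ u, L u (R ω) * (L u (R ω))ᵀ = S u (R ω) ∧ (L u (R ω)).det ≠ 0)
    (hdyn : ∀ᵐ ω ∂μ, ∀ u, y ω u = m u (R ω) (y ω) + L u (R ω) *ᵥ ε ω u)
    {F : X × (Fin t → Fin n → ℝ) → ℝ≥0∞} (hF : Measurable F) :
    ∫⁻ ω, F (R ω, y ω) ∂μ =
      ∫⁻ ω, ∫⁻ z, F (R ω, z) *
        ∏ u, ENNReal.ofReal (gaussPdf (m u (R ω) z) (S u (R ω)) (z u)) ∂volume ∂μ := by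
  -- Interpolation between noise and path: the first k coordinates are observations, the others
  -- noise. k = 0 is the assumed law of the noise, k = t the claim.
  have key : ∀ k : ℕ, k ≤ t → ∀ F : X × (Fin t → Fin n → ℝ) → ℝ≥0∞, Measurable F →
      ∫⁻ ω, F (R ω, fun u => if (u : ℕ) < k then y ω u else ε ω u) ∂μ =
        ∫⁻ ω, ∫⁻ z, F (R ω, z) * hybridPdf m S k (R ω) z ∂volume ∂μ := by
    intro k
    induction k with
    | zero =>
      intro _ F hF
      simpa [hybridPdf] using hlaw F hF
    | succ k ih =>
      intro hk F hF
      let k' : Fin t := ⟨k, hk⟩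
      let G : X × (Fin t → Fin n → ℝ) → ℝ≥0∞ := fun q =>
        F (q.1, Function.update q.2 k' (m k' q.1 q.2 + L k' q.1 *ᵥ q.2 k'))
      have hG : Measurable G :=
        hF.comp (measurable_fst.prodMk (measurable_path_step hm hL k'))
      have e1 : ∫⁻ ω, F (R ω, fun u => if (u : ℕ) < k + 1 then y ω u else ε ω u) ∂μ =
          ∫⁻ ω, G (R ω, fun u => if (u : ℕ) < k then y ω u else ε ω u) ∂μ := by
        refine lintegral_congr_ae ?_
        filter_upwards [hdyn] with ω hω
        -- The conditional mean reads only coordinates before k, where the hybrid path already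
        -- coincides with the observations.
        have hmk : m k' (R ω) (fun u => if (u : ℕ) < k then y ω u else ε ω u) =
            m k' (R ω) (y ω) := hdep _ _ _ _ fun v hv => if_pos hv
        simp only [G, hmk]
        congr 2
        funext u
        by_cases hu : u = k'
        · subst hu
          rw [Function.update_self, if_pos (Nat.lt_succ_self k), if_neg (lt_irrefl k), hω]
        · have hne : (u : ℕ) ≠ k := fun h => hu (Fin.ext h)
          rw [Function.update_of_ne hu]
          by_cases h : (u : ℕ) < k
          · rw [if_pos h, if_pos (by omega)]
          · rw [if_neg h, if_neg (by omega)]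
      rw [e1, ih (by omega) G hG]
      refine lintegral_congr_ae ?_
      filter_upwards [hLS] with ω hω
      exact lintegral_hybridPdf_succ hm hS hL hdep k' (R ω) (hω k').1 (hω k').2
        (hF.comp measurable_prodMk_left)
  have := key t le_rfl F hF
  simpa [hybridPdf] using this

end Path

/-! ### Conditional laws tested on generating events. -/

section CondLaw

/-- The bridge from conditional expectations, which are real valued, to identities between measures.
-/
theorem measure_inter_of_condExp {Ω : Type*} {m mΩ : MeasurableSpace Ω} {Q : Measure Ω}
    [IsFiniteMeasure Q] (hm : m ≤ mΩ) {D : Set Ω} (hD : MeasurableSet D)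
    {g : Ω → ℝ} (hg0 : 0 ≤ g) (h : Q[D.indicator (fun _ => (1 : ℝ)) | m] =ᵐ[Q] g)
    {A : Set Ω} (hA : MeasurableSet[m] A) :
    Q (A ∩ D) = ∫⁻ ω in A, ENNReal.ofReal (g ω) ∂Q := by
  have hgi : Integrable g Q := (integrable_congr h).1 integrable_condExp
  have h1 : ∫ ω in A, g ω ∂Q = Q.real (A ∩ D) := by
    rw [← setIntegral_congr_ae (hm _ hA) (h.mono fun ω hω _ => hω), setIntegral_condExp hm _ hA,
      integral_indicator hD, setIntegral_const, smul_eq_mul, mul_one,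
      measureReal_restrict_apply hD, Set.inter_comm]
    exact (integrable_const _).indicator hD
  rw [← ofReal_integral_eq_lintegral_ofReal hgi.integrableOn (ae_of_all _ hg0), h1,
    ofReal_measureReal]

theorem HasCondLaw.measure_inter {Ω E : Type*} {m mΩ : MeasurableSpace Ω} [MeasurableSpace E]
    {Q : Measure Ω} [IsFiniteMeasure Q] (hm : m ≤ mΩ) {X : Ω → E}
    (hX : Measurable X) {κ : Ω → Measure E} [∀ ω, IsFiniteMeasure (κ ω)]
    (h : HasCondLaw Q m X κ) {A : Set Ω} (hA : MeasurableSet[m] A) {B : Set E}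
    (hB : MeasurableSet B) : Q (A ∩ X ⁻¹' B) = ∫⁻ ω in A, κ ω B ∂Q := by
  rw [measure_inter_of_condExp hm (hX hB) (fun _ => measureReal_nonneg) (h B hB) hA]
  simp

theorem condExp_indicator_eq_const {Ω : Type*} {m mΩ : MeasurableSpace Ω} {Q : Measure Ω}
    [IsFiniteMeasure Q] (hm : m ≤ mΩ) {D : Set Ω} (hD : MeasurableSet D)
    {c : ℝ≥0∞} (h : ∀ A, MeasurableSet[m] A → Q (A ∩ D) = Q A * c) :
    Q[D.indicator (fun _ => (1 : ℝ)) | m] =ᵐ[Q] fun _ => c.toReal := by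
  refine (ae_eq_condExp_of_forall_setIntegral_eq hm ((integrable_const _).indicator hD)
    (fun _ _ _ => (integrable_const _)) (fun A hA _ => ?_)
    aestronglyMeasurable_const).symm
  rw [setIntegral_const, integral_indicator hD, setIntegral_const, smul_eq_mul, smul_eq_mul,
    mul_one, measureReal_restrict_apply hD, Set.inter_comm,
    measureReal_def, measureReal_def, h A hA, ENNReal.toReal_mul]

/-- The sets A ∩ z⁻¹(C) form a π-system generating the join. Finiteness of ν, needed for
complements, follows from agreement on the whole space. -/
theorem measure_inter_sup_comap {Ω Z : Type*} {m mΩ : MeasurableSpace Ω} [mZ : MeasurableSpace Z]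
    {μ ν : Measure Ω} [IsFiniteMeasure μ] (hm : m ≤ mΩ) {z : Ω → Z}
    (hz : Measurable z)
    (h : ∀ A C, MeasurableSet[m] A → MeasurableSet C → μ (A ∩ z ⁻¹' C) = ν (A ∩ z ⁻¹' C))
    {E : Set Ω} (hE : MeasurableSet[m ⊔ mZ.comap z] E) : μ E = ν E := by
  have hzm : mZ.comap z ≤ mΩ := hz.comap_le
  have hu : μ Set.univ = ν Set.univ := by
    simpa using h Set.univ Set.univ MeasurableSet.univ MeasurableSet.univ
  have : IsFiniteMeasure ν := ⟨by rw [← hu]; exact measure_lt_top _ _⟩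
  let S : Set (Set Ω) := {E | ∃ A C, MeasurableSet[m] A ∧ MeasurableSet C ∧ E = A ∩ z ⁻¹' C}
  have hS : m ⊔ mZ.comap z = MeasurableSpace.generateFrom S := by
    apply le_antisymm
    · refine sup_le (fun A hA => ?_) ?_
      · exact MeasurableSpace.measurableSet_generateFrom
          ⟨A, Set.univ, hA, MeasurableSet.univ, by simp⟩
      · rintro _ ⟨C, hC, rfl⟩
        exact MeasurableSpace.measurableSet_generateFrom
          ⟨Set.univ, C, MeasurableSet.univ, hC, by simp⟩
    · refine MeasurableSpace.generateFrom_le ?_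
      rintro _ ⟨A, C, hA, hC, rfl⟩
      exact MeasurableSet.inter (le_sup_left (a := m) (b := mZ.comap z) _ hA)
        (le_sup_right (a := m) (b := mZ.comap z) _ ⟨C, hC, rfl⟩)
  have hle : m ⊔ mZ.comap z ≤ mΩ := sup_le hm hzm
  refine MeasurableSpace.induction_on_inter (C := fun E _ => μ E = ν E) hS ?_ (by simp) ?_ ?_ ?_ E hE
  · rintro _ ⟨A, C, hA, hC, rfl⟩ _ ⟨A', C', hA', hC', rfl⟩ _
    refine ⟨A ∩ A', C ∩ C', hA.inter hA', hC.inter hC', ?_⟩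
    rw [Set.preimage_inter]; exact Set.inter_inter_inter_comm _ _ _ _
  · rintro _ ⟨A, C, hA, hC, rfl⟩
    exact h A C hA hC
  · intro E hE' ih
    rw [measure_compl (hle _ hE') (measure_ne_top _ _), measure_compl (hle _ hE') (measure_ne_top _ _),
      ih, hu]
  · intro f hd hf ih
    rw [measure_iUnion hd fun i => hle _ (hf i), measure_iUnion hd fun i => hle _ (hf i)]
    simp only [ih]

/-- The integral of g over B is measurable for the join, so it is a version of the conditional
probability once it has the right integrals; the π-system suffices for that. -/
theorem hasCondDensity_of_measure_inter {Ω W Z E : Type*} {m mΩ : MeasurableSpace Ω}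
    [mW : MeasurableSpace W] [mZ : MeasurableSpace Z] [MeasurableSpace E] {Q : Measure Ω}
    [IsFiniteMeasure Q] (hm : m ≤ mΩ) {w : Ω → W} (hw : Measurable[m] w)
    {z : Ω → Z} (hz : Measurable z) {X : Ω → E} (hX : Measurable X) {ρ : Measure E} [SFinite ρ]
    {g : W → Z → E → ℝ} (hg : Measurable fun q : (W × Z) × E => g q.1.1 q.1.2 q.2)
    (hg0 : ∀ a b e, 0 ≤ g a b e)
    (h : ∀ A C B, MeasurableSet[m] A → MeasurableSet C → MeasurableSet B →
      Q (A ∩ z ⁻¹' C ∩ X ⁻¹' B) =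
        ∫⁻ ω in A ∩ z ⁻¹' C, ∫⁻ x in B, ENNReal.ofReal (g (w ω) (z ω) x) ∂ρ ∂Q) :
    HasCondDensity Q (m ⊔ mZ.comap z) X ρ (fun ω => g (w ω) (z ω)) := by
  have hle : m ⊔ mZ.comap z ≤ mΩ := sup_le hm hz.comap_le
  have hwz : Measurable[m ⊔ mZ.comap z] fun ω => (w ω, z ω) := by
    refine Measurable.prodMk (hw.mono le_sup_left le_rfl) ?_
    exact (Measurable.of_comap_le le_rfl).mono le_sup_right le_rfl
  have hk : ∀ B, MeasurableSet B →
      Measurable[m ⊔ mZ.comap z] fun ω => ∫⁻ x in B, ENNReal.ofReal (g (w ω) (z ω) x) ∂ρ := by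
    intro B _
    have h1 : Measurable fun q : W × Z => ∫⁻ x in B, ENNReal.ofReal (g q.1 q.2 x) ∂ρ :=
      hg.ennreal_ofReal.lintegral_prod_right'
    exact h1.comp hwz
  have hgs : ∀ a b, Measurable (g a b) := fun a b =>
    hg.of_uncurry_left (f := fun (q : W × Z) e => g q.1 q.2 e) (x := (a, b))
  -- The density integrates over Ω and E to the finite mass of Q, hence is integrable in its last
  -- variable for almost every ω.
  have hfin : ∀ᵐ ω ∂Q, ∫⁻ x, ENNReal.ofReal (g (w ω) (z ω) x) ∂ρ < ∞ := by
    have h1 := h Set.univ Set.univ Set.univ MeasurableSet.univ MeasurableSet.univ MeasurableSet.univ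
    simp only [Set.preimage_univ, Set.inter_univ, Measure.restrict_univ] at h1
    refine ae_lt_top ?_ (by rw [← h1]; exact measure_ne_top _ _)
    simpa using (hk Set.univ MeasurableSet.univ).mono hle le_rfl
  refine ⟨?_, fun B hB => ?_⟩
  · filter_upwards [hfin] with ω hω
    refine ⟨hg0 _ _, (hgs _ _).aestronglyMeasurable, ?_⟩
    rw [hasFiniteIntegral_iff_ofReal (ae_of_all _ (hg0 _ _))]
    exact hω
  · have hfB : ∀ᵐ ω ∂Q, ∫⁻ x in B, ENNReal.ofReal (g (w ω) (z ω) x) ∂ρ < ∞ :=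
      hfin.mono fun ω hω => (setLIntegral_le_lintegral _ _).trans_lt hω
    have hint : ∀ ω, ∫ x in B, g (w ω) (z ω) x ∂ρ =
        (∫⁻ x in B, ENNReal.ofReal (g (w ω) (z ω) x) ∂ρ).toReal := fun ω =>
      integral_eq_lintegral_of_nonneg_ae (ae_of_all _ (hg0 _ _)) (hgs _ _).aestronglyMeasurable
    have hkm := (hk B hB).mono hle le_rfl
    have key : ∀ E, MeasurableSet[m ⊔ mZ.comap z] E → Q (E ∩ X ⁻¹' B) =
        ∫⁻ ω in E, ∫⁻ x in B, ENNReal.ofReal (g (w ω) (z ω) x) ∂ρ ∂Q := by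
      intro E hE
      have h2 := measure_inter_sup_comap (μ := Q.restrict (X ⁻¹' B))
        (ν := Q.withDensity fun ω => ∫⁻ x in B, ENNReal.ofReal (g (w ω) (z ω) x) ∂ρ) hm hz
        (fun A C hA hC => ?_) hE
      · rwa [Measure.restrict_apply (hle _ hE), withDensity_apply _ (hle _ hE)] at h2
      · have hAC : MeasurableSet (A ∩ z ⁻¹' C) := (hm _ hA).inter (hz hC)
        rw [Measure.restrict_apply hAC, withDensity_apply _ hAC, h A C B hA hC hB]
    have hkint : ∫⁻ ω, ∫⁻ x in B, ENNReal.ofReal (g (w ω) (z ω) x) ∂ρ ∂Q ≠ ∞ := by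
      have h3 := key Set.univ MeasurableSet.univ
      rw [Measure.restrict_univ] at h3
      rw [← h3]; exact measure_ne_top _ _
    simp only [hint]
    refine (ae_eq_condExp_of_forall_setIntegral_eq hle
      ((integrable_const _).indicator (hX hB)) (fun E _ _ => ?_) (fun E hE _ => ?_) ?_).symm
    · exact (integrable_toReal_of_lintegral_ne_top hkm.aemeasurable hkint).integrableOn
    · rw [integral_toReal hkm.aemeasurable (ae_restrict_of_ae hfB), ← key E hE,
        integral_indicator (hX hB), setIntegral_const, smul_eq_mul, mul_one,
        measureReal_restrict_apply (hX hB), Set.inter_comm,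
        measureReal_def]
    · exact (hk B hB).ennreal_toReal.stronglyMeasurable.aestronglyMeasurable

end CondLaw
-- The normal-inverse-Wishart law and its marginals.
section Niw

variable {n l p : ℕ}

/-- The parameters of one regime: vectorised coefficients and the covariance matrix. -/
abbrev Par (n l p : ℕ) : Type := CoefVec n l p × Matrix (Fin n) (Fin n) ℝ

/-- The normal-inverse-Wishart distribution. -/
noncomputable def niwMeasure (m : CoefVec n l p) (K : Matrix (Reg n l p) (Reg n l p) ℝ) (ν : ℝ)
    (V : Matrix (Fin n) (Fin n) ℝ) : Measure (Par n l p) :=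
  (volume.prod (symVolume n)).withDensity fun θ => ENNReal.ofReal (niwPdf m K ν V θ.1 θ.2)

theorem measurable_ofReal_niwPdf (m : CoefVec n l p) (K : Matrix (Reg n l p) (Reg n l p) ℝ) (ν : ℝ)
    (V : Matrix (Fin n) (Fin n) ℝ) :
    Measurable fun θ : Par n l p => ENNReal.ofReal (niwPdf m K ν V θ.1 θ.2) :=
  (measurable_niwPdf ν measurable_const measurable_const measurable_const measurable_fst
    measurable_snd).ennreal_ofReal

theorem map_snd_niwMeasure (m : CoefVec n l p) {K : Matrix (Reg n l p) (Reg n l p) ℝ}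
    (hK : K.PosDef) (ν : ℝ) (V : Matrix (Fin n) (Fin n) ℝ) : (niwMeasure m K ν V).map Prod.snd = invWishart n ν V := by
  ext D hD
  rw [Measure.map_apply measurable_snd hD, niwMeasure, invWishart,
    withDensity_apply _ (measurable_snd hD), withDensity_apply _ hD,
    ← lintegral_indicator (measurable_snd hD), ← lintegral_indicator hD,
    lintegral_prod_symm' _ ((measurable_ofReal_niwPdf m K ν V).indicator (measurable_snd hD))]
  refine lintegral_congr fun S => ?_
  by_cases hS : S ∈ D
  · simp only [Set.indicator, Set.mem_preimage, hS, if_true]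
    exact lintegral_niwPdf_coef m hK ν V S
  · simp [Set.indicator, hS]

theorem map_fst_niwMeasure (C : Matrix (Fin n) (Reg n l p) ℝ)
    {L : Matrix (Reg n l p) (Reg n l p) ℝ} (hL : L.PosDef) {ν : ℝ} (hν : (n : ℝ) - 1 < ν)
    {V : Matrix (Fin n) (Fin n) ℝ} (hV : V.PosDef) :
    (niwMeasure C.vec L⁻¹ ν V).map Prod.fst =
      volume.withDensity fun v => ENNReal.ofReal (studentPdf C L ν V v) := by
  ext D hD
  rw [Measure.map_apply measurable_fst hD, niwMeasure,
    withDensity_apply _ (measurable_fst hD), withDensity_apply _ hD,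
    ← lintegral_indicator (measurable_fst hD), ← lintegral_indicator hD,
    lintegral_prod _ ((measurable_ofReal_niwPdf _ _ ν V).indicator (measurable_fst hD)).aemeasurable]
  refine lintegral_congr fun v => ?_
  by_cases hv : v ∈ D
  · simp only [Set.indicator, Set.mem_preimage, hv, if_true]
    exact lintegral_niwPdf_cov C hL hν hV v
  · simp [Set.indicator, hv]

theorem isProbabilityMeasure_invWishart {ν : ℝ} (hν : (n : ℝ) - 1 < ν)
    {V : Matrix (Fin n) (Fin n) ℝ} (hV : V.PosDef) : IsProbabilityMeasure (invWishart n ν V) :=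
  ⟨by rw [invWishart, withDensity_apply _ MeasurableSet.univ, Measure.restrict_univ,
    lintegral_iwPdf hν hV]⟩

theorem isProbabilityMeasure_niwMeasure (m : CoefVec n l p)
    {K : Matrix (Reg n l p) (Reg n l p) ℝ}
    (hK : K.PosDef) {ν : ℝ} (hν : (n : ℝ) - 1 < ν) {V : Matrix (Fin n) (Fin n) ℝ}
    (hV : V.PosDef) : IsProbabilityMeasure (niwMeasure m K ν V) := by
  have := isProbabilityMeasure_invWishart hν hV
  refine ⟨?_⟩
  have h := congrArg (fun μ => μ Set.univ) (map_snd_niwMeasure m hK ν V)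
  simpa [Measure.map_apply measurable_snd MeasurableSet.univ] using h

instance isProbabilityMeasure_mvNormal {ι : Type*} [Fintype ι] [DecidableEq ι] (m : ι → ℝ)
    (S : Matrix ι ι ℝ) : IsProbabilityMeasure (mvNormal m S) :=
  Measure.isProbabilityMeasure_map (by fun_prop)

/-- A covariance with the inverse-Wishart law and coefficients with the conditional normal law have
jointly the normal-inverse-Wishart law, independently of the initial information. -/
theorem measure_inter_niw {Ω : Type*} {m mΩ : MeasurableSpace Ω} {Q : Measure Ω}
    [IsFiniteMeasure Q] (hm : m ≤ mΩ) {X : Ω → CoefVec n l p} {S : Ω → Matrix (Fin n) (Fin n) ℝ}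
    (hX : Measurable X) (hS : Measurable S) (c : CoefVec n l p)
    {K : Matrix (Reg n l p) (Reg n l p) ℝ} (hK : K.PosDef) {ν : ℝ} (hν : (n : ℝ) - 1 < ν)
    {V : Matrix (Fin n) (Fin n) ℝ} (hV : V.PosDef)
    (hlawS : HasCondLaw Q m S fun _ => invWishart n ν V)
    (hlawX : HasCondLaw Q (m ⊔ MeasurableSpace.comap S inferInstance) X
      fun ω => mvNormal c (K ⊗ₖ S ω))
    {A : Set Ω} (hA : MeasurableSet[m] A) {E : Set (Par n l p)} (hE : MeasurableSet E) :
    Q (A ∩ (fun ω => (X ω, S ω)) ⁻¹' E) = Q A * niwMeasure c K ν V E := by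
  have := isProbabilityMeasure_invWishart hν hV
  have := isProbabilityMeasure_niwMeasure c hK hν hV
  have hle : m ⊔ MeasurableSpace.comap S inferInstance ≤ mΩ := sup_le hm hS.comap_le
  have hXS : Measurable fun ω => (X ω, S ω) := hX.prodMk hS
  have hiw : Measurable fun M : Matrix (Fin n) (Fin n) ℝ => ENNReal.ofReal (iwPdf n ν V M) :=
    (measurable_iwPdf ν measurable_const measurable_id).ennreal_ofReal
  have h1 : (Q.restrict A).map S = Q A • invWishart n ν V := by
    ext D hD
    rw [Measure.map_apply hS hD, Measure.restrict_apply (hS hD), Set.inter_comm,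
      hlawS.measure_inter hm hS hA hD]
    simp [mul_comm]
  -- The conditional normal law is replaced by its density below, which is legitimate only at
  -- positive definite covariances.
  have hpd : ∀ᵐ ω ∂Q.restrict A, (S ω).PosDef := by
    have h2 : ∀ᵐ M ∂(Q.restrict A).map S, M.PosDef := by
      rw [h1]
      refine Measure.ae_smul_measure ?_ _
      rw [invWishart, ae_withDensity_iff hiw]
      refine ae_of_all _ fun M hM => ?_
      by_contra hn
      exact hM (by rw [iwPdf_of_not_posDef _ _ hn, ENNReal.ofReal_zero])
    exact ae_of_ae_map hS.aemeasurable h2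
  have h3 : (Q.restrict A).map (fun ω => (X ω, S ω)) = Q A • niwMeasure c K ν V := by
    have hfin : IsFiniteMeasure (Q A • niwMeasure c K ν V) :=
      Measure.smul_finite _ (measure_ne_top _ _)
    -- The hypothesis on the coefficients conditions on the covariance, so it evaluates rectangles B
    -- × D directly, through the event A ∩ S⁻¹(D).
    refine Measure.ext_prod fun {B D} hB hD => ?_
    have hAD : MeasurableSet[m ⊔ MeasurableSpace.comap S inferInstance] (A ∩ S ⁻¹' D) :=
      MeasurableSet.inter (le_sup_left (a := m) _ hA)
        (le_sup_right (a := m) (b := MeasurableSpace.comap S inferInstance) _ ⟨D, hD, rfl⟩)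
    have hg : Measurable fun M : Matrix (Fin n) (Fin n) ℝ =>
        ∫⁻ v in B, ENNReal.ofReal (gaussPdf c (K ⊗ₖ M) v) := by
      have h4 : Measurable fun q : Matrix (Fin n) (Fin n) ℝ × CoefVec n l p =>
          ENNReal.ofReal (gaussPdf c (K ⊗ₖ q.1) q.2) :=
        (measurable_gaussPdf measurable_const
          (measurable_matrix_kronecker measurable_const measurable_fst) measurable_snd).ennreal_ofReal
      exact h4.lintegral_prod_right'
    calc (Q.restrict A).map (fun ω => (X ω, S ω)) (B ×ˢ D)
        = Q (A ∩ S ⁻¹' D ∩ X ⁻¹' B) := by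
          rw [Measure.map_apply hXS (hB.prod hD), Measure.restrict_apply (hXS (hB.prod hD))]
          congr 1
          ext ω
          simp only [Set.mem_inter_iff, Set.mem_preimage, Set.mem_prod]
          tauto
      _ = ∫⁻ ω in A ∩ S ⁻¹' D, mvNormal c (K ⊗ₖ S ω) B ∂Q :=
          hlawX.measure_inter hle hX hAD hB
      _ = ∫⁻ ω in A, (S ⁻¹' D).indicator (fun ω => mvNormal c (K ⊗ₖ S ω) B) ω ∂Q := by
          rw [lintegral_indicator (hS hD), Measure.restrict_restrict (hS hD), Set.inter_comm]
      _ = ∫⁻ ω in A, D.indicator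
            (fun M => ∫⁻ v in B, ENNReal.ofReal (gaussPdf c (K ⊗ₖ M) v)) (S ω) ∂Q := by
          refine lintegral_congr_ae (hpd.mono fun ω hω => ?_)
          by_cases hD' : S ω ∈ D
          · simp only [Set.indicator, Set.mem_preimage, hD', if_true]
            rw [mvNormal_eq_withDensity c (hK.kronecker hω), withDensity_apply _ hB]
          · simp [Set.indicator, hD']
      _ = Q A * ∫⁻ M in D, ENNReal.ofReal (iwPdf n ν V M) *
            (∫⁻ v in B, ENNReal.ofReal (gaussPdf c (K ⊗ₖ M) v)) ∂symVolume n := by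
          rw [← lintegral_map (f := D.indicator _) (hg.indicator hD) hS, h1, lintegral_smul_measure,
            lintegral_indicator hD, invWishart, setLIntegral_withDensity_eq_setLIntegral_mul _
            hiw hg hD]
          rfl
      _ = Q A * ∫⁻ M in D, (∫⁻ v in B, ENNReal.ofReal (niwPdf c K ν V v M)) ∂symVolume n := by
          congr 1
          refine lintegral_congr fun M => ?_
          rw [← lintegral_const_mul']
          · refine lintegral_congr fun v => ?_
            rw [niwPdf, mul_comm (gaussPdf _ _ _), ENNReal.ofReal_mul (iwPdf_nonneg hν hV M)]
          · exact ENNReal.ofReal_ne_top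
      _ = (Q A • niwMeasure c K ν V) (B ×ˢ D) := by
          rw [Measure.smul_apply, niwMeasure, withDensity_apply _ (hB.prod hD),
            ← Measure.prod_restrict, lintegral_prod_symm' _ (measurable_ofReal_niwPdf c K ν V),
            smul_eq_mul]
  have h4 := congrArg (fun μ => μ E) h3
  simp only [Measure.map_apply hXS hE, Measure.restrict_apply (hXS hE), Measure.smul_apply,
    smul_eq_mul] at h4
  rw [Set.inter_comm, h4]

end Niw
-- Prior and posterior laws of one regime.
section ParameterLaws

variable {n l p t N : ℕ} (H : Fin N → Hyper n l p) (x : Sample n l p t) (σ : Fin t → Fin N)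
  (j : Fin N)

/-- The prior law of the parameters of one regime. -/
noncomputable def priorMeasure : Measure (Par n l p) :=
  niwMeasure (H j).pi0 (H j).Lam0 (H j).nu0 (H j).V0

/-- The posterior law of the parameters of one regime. -/
noncomputable def postMeasure : Measure (Par n l p) :=
  niwMeasure (Cmat H x σ j).vec (LamPost H x σ j)⁻¹ ((H j).nu0 + visitCount σ j)
    (Bbar H x σ j + (H j).V0)

instance isProbabilityMeasure_priorMeasure : IsProbabilityMeasure (priorMeasure H j) :=
  isProbabilityMeasure_niwMeasure _ (H j).Lam0_posDef (H j).nu0_gt (H j).V0_posDef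

instance isProbabilityMeasure_postMeasure : IsProbabilityMeasure (postMeasure H x σ j) :=
  isProbabilityMeasure_niwMeasure _ (LamPost_posDef H x σ j).inv (nuPost_gt H σ j)
    (Bbar_add_posDef H x σ j)

end ParameterLaws

/-! ### Measurable dependence on the sample. -/

section MeasurableSample

variable {n l p t N : ℕ}

/-- Exogenous variables and initial values. -/
abbrev Init (n l p t : ℕ) : Type := (Fin t → Fin l → ℝ) × (Fin p → Fin n → ℝ)

/-- The sample with given initial information and observations. -/
def smp (q : Init n l p t × (Fin t → Fin n → ℝ)) : Sample n l p t := ⟨q.1.1, q.1.2, q.2⟩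

theorem measurable_regressor (u : Fin t) :
    Measurable fun q : Init n l p t × (Fin t → Fin n → ℝ) => (smp q).regressor u := by
  refine measurable_pi_lambda _ fun k => ?_
  rcases k with k | k
  · simp only [Sample.regressor, smp, Sum.elim_inl]
    fun_prop
  · simp only [Sample.regressor, smp, Sum.elim_inr, Sample.lag]
    split_ifs <;> fun_prop

variable (H : Fin N → Hyper n l p) (σ : Fin t → Fin N) (j : Fin N)

theorem measurable_regMat :
    Measurable fun q : Init n l p t × (Fin t → Fin n → ℝ) => regMat (smp q) σ j :=
  measurable_matrix fun k u => (measurable_pi_apply k).comp (measurable_regressor u.1)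

theorem measurable_obsMat :
    Measurable fun q : Init n l p t × (Fin t → Fin n → ℝ) => obsMat (smp q) σ j :=
  measurable_matrix fun i u => by
    simp only [obsMat, smp, Matrix.of_apply]
    fun_prop

theorem measurable_LamPost :
    Measurable fun q : Init n l p t × (Fin t → Fin n → ℝ) => LamPost H (smp q) σ j :=
  measurable_matrix_add (measurable_matrix_mul (measurable_regMat σ j)
    (measurable_matrix_transpose (measurable_regMat σ j))) measurable_const

theorem measurable_Cmat :
    Measurable fun q : Init n l p t × (Fin t → Fin n → ℝ) => Cmat H (smp q) σ j :=
  measurable_matrix_mul (measurable_matrix_add (measurable_matrix_mul (measurable_obsMat σ j)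
    (measurable_matrix_transpose (measurable_regMat σ j))) measurable_const)
    (measurable_matrix_inv (measurable_LamPost H σ j))

theorem measurable_Bbar :
    Measurable fun q : Init n l p t × (Fin t → Fin n → ℝ) => Bbar H (smp q) σ j :=
  measurable_matrix_sub (measurable_matrix_add (measurable_matrix_mul (measurable_obsMat σ j)
    (measurable_matrix_transpose (measurable_obsMat σ j))) measurable_const)
    (measurable_matrix_mul (measurable_matrix_mul (measurable_Cmat H σ j)
      (measurable_LamPost H σ j)) (measurable_matrix_transpose (measurable_Cmat H σ j)))

theorem measurable_vec {X a b : Type*} [MeasurableSpace X] {f : X → Matrix a b ℝ}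
    (hf : Measurable f) : Measurable fun x => (f x).vec :=
  measurable_pi_lambda _ fun k => measurable_entry hf k.2 k.1

theorem measurable_circ {X : Type*} [MeasurableSpace X] {f : X → CoefVec n l p}
    (hf : Measurable f) : Measurable fun x => circ (f x) :=
  measurable_matrix fun i k => (measurable_pi_apply (k, i)).comp hf

theorem measurable_obsPdf :
    Measurable fun q : Init n l p t × (Fin t → Fin n → ℝ) => obsPdf H (smp q) σ := by
  unfold obsPdf
  refine measurable_const.mul (Finset.measurable_prod _ fun j _ => measurable_const.div ?_)
  exact (((measurable_matrix_det (measurable_LamPost H σ j)).pow_const _).mul_const _).mul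
    ((measurable_matrix_det (measurable_matrix_add (measurable_Bbar H σ j)
      measurable_const)).pow_const _)

/-- Lags reach strictly into the past; this is the adaptedness that the path argument needs. -/
theorem regressor_congr {x x' : Sample n l p t} (u : Fin t) (hψ : x.psi u = x'.psi u)
    (hy0 : x.y0 = x'.y0) (hy : ∀ v < u, x.y v = x'.y v) : x.regressor u = x'.regressor u := by
  funext k
  rcases k with k | k
  · simp [Sample.regressor, hψ]
  · simp only [Sample.regressor, Sum.elim_inr, Sample.lag]
    split_ifs with h
    · rw [hy]
      exact Fin.lt_def.2 (by simp; omega)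
    · rw [hy0]

theorem regressor_castLE {T : ℕ} (ht : t ≤ T) (x : Sample n l p T) (u : Fin t) :
    x.regressor (Fin.castLE ht u) =
      (Sample.mk (firstPart ht x.psi) x.y0 (firstPart ht x.y)).regressor u := rfl

end MeasurableSample

/-! ### Prior law of the parameters and law of the noise in the model. -/

section PriorLaw

variable {Ω : Type*} {F0 : MeasurableSpace Ω} [mΩ : MeasurableSpace Ω] {P : Measure Ω}
  [IsProbabilityMeasure P] {n l p T N : ℕ} {H : Fin N → Hyper n l p} {s : Fin T → Ω → Fin N}
  {ψ : Fin T → Ω → Fin l → ℝ} {y0 : Fin p → Ω → Fin n → ℝ} {y ε : Fin T → Ω → Fin n → ℝ}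
  {Pi : Fin N → Ω → Matrix (Fin n) (Reg n l p) ℝ} {Sig : Fin N → Ω → Matrix (Fin n) (Fin n) ℝ}

/-- The parameters of the regimes in `J`. -/
def params (Pi : Fin N → Ω → Matrix (Fin n) (Reg n l p) ℝ)
    (Sig : Fin N → Ω → Matrix (Fin n) (Fin n) ℝ) (J : Finset (Fin N)) (ω : Ω) : J → Par n l p :=
  fun j => ((Pi j ω).vec, Sig j ω)

theorem IsBayesianMSVAR.measurable_params (hM : IsBayesianMSVAR F0 P H s ψ y0 y ε Pi Sig)
    (J : Finset (Fin N)) : Measurable (params Pi Sig J) :=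
  measurable_pi_lambda _ fun j => (measurable_vec (hM.measurable_Pi j)).prodMk (hM.measurable_Sig j)

/-- Each conditional probability of a regime's parameters given `F0` is a constant. Conditional
independence therefore gives a constant product on boxes, that is, the product prior independently
of `F0`. -/
theorem IsBayesianMSVAR.measure_inter_params (hM : IsBayesianMSVAR F0 P H s ψ y0 y ε Pi Sig)
    (τ : Fin T → Fin N) {A : Set Ω} (hA : MeasurableSet[F0] A)
    {E : Set (regimes τ → Par n l p)} (hE : MeasurableSet E) :
    P[|{ω | (fun u => s u ω) = τ}] (A ∩ params Pi Sig (regimes τ) ⁻¹' E) =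
      P[|{ω | (fun u => s u ω) = τ}] A * Measure.pi (fun j : regimes τ => priorMeasure H j) E := by
  set Q := P[|{ω | (fun u => s u ω) = τ}] with hQ
  have hΘ := hM.measurable_params (regimes τ)
  have hPS : ∀ j, Measurable fun ω => (Pi j ω, Sig j ω) := fun j =>
    (hM.measurable_Pi j).prodMk (hM.measurable_Sig j)
  have hbox : ∀ A, MeasurableSet[F0] A → ∀ B : regimes τ → Set (Par n l p),
      (∀ j, MeasurableSet (B j)) →
      Q (A ∩ params Pi Sig (regimes τ) ⁻¹' Set.univ.pi B) =
        Q A * ∏ j : regimes τ, priorMeasure H j (B j) := by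
    intro A hA B hB
    -- The model speaks of the matrices Π_j, the prior measure of their vectorisations; B'
    -- transports the boxes.
    let B' : regimes τ → Set (Matrix (Fin n) (Reg n l p) ℝ × Matrix (Fin n) (Fin n) ℝ) :=
      fun j => (fun q => (q.1.vec, q.2)) ⁻¹' B j
    have hB' : ∀ j, MeasurableSet (B' j) := fun j =>
      ((measurable_vec measurable_fst).prodMk measurable_snd) (hB j)
    have h1 : ∀ j : regimes τ, Q[((fun ω => (Pi j ω, Sig j ω)) ⁻¹' B' j).indicator
        (fun _ => (1 : ℝ)) | F0] =ᵐ[Q] fun _ => (priorMeasure H j (B j)).toReal := by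
      intro j
      refine condExp_indicator_eq_const hM.F0_le (hPS j (hB' j)) fun A hA => ?_
      exact measure_inter_niw hM.F0_le (measurable_vec (hM.measurable_Pi j))
        (hM.measurable_Sig j) _ (H j).Lam0_posDef (H j).nu0_gt (H j).V0_posDef
        (hM.prior_Sig τ j j.2) (hM.prior_Pi τ j j.2) hA (hB j)
    have h2 := hM.prior_indep τ B' hB'
    have h3 : Q[(⋂ j : regimes τ, (fun ω => (Pi j ω, Sig j ω)) ⁻¹' B' j).indicator
        (fun _ => (1 : ℝ)) | F0] =ᵐ[Q]
          fun _ => ∏ j : regimes τ, (priorMeasure H j (B j)).toReal := by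
      refine h2.trans ?_
      filter_upwards [ae_all_iff.2 h1] with ω hω
      exact Finset.prod_congr rfl fun j _ => hω j
    have h4 : params Pi Sig (regimes τ) ⁻¹' Set.univ.pi B =
        ⋂ j : regimes τ, (fun ω => (Pi j ω, Sig j ω)) ⁻¹' B' j := by
      ext ω
      simp [params, B', Set.mem_pi]
    rw [h4, measure_inter_of_condExp hM.F0_le
      (MeasurableSet.iInter fun j : regimes τ => hPS j.1 (hB' j))
      (fun _ => Finset.prod_nonneg fun _ _ => ENNReal.toReal_nonneg) h3 hA, setLIntegral_const,
      mul_comm, ENNReal.ofReal_prod_of_nonneg fun _ _ => ENNReal.toReal_nonneg]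
    congr 1
    exact Finset.prod_congr rfl fun j _ => ENNReal.ofReal_toReal (measure_ne_top _ _)
  have h5 : (Q.restrict A).map (params Pi Sig (regimes τ)) =
      Q A • Measure.pi (fun j : regimes τ => priorMeasure H j) := by
    have hfin : IsFiniteMeasure (Q A • Measure.pi (fun j : regimes τ => priorMeasure H j)) :=
      Measure.smul_finite _ (measure_ne_top _ _)
    refine ext_of_generate_finite _ generateFrom_pi.symm isPiSystem_pi ?_ ?_
    · rintro _ ⟨B, hB, rfl⟩
      have hB : ∀ j, MeasurableSet (B j) := fun j => hB j (Set.mem_univ j)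
      rw [Measure.map_apply hΘ (MeasurableSet.univ_pi hB),
        Measure.restrict_apply (hΘ (MeasurableSet.univ_pi hB)), Set.inter_comm, hbox A hA B hB,
        Measure.smul_apply, Measure.pi_pi, smul_eq_mul]
    · rw [Measure.map_apply hΘ MeasurableSet.univ]
      simp
  have h6 := congrArg (fun μ => μ E) h5
  simp only [Measure.map_apply hΘ hE, Measure.restrict_apply (hΘ hE), Measure.smul_apply,
    smul_eq_mul] at h6
  rw [Set.inter_comm, h6]

/-- The first `t` noise vectors are independent standard normal vectors. -/
theorem IsBayesianMSVAR.map_firstPart_eps (hM : IsBayesianMSVAR F0 P H s ψ y0 y ε Pi Sig) {t : ℕ}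
    (ht : t ≤ T) : P.map (fun ω => firstPart ht fun u => ε u ω) =
      Measure.pi fun _ : Fin t => mvNormal (0 : Fin n → ℝ) 1 := by
  have h1 : ∀ u, P.map (ε u) = mvNormal (0 : Fin n → ℝ) 1 := by
    intro u
    have h2 : (P.map fun ω u => ε u ω).map (Function.eval u) =
        (Measure.pi fun _ : Fin T => mvNormal (0 : Fin n → ℝ) 1).map (Function.eval u) := by
      rw [hM.law_eps]
    rw [Measure.map_map (measurable_pi_apply u) (measurable_pi_lambda _ hM.measurable_eps),
      (measurePreserving_eval _ u).map_eq] at h2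
    exact h2
  have h3 : iIndepFun ε P := by
    rw [iIndepFun_iff_map_fun_eq_pi_map fun u => (hM.measurable_eps u).aemeasurable, hM.law_eps]
    simp only [h1]
  have h4 := h3.precomp (Fin.castLE_injective ht)
  rw [iIndepFun_iff_map_fun_eq_pi_map fun u => (hM.measurable_eps _).aemeasurable] at h4
  simp only [h1, Function.comp_def] at h4
  exact h4

end PriorLaw
-- Bayes' rule for a whole path.
section PathLaw

variable {n l p t N : ℕ} (H : Fin N → Hyper n l p)

theorem pi_mvNormal_zero_one : (Measure.pi fun _ : Fin t => mvNormal (0 : Fin n → ℝ) 1) =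
    (volume : Measure (Fin t → Fin n → ℝ)).withDensity
      fun z => ∏ u : Fin t, ENNReal.ofReal (gaussPdf 0 1 (z u)) := by
  have h : Measurable fun x : Fin n → ℝ => ENNReal.ofReal (gaussPdf 0 1 x) :=
    (measurable_gaussPdf measurable_const measurable_const measurable_id).ennreal_ofReal
  have : ∀ _ : Fin t, SigmaFinite ((volume : Measure (Fin n → ℝ)).withDensity
      fun x => ENNReal.ofReal (gaussPdf 0 1 x)) := fun _ => by
    rw [← mvNormal_zero_one]; infer_instance
  rw [mvNormal_zero_one]
  exact pi_withDensity (fun _ : Fin t => fun x : Fin n → ℝ => ENNReal.ofReal (gaussPdf 0 1 x))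
    fun _ => h

theorem lintegral_pi_niwMeasure {J : Type*} [Fintype J] (m : J → CoefVec n l p)
    (K : J → Matrix (Reg n l p) (Reg n l p) ℝ) (ν : J → ℝ) (V : J → Matrix (Fin n) (Fin n) ℝ)
    [∀ j, IsProbabilityMeasure (niwMeasure (m j) (K j) (ν j) (V j))]
    {f : (J → Par n l p) → ℝ≥0∞} (hf : Measurable f) :
    ∫⁻ θ, f θ ∂(Measure.pi fun j => niwMeasure (m j) (K j) (ν j) (V j)) =
      ∫⁻ θ, (∏ j, ENNReal.ofReal (niwPdf (m j) (K j) (ν j) (V j) (θ j).1 (θ j).2)) * f θ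
        ∂(Measure.pi fun _ : J => volume.prod (symVolume n)) := by
  have : ∀ j, SigmaFinite ((volume.prod (symVolume n)).withDensity fun θ : Par n l p =>
      ENNReal.ofReal (niwPdf (m j) (K j) (ν j) (V j) θ.1 θ.2)) := fun j => by
    change SigmaFinite (niwMeasure (m j) (K j) (ν j) (V j)); infer_instance
  have h : (Measure.pi fun j => niwMeasure (m j) (K j) (ν j) (V j)) =
      (Measure.pi fun _ : J => volume.prod (symVolume n)).withDensity fun θ : J → Par n l p =>
        ∏ j, ENNReal.ofReal (niwPdf (m j) (K j) (ν j) (V j) (θ j).1 (θ j).2) :=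
    pi_withDensity (fun j (θ : Par n l p) =>
      ENNReal.ofReal (niwPdf (m j) (K j) (ν j) (V j) θ.1 θ.2))
      fun j => measurable_ofReal_niwPdf _ _ _ _
  rw [h]
  refine lintegral_withDensity_eq_lintegral_mul _ ?_ hf
  exact Finset.measurable_prod _ fun j _ =>
    (measurable_ofReal_niwPdf _ _ _ _).comp (measurable_pi_apply j)

/-- The conditional mean of the observation at time `u`. -/
def condMean {J : Finset (Fin N)} {σ : Fin t → Fin N} (hσ : ∀ u, σ u ∈ J) (u : Fin t)
    (r : Init n l p t × (J → Par n l p)) (z : Fin t → Fin n → ℝ) : Fin n → ℝ :=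
  circ (r.2 ⟨σ u, hσ u⟩).1 *ᵥ (smp (r.1, z)).regressor u

theorem measurable_condMean {X : Type*} [MeasurableSpace X] {J : Finset (Fin N)}
    {σ : Fin t → Fin N} (hσ : ∀ u, σ u ∈ J) (u : Fin t)
    {r : X → Init n l p t × (J → Par n l p)} {z : X → Fin t → Fin n → ℝ}
    (hr : Measurable r) (hz : Measurable z) : Measurable fun q => condMean hσ u (r q) (z q) :=
  measurable_matrix_mulVec
    (measurable_circ ((measurable_pi_apply _).comp hr.snd).fst)
    ((measurable_regressor u).comp (hr.fst.prodMk hz))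

/-- The likelihood of the observations. -/
noncomputable def pathPdf {J : Finset (Fin N)} {σ : Fin t → Fin N} (hσ : ∀ u, σ u ∈ J)
    (r : Init n l p t × (J → Par n l p)) (z : Fin t → Fin n → ℝ) : ℝ≥0∞ :=
  ∏ u : Fin t, ENNReal.ofReal (gaussPdf (condMean hσ u r z) (r.2 ⟨σ u, hσ u⟩).2 (z u))

theorem measurable_pathPdf {X : Type*} [MeasurableSpace X] {J : Finset (Fin N)}
    {σ : Fin t → Fin N} (hσ : ∀ u, σ u ∈ J)
    {r : X → Init n l p t × (J → Par n l p)} {z : X → Fin t → Fin n → ℝ}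
    (hr : Measurable r) (hz : Measurable z) : Measurable fun q => pathPdf hσ (r q) (z q) :=
  Finset.measurable_prod _ fun u _ =>
    (measurable_gaussPdf (measurable_condMean hσ u hr hz)
      ((measurable_pi_apply _).comp hr.snd).snd ((measurable_pi_apply u).comp hz)).ennreal_ofReal

/-- Bayes' rule: likelihood times prior is the marginal density times the posterior. -/
theorem prod_priorPdf_mul_pathPdf {J : Finset (Fin N)} {σ : Fin t → Fin N} (hσ : ∀ u, σ u ∈ J)
    (w : Init n l p t) (θ : J → Par n l p) (z : Fin t → Fin n → ℝ) :
    (∏ j : J, ENNReal.ofReal (priorPdf H j (θ j).1 (θ j).2)) * pathPdf hσ (w, θ) z =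
      ENNReal.ofReal (obsPdf H (smp (w, z)) σ) *
        ∏ j : J, ENNReal.ofReal (postPdf H (smp (w, z)) σ j (θ j).1 (θ j).2) := by
  have hJ : regimes σ ⊆ J := by
    intro j hj
    obtain ⟨u, -, rfl⟩ := Finset.mem_image.1 hj
    exact hσ u
  have h1 : pathPdf hσ (w, θ) z = ∏ j : J, ∏ u : {u : Fin t // σ u = j},
      ENNReal.ofReal (gaussPdf (circ (θ j).1 *ᵥ (smp (w, z)).regressor u) (θ j).2 (z u)) := by
    -- The product over times is regrouped by regime, so that the one-regime Bayes formula applies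
    -- factor by factor.
    rw [pathPdf, ← Fintype.prod_fiberwise (fun u => (⟨σ u, hσ u⟩ : J))]
    refine Finset.prod_congr rfl fun j _ => ?_
    refine Fintype.prod_equiv (Equiv.subtypeEquivRight fun u => by
      rw [Subtype.ext_iff]) _ _ fun u => ?_
    obtain ⟨u, rfl⟩ := u
    rfl
  rw [h1, ← prod_obsFactor H (smp (w, z)) σ hJ, ← Finset.prod_coe_sort J (obsFactor H (smp (w, z)) σ),
    ENNReal.ofReal_prod_of_nonneg fun j _ => obsFactor_nonneg _ _ _ _, ← Finset.prod_mul_distrib,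
    ← Finset.prod_mul_distrib]
  refine Finset.prod_congr rfl fun j _ => ?_
  have h2 := likelihood_mul_priorPdf H (smp (w, z)) σ j (θ j).1 (θ j).2
  -- Signs of the normal density are controlled only at positive definite covariances; elsewhere
  -- both sides vanish.
  by_cases hS : (θ j).2.PosDef
  · rw [← ENNReal.ofReal_prod_of_nonneg fun u _ => gaussPdf_nonneg _ hS _,
      ← ENNReal.ofReal_mul (priorPdf_nonneg _ _ _ _), ← ENNReal.ofReal_mul (obsFactor_nonneg _ _ _ _),
      mul_comm, ← h2]
    rfl
  · simp [priorPdf, postPdf, niwPdf, iwPdf_of_not_posDef _ _ hS]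

/-- Bayes' rule in integrated form. -/
theorem lintegral_prior_pathPdf {J : Finset (Fin N)} {σ : Fin t → Fin N} (hσ : ∀ u, σ u ∈ J)
    (w : Init n l p t) {F : (J → Par n l p) × (Fin t → Fin n → ℝ) → ℝ≥0∞} (hF : Measurable F) :
    ∫⁻ θ, ∫⁻ z, F (θ, z) * pathPdf hσ (w, θ) z ∂volume
        ∂(Measure.pi fun j : J => priorMeasure H j) =
      ∫⁻ z, ENNReal.ofReal (obsPdf H (smp (w, z)) σ) *
        ∫⁻ θ, F (θ, z) ∂(Measure.pi fun j : J => postMeasure H (smp (w, z)) σ j) := by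
  have hL : Measurable fun q : (J → Par n l p) × (Fin t → Fin n → ℝ) => pathPdf hσ (w, q.1) q.2 :=
    measurable_pathPdf hσ (measurable_const.prodMk measurable_fst) measurable_snd
  have hFL : Measurable fun q : (J → Par n l p) × (Fin t → Fin n → ℝ) =>
    F q * pathPdf hσ (w, q.1) q.2 := hF.mul hL
  -- With the path outside, Bayes' rule is applied to the parameters at a fixed path.
  rw [lintegral_lintegral_swap (f := fun θ z => F (θ, z) * pathPdf hσ (w, θ) z) hFL.aemeasurable]
  refine lintegral_congr fun z => ?_
  have hFz : Measurable fun θ => F (θ, z) := hF.comp measurable_prodMk_right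
  have hFLz : Measurable fun θ => F (θ, z) * pathPdf hσ (w, θ) z :=
    hFz.mul (measurable_pathPdf hσ (measurable_const.prodMk measurable_id) measurable_const)
  have i1 : ∀ j : J, IsProbabilityMeasure
    (niwMeasure (H j).pi0 (H j).Lam0 (H j).nu0 (H j).V0) := fun j =>
      isProbabilityMeasure_priorMeasure H j
  have i2 : ∀ j : J, IsProbabilityMeasure (niwMeasure (Cmat H (smp (w, z)) σ j).vec
      (LamPost H (smp (w, z)) σ j)⁻¹ ((H j).nu0 + visitCount σ j)
      (Bbar H (smp (w, z)) σ j + (H j).V0)) := fun j => isProbabilityMeasure_postMeasure H _ σ j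
  simp only [priorMeasure, postMeasure]
  rw [lintegral_pi_niwMeasure _ _ _ _ hFLz, lintegral_pi_niwMeasure _ _ _ _ hFz,
    ← lintegral_const_mul' _ _ ENNReal.ofReal_ne_top]
  refine lintegral_congr fun θ => ?_
  have h := prod_priorPdf_mul_pathPdf H hσ w θ z
  simp only [priorPdf, postPdf] at h
  rw [mul_comm (F (θ, z)), ← mul_assoc, h, mul_assoc]

end PathLaw
/-- The joint law, under `Q`, of the observations `z` and the parameters `Θ` of the regimes in `J`,
given the initial information: the observations have the density `obsPdf`, and given them the
parameters of different regimes are independent with the posterior laws. -/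
def HasPosterior {Ω : Type*} (F0 : MeasurableSpace Ω) [mΩ : MeasurableSpace Ω] (Q : Measure Ω)
    {n l p t N : ℕ} (H : Fin N → Hyper n l p) (σ : Fin t → Fin N) (w : Ω → Init n l p t)
    (z : Ω → Fin t → Fin n → ℝ) (J : Finset (Fin N))
    (Θ : Ω → J → Par n l p) : Prop :=
  ∀ A, MeasurableSet[F0] A →
    ∀ F : (Init n l p t × (Fin t → Fin n → ℝ)) × (J → Par n l p) → ℝ≥0∞, Measurable F →
      ∫⁻ ω in A, F ((w ω, z ω), Θ ω) ∂Q =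
        ∫⁻ ω in A, ∫⁻ v, ENNReal.ofReal (obsPdf H (smp (w ω, v)) σ) *
          ∫⁻ θ, F ((w ω, v), θ) ∂(Measure.pi fun j : J => postMeasure H (smp (w ω, v)) σ j)
            ∂volume ∂Q

/-! ### Joint law of observations and parameters in the model. -/

section Posterior

variable {Ω : Type*} {F0 : MeasurableSpace Ω} [mΩ : MeasurableSpace Ω] {P : Measure Ω}
  [IsProbabilityMeasure P] {n l p T N : ℕ} {H : Fin N → Hyper n l p} {s : Fin T → Ω → Fin N}
  {ψ : Fin T → Ω → Fin l → ℝ} {y0 : Fin p → Ω → Fin n → ℝ} {y ε : Fin T → Ω → Fin n → ℝ}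
  {Pi : Fin N → Ω → Matrix (Fin n) (Reg n l p) ℝ} {Sig : Fin N → Ω → Matrix (Fin n) (Fin n) ℝ}
  {t : ℕ}

/-- The exogenous variables up to the time `t` and the initial values. -/
def initOf (ψ : Fin T → Ω → Fin l → ℝ) (y0 : Fin p → Ω → Fin n → ℝ) (ht : t ≤ T) (ω : Ω) :
    Init n l p t :=
  (firstPart ht fun u => ψ u ω, fun i => y0 i ω)

theorem IsBayesianMSVAR.measurable_initOf (hM : IsBayesianMSVAR F0 P H s ψ y0 y ε Pi Sig)
    (ht : t ≤ T) : Measurable[F0] (initOf ψ y0 ht) :=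
  Measurable.prodMk (@measurable_pi_lambda _ _ _ F0 _ _ fun _ => hM.measurable_psi _)
    (@measurable_pi_lambda _ _ _ F0 _ _ fun i => hM.measurable_y0 i)

theorem IsBayesianMSVAR.measurable_firstPart_y (hM : IsBayesianMSVAR F0 P H s ψ y0 y ε Pi Sig)
    (ht : t ≤ T) : Measurable fun ω => firstPart ht fun u => y u ω :=
  measurable_pi_lambda _ fun _ => hM.measurable_y _

theorem IsBayesianMSVAR.measurable_firstPart_eps
    (hM : IsBayesianMSVAR F0 P H s ψ y0 y ε Pi Sig) (ht : t ≤ T) :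
    Measurable fun ω => firstPart ht fun u => ε u ω :=
  measurable_pi_lambda _ fun _ => hM.measurable_eps _

theorem IsBayesianMSVAR.measurableSet_regimes (hM : IsBayesianMSVAR F0 P H s ψ y0 y ε Pi Sig)
    (τ : Fin T → Fin N) : MeasurableSet {ω | (fun u => s u ω) = τ} :=
  (measurable_pi_lambda (fun ω u => s u ω) hM.measurable_s) (measurableSet_singleton τ)

theorem mem_regimes (σ : Fin t → Fin N) (u : Fin t) : σ u ∈ regimes σ :=
  Finset.mem_image_of_mem _ (Finset.mem_univ u)

theorem regimes_firstPart_subset (ht : t ≤ T) (τ : Fin T → Fin N) :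
    regimes (firstPart ht τ) ⊆ regimes τ := by
  intro j hj
  obtain ⟨u, -, rfl⟩ := Finset.mem_image.1 hj
  exact mem_regimes τ _

/-- The information in the initial values, the parameters of the realised regimes and the
regimes. -/
abbrev structuralField (F0 : MeasurableSpace Ω) (s : Fin T → Ω → Fin N)
    (Pi : Fin N → Ω → Matrix (Fin n) (Reg n l p) ℝ)
    (Sig : Fin N → Ω → Matrix (Fin n) (Fin n) ℝ) : MeasurableSpace Ω :=
  F0 ⊔ MeasurableSpace.comap (fun ω u => (Pi (s u ω) ω, Sig (s u ω) ω)) inferInstance ⊔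
    MeasurableSpace.comap (fun ω u => s u ω) inferInstance

/-- Given the regimes, the parameters are independent of the initial information and have the prior
law. -/
theorem IsBayesianMSVAR.lintegral_init_params (hM : IsBayesianMSVAR F0 P H s ψ y0 y ε Pi Sig)
    (ht : t ≤ T) (τ : Fin T → Fin N) {A : Set Ω} (hA : MeasurableSet[F0] A)
    {F : Init n l p t × (regimes τ → Par n l p) → ℝ≥0∞} (hF : Measurable F) :
    ∫⁻ ω in A, F (initOf ψ y0 ht ω, params Pi Sig (regimes τ) ω)
        ∂P[|{ω | (fun u => s u ω) = τ}] =
      ∫⁻ ω in A, ∫⁻ θ, F (initOf ψ y0 ht ω, θ)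
        ∂(Measure.pi fun j : regimes τ => priorMeasure H j) ∂P[|{ω | (fun u => s u ω) = τ}] := by
  set Q := P[|{ω | (fun u => s u ω) = τ}]
  have hw0 := hM.measurable_initOf ht
  have hw : Measurable (initOf ψ y0 ht) := hw0.mono hM.F0_le le_rfl
  have hΘ := hM.measurable_params (regimes τ)
  have h1 : (Q.restrict A).map (fun ω => (initOf ψ y0 ht ω, params Pi Sig (regimes τ) ω)) =
      ((Q.restrict A).map (initOf ψ y0 ht)).prod
        (Measure.pi fun j : regimes τ => priorMeasure H j) := by
    refine (Measure.prod_eq fun C E hC hE => ?_).symm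
    rw [Measure.map_apply (hw.prodMk hΘ) (hC.prod hE),
      Measure.restrict_apply ((hw.prodMk hΘ) (hC.prod hE)), Measure.map_apply hw hC,
      Measure.restrict_apply (hw hC), Set.inter_comm (initOf ψ y0 ht ⁻¹' C),
      ← hM.measure_inter_params τ (MeasurableSet.inter hA (hw0 hC)) hE]
    congr 1
    ext ω
    simp only [Set.mem_inter_iff, Set.mem_preimage, Set.mem_prod]
    tauto
  rw [← lintegral_map hF (hw.prodMk hΘ), h1, lintegral_prod _ hF.aemeasurable,
    lintegral_map hF.lintegral_prod_right' hw]

/-- Given the regimes, the noise is independent of the initial information and the parameters. -/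
theorem IsBayesianMSVAR.lintegral_eps (hM : IsBayesianMSVAR F0 P H s ψ y0 y ε Pi Sig)
    (ht : t ≤ T) (τ : Fin T → Fin N) {A : Set Ω} (hA : MeasurableSet[F0] A)
    {F : (Init n l p t × (regimes τ → Par n l p)) × (Fin t → Fin n → ℝ) → ℝ≥0∞}
    (hF : Measurable F) :
    ∫⁻ ω in A, F ((initOf ψ y0 ht ω, params Pi Sig (regimes τ) ω), firstPart ht fun u => ε u ω)
        ∂P[|{ω | (fun u => s u ω) = τ}] =
      ∫⁻ ω in A, ∫⁻ z, F ((initOf ψ y0 ht ω, params Pi Sig (regimes τ) ω), z) *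
        ∏ u, ENNReal.ofReal (gaussPdf 0 1 (z u)) ∂volume ∂P[|{ω | (fun u => s u ω) = τ}] := by
  set Q := P[|{ω | (fun u => s u ω) = τ}] with hQ
  have hτ := hM.measurableSet_regimes τ
  have hw0 := hM.measurable_initOf ht
  have hw : Measurable (initOf ψ y0 ht) := hw0.mono hM.F0_le le_rfl
  have hΘ := hM.measurable_params (regimes τ)
  have hε := hM.measurable_firstPart_eps ht
  have hA' := hM.F0_le _ hA
  set R : Ω → Init n l p t × (regimes τ → Par n l p) :=
    fun ω => (initOf ψ y0 ht ω, params Pi Sig (regimes τ) ω) with hR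
  have hRm : Measurable R := hw.prodMk hΘ
  have hex : ∀ j : regimes τ, ∃ u, τ u = j := fun j => by
    obtain ⟨u, -, hu⟩ := Finset.mem_image.1 j.2
    exact ⟨u, hu⟩
  -- The noise is assumed independent only of the parameters of the realised regimes. Each regime of
  -- τ occurs at some time e j, so on s = τ its parameters can be read off there.
  choose e he using hex
  let R' : Ω → Init n l p t × (regimes τ → Par n l p) := fun ω =>
    (initOf ψ y0 ht ω, fun j => ((Pi (s (e j) ω) ω).vec, Sig (s (e j) ω) ω))
  have hR' : Measurable[structuralField F0 s Pi Sig] R' := by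
    refine Measurable.prodMk (hw0.mono (le_sup_left.trans le_sup_left) le_rfl) ?_
    have h1 : Measurable[structuralField F0 s Pi Sig] fun ω u => (Pi (s u ω) ω, Sig (s u ω) ω) :=
      (Measurable.of_comap_le le_rfl).mono (le_sup_right.trans le_sup_left) le_rfl
    have h2 : Measurable fun (q : Fin T → Matrix (Fin n) (Reg n l p) ℝ × Matrix (Fin n) (Fin n) ℝ)
        (j : regimes τ) => ((q (e j)).1.vec, (q (e j)).2) :=
      measurable_pi_lambda _ fun j => (measurable_vec (measurable_pi_apply (e j)).fst).prodMk
        (measurable_pi_apply (e j)).snd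
    exact h2.comp h1
  have hRR' : ∀ ω, (fun u => s u ω) = τ → R ω = R' ω := by
    intro ω hω
    refine Prod.ext rfl (funext fun j => ?_)
    have h1 : s (e j) ω = j := by rw [← he j, ← hω]
    simp only [hR, R', params, h1]
  have hind : ∀ E G, MeasurableSet E → MeasurableSet G →
      Q (A ∩ R ⁻¹' E ∩ (fun ω => firstPart ht fun u => ε u ω) ⁻¹' G) =
        Q (A ∩ R ⁻¹' E) * Measure.pi (fun _ : Fin t => mvNormal (0 : Fin n → ℝ) 1) G := by
    intro E G hE hG
    have h1 : MeasurableSet[structuralField F0 s Pi Sig]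
        ({ω | (fun u => s u ω) = τ} ∩ (A ∩ R ⁻¹' E)) := by
      have h2 : {ω | (fun u => s u ω) = τ} ∩ (A ∩ R ⁻¹' E) =
          {ω | (fun u => s u ω) = τ} ∩ (A ∩ R' ⁻¹' E) := by
        ext ω
        simp only [Set.mem_inter_iff, Set.mem_preimage, Set.mem_ofPred_eq]
        refine and_congr_right fun hω => ?_
        rw [hRR' ω hω]
      rw [h2]
      refine MeasurableSet.inter (le_sup_right (a := F0 ⊔ _) _ ⟨{τ}, measurableSet_singleton τ, rfl⟩)
        (MeasurableSet.inter ((le_sup_left (b := MeasurableSpace.comap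
          (fun ω u => (Pi (s u ω) ω, Sig (s u ω) ω)) inferInstance)).trans le_sup_left _ hA) (hR' hE))
    have h3 : MeasurableSet[MeasurableSpace.comap (fun ω u => ε u ω) inferInstance]
        ((fun ω => firstPart ht fun u => ε u ω) ⁻¹' G) := by
      have h4 : Measurable fun q : Fin T → Fin n → ℝ => firstPart ht q :=
        measurable_pi_lambda _ fun u => measurable_pi_apply _
      exact ⟨_, h4 hG, rfl⟩
    have h5 := (ProbabilityTheory.Indep_iff _ _ _).1 hM.indep_eps _ _ h3 h1
    rw [hQ, cond_apply hτ, cond_apply hτ, ← Set.inter_assoc, Set.inter_comm _ (_ ⁻¹' G), h5,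
      ← hM.map_firstPart_eps ht, Measure.map_apply hε hG]
    ring
  have hmap : (Q.restrict A).map (fun ω => (R ω, firstPart ht fun u => ε u ω)) =
      ((Q.restrict A).map R).prod (Measure.pi fun _ : Fin t => mvNormal (0 : Fin n → ℝ) 1) := by
    refine (Measure.prod_eq fun E G hE hG => ?_).symm
    rw [Measure.map_apply (hRm.prodMk hε) (hE.prod hG),
      Measure.restrict_apply ((hRm.prodMk hε) (hE.prod hG)), Measure.map_apply hRm hE,
      Measure.restrict_apply (hRm hE), Set.inter_comm (R ⁻¹' E), ← hind E G hE hG]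
    congr 1
    ext ω
    simp only [Set.mem_inter_iff, Set.mem_preimage, Set.mem_prod]
    tauto
  have hdens : Measurable fun z : Fin t → Fin n → ℝ =>
      ∏ u : Fin t, ENNReal.ofReal (gaussPdf 0 1 (z u)) :=
    Finset.measurable_prod _ fun u _ => (measurable_gaussPdf measurable_const measurable_const
      (measurable_pi_apply u)).ennreal_ofReal
  rw [← lintegral_map hF (hRm.prodMk hε), hmap, lintegral_prod _ hF.aemeasurable,
    lintegral_map hF.lintegral_prod_right' hRm]
  refine lintegral_congr fun ω => ?_
  have hFω : Measurable fun z => F (R ω, z) := hF.comp measurable_prodMk_left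
  rw [pi_mvNormal_zero_one, lintegral_withDensity_eq_lintegral_mul _ hdens hFω]
  exact lintegral_congr fun z => mul_comm _ _

/-- Noise turned into a path, parameters replaced by their prior, then Bayes' rule at fixed initial
information. -/
theorem IsBayesianMSVAR.hasPosterior (hM : IsBayesianMSVAR F0 P H s ψ y0 y ε Pi Sig)
    (ht : t ≤ T) (τ : Fin T → Fin N) :
    HasPosterior F0 P[|{ω | (fun u => s u ω) = τ}] H (firstPart ht τ) (initOf ψ y0 ht)
      (fun ω => firstPart ht fun u => y u ω) (regimes τ) (params Pi Sig (regimes τ)) := by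
  intro A hA F hF
  set Q := P[|{ω | (fun u => s u ω) = τ}] with hQ
  have hτ := hM.measurableSet_regimes τ
  have hw : Measurable (initOf ψ y0 ht) := (hM.measurable_initOf ht).mono hM.F0_le le_rfl
  have hΘ := hM.measurable_params (regimes τ)
  have hσ : ∀ u, firstPart ht τ u ∈ regimes τ := fun u => mem_regimes τ _
  -- The dynamics only assert that some factor L exists at each ω; the path lemma needs it as a
  -- measurable function of the covariance, and uniqueness identifies the two.
  obtain ⟨c, hc, hcL⟩ := exists_measurable_cholesky n
  let S : Fin t → Init n l p t × (regimes τ → Par n l p) → Matrix (Fin n) (Fin n) ℝ :=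
    fun u r => (r.2 ⟨firstPart ht τ u, hσ u⟩).2
  have hS : ∀ u, Measurable (S u) := fun u => ((measurable_pi_apply _).comp measurable_snd).snd
  let G : (Init n l p t × (regimes τ → Par n l p)) × (Fin t → Fin n → ℝ) → ℝ≥0∞ :=
    fun q => F ((q.1.1, q.2), q.1.2)
  have hG : Measurable G := hF.comp (by fun_prop)
  have hdynamics : ∀ᵐ ω ∂Q.restrict A, ∀ u : Fin t, ∃ L,
      IsCholeskyFactor L (S u (initOf ψ y0 ht ω, params Pi Sig (regimes τ) ω)) ∧
      firstPart ht (fun u => y u ω) u =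
        condMean hσ u (initOf ψ y0 ht ω, params Pi Sig (regimes τ) ω)
          (firstPart ht fun u => y u ω) + L *ᵥ firstPart ht (fun u => ε u ω) u := by
    refine ae_restrict_of_ae ?_
    have h1 : ∀ᵐ ω ∂Q, ω ∈ {ω | (fun u => s u ω) = τ} := ae_cond_mem hτ
    have h2 := (cond_absolutelyContinuous (μ := P)
      (s := {ω | (fun u => s u ω) = τ})).ae_le hM.dynamics
    filter_upwards [h1, h2] with ω hω1 hω2 u
    obtain ⟨L, hL, hy⟩ := hω2 (Fin.castLE ht u)
    have h3 : s (Fin.castLE ht u) ω = firstPart ht τ u := congrFun hω1 (Fin.castLE ht u)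
    rw [h3] at hL hy
    refine ⟨L, hL, ?_⟩
    rw [regressor_castLE] at hy
    exact hy
  have hpath := lintegral_path (μ := Q.restrict A)
    (R := fun ω => (initOf ψ y0 ht ω, params Pi Sig (regimes τ) ω))
    (y := fun ω => firstPart ht fun u => y u ω) (ε := fun ω => firstPart ht fun u => ε u ω)
    (fun F hF => hM.lintegral_eps ht τ hA hF)
    (m := fun u r z => condMean hσ u r z) (S := S) (L := fun u r => c (S u r))
    (fun u => measurable_condMean hσ u measurable_fst measurable_snd) hS
    (fun u => hc.comp (hS u)) ?_ ?_ ?_ hG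
  rotate_left
  · intro u r z z' hz
    rw [condMean, condMean, regressor_congr u (x := smp (r.1, z)) (x' := smp (r.1, z')) rfl rfl hz]
  · filter_upwards [hdynamics] with ω hω u
    obtain ⟨L, hL, -⟩ := hω u
    rw [hcL L _ hL]
    exact ⟨hL.2.2, hL.det_ne_zero⟩
  · filter_upwards [hdynamics] with ω hω u
    obtain ⟨L, hL, hy⟩ := hω u
    rw [hcL L _ hL]
    exact hy
  refine hpath.trans ?_
  have hΦ : Measurable fun r : Init n l p t × (regimes τ → Par n l p) =>
      ∫⁻ z, G (r, z) * pathPdf hσ r z := by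
    have h1 : Measurable fun q : (Init n l p t × (regimes τ → Par n l p)) × (Fin t → Fin n → ℝ) =>
        G q * pathPdf hσ q.1 q.2 := hG.mul (measurable_pathPdf hσ measurable_fst measurable_snd)
    exact h1.lintegral_prod_right'
  refine (hM.lintegral_init_params ht τ hA hΦ).trans ?_
  refine lintegral_congr fun ω => ?_
  exact lintegral_prior_pathPdf H hσ (initOf ψ y0 ht ω)
    (F := fun q => F ((initOf ψ y0 ht ω, q.2), q.1)) (hF.comp (by fun_prop))

end Posterior
-- Changing the regimes and the conditioning event; conditional densities.
theorem setLIntegral_cond {Ω : Type*} {mΩ : MeasurableSpace Ω} {P : Measure Ω} {A S : Set Ω}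
    (hA : MeasurableSet A) (f : Ω → ℝ≥0∞) :
    ∫⁻ ω in A, f ω ∂P[|S] = (P S)⁻¹ * ∫⁻ ω in A ∩ S, f ω ∂P := by
  rw [ProbabilityTheory.cond, Measure.restrict_smul, Measure.restrict_restrict hA,
    lintegral_smul_measure, smul_eq_mul]

section HasPosterior

variable {Ω : Type*} {F0 : MeasurableSpace Ω} [mΩ : MeasurableSpace Ω]
    {n l p t N : ℕ} {H : Fin N → Hyper n l p} {σ : Fin t → Fin N}
    {w : Ω → Init n l p t} {z : Ω → Fin t → Fin n → ℝ} {J : Finset (Fin N)}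

theorem lintegral_pi_restrict {J J' : Finset (Fin N)} (hJ : J' ⊆ J)
    (μ : Fin N → Measure (Par n l p)) [∀ j, IsProbabilityMeasure (μ j)]
    {f : (J' → Par n l p) → ℝ≥0∞} (hf : Measurable f) :
    ∫⁻ θ, f (fun j => θ ⟨j, hJ j.2⟩) ∂(Measure.pi fun j : J => μ j) =
      ∫⁻ θ, f θ ∂(Measure.pi fun j : J' => μ j) := by
  have h := isProjectiveMeasureFamily_pi μ J J' hJ
  simp only at h
  rw [h, lintegral_map hf (Finset.measurable_restrict₂ hJ)]
  rfl

/-- The posterior is a product of probability measures, so the discarded regimes integrate out to 1.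
-/
theorem HasPosterior.mono {Q : Measure Ω} {J' : Finset (Fin N)} (hJ : J' ⊆ J)
    {θ : Fin N → Ω → Par n l p}
    (h : HasPosterior F0 Q H σ w z J (fun ω j => θ j ω)) :
    HasPosterior F0 Q H σ w z J' (fun ω j => θ j ω) := by
  intro A hA F hF
  have hF' : Measurable fun q : (Init n l p t × (Fin t → Fin n → ℝ)) × (J → Par n l p) =>
      F (q.1, fun j : J' => q.2 ⟨j, hJ j.2⟩) :=
    hF.comp (measurable_fst.prodMk (measurable_pi_lambda _ fun j =>
      (measurable_pi_apply _).comp measurable_snd))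
  refine (h A hA _ hF').trans ?_
  refine lintegral_congr fun ω => lintegral_congr fun v => ?_
  congr 1
  have hF2 : Measurable fun θ : J' → Par n l p => F ((w ω, v), θ) := hF.comp measurable_prodMk_left
  exact lintegral_pi_restrict hJ (fun j => postMeasure H (smp (w ω, v)) σ j) hF2

/-- The posterior formula passes to finite unions of conditioning events. -/
theorem HasPosterior.biUnion {P : Measure Ω} [IsFiniteMeasure P] (hm : F0 ≤ mΩ)
    {ι : Type*} {I : Finset ι} {S : ι → Set Ω}
    (hS : ∀ i ∈ I, MeasurableSet (S i)) (hd : Set.PairwiseDisjoint (I : Set ι) S)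
    {Θ : Ω → J → Par n l p}
    (h : ∀ i ∈ I, HasPosterior F0 P[|S i] H σ w z J Θ) :
    HasPosterior F0 P[|⋃ i ∈ I, S i] H σ w z J Θ := by
  intro A hA F hF
  have hA' := hm _ hA
  rw [setLIntegral_cond hA', setLIntegral_cond hA']
  congr 1
  rw [Set.inter_iUnion₂,
    lintegral_biUnion_finset (fun i hi j hj hij => (hd hi hj hij).mono Set.inter_subset_right
      Set.inter_subset_right) (fun i hi => hA'.inter (hS i hi)),
    lintegral_biUnion_finset (fun i hi j hj hij => (hd hi hj hij).mono Set.inter_subset_right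
      Set.inter_subset_right) (fun i hi => hA'.inter (hS i hi))]
  refine Finset.sum_congr rfl fun i hi => ?_
  -- On a null event the factor 1/P(S i) is infinite and cannot be cancelled, but both integrals
  -- vanish.
  by_cases h0 : P (S i) = 0
  · have h1 : P (A ∩ S i) = 0 := measure_mono_null Set.inter_subset_right h0
    rw [setLIntegral_measure_zero _ _ h1, setLIntegral_measure_zero _ _ h1]
  · have h1 := h i hi A hA F hF
    rw [setLIntegral_cond hA', setLIntegral_cond hA'] at h1
    exact (ENNReal.mul_right_inj (ENNReal.inv_ne_zero.2 (measure_ne_top _ _))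
      (ENNReal.inv_ne_top.2 h0)).1 h1

/-- Conditional density of the observations. -/
theorem HasPosterior.hasCondDensity_obs {Q : Measure Ω} [IsFiniteMeasure Q] (hm : F0 ≤ mΩ)
    (hw : Measurable[F0] w) (hz : Measurable z) {Θ : Ω → J → Par n l p}
    (h : HasPosterior F0 Q H σ w z J Θ) :
    HasCondDensity Q F0 z volume (fun ω v => obsPdf H (smp (w ω, v)) σ) := by
  have hg : Measurable fun q : (Init n l p t × Unit) × (Fin t → Fin n → ℝ) =>
      obsPdf H (smp (q.1.1, q.2)) σ :=
    (measurable_obsPdf H σ).comp (measurable_fst.fst.prodMk measurable_snd)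
  -- The second conditioning variable is taken constant, so the join of σ-algebras reduces to `F0`.
  have hQ := hasCondDensity_of_measure_inter (Q := Q) hm hw
    (measurable_const : Measurable fun _ : Ω => ()) hz (ρ := volume)
    (g := fun a _ v => obsPdf H (smp (a, v)) σ) hg (fun a _ v => obsPdf_nonneg _ _ _) ?_
  · simpa only [MeasurableSpace.comap_const, sup_bot_eq] using hQ
  · intro A C B hA hC hB
    have hAC : MeasurableSet[F0] (A ∩ (fun _ : Ω => ()) ⁻¹' C) :=
      MeasurableSet.inter hA (@measurable_const _ _ _ F0 () C hC)
    have h1 := h _ hAC (fun q => B.indicator 1 q.1.2)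
      ((measurable_one.indicator hB).comp measurable_fst.snd)
    have h2 : ∫⁻ ω in A ∩ (fun _ : Ω => ()) ⁻¹' C,
        B.indicator (1 : (Fin t → Fin n → ℝ) → ℝ≥0∞) (z ω) ∂Q =
        Q (A ∩ (fun _ : Ω => ()) ⁻¹' C ∩ z ⁻¹' B) := by
      have h3 : ∀ ω, B.indicator (1 : (Fin t → Fin n → ℝ) → ℝ≥0∞) (z ω) =
          (z ⁻¹' B).indicator 1 ω := fun ω => rfl
      simp only [h3]
      rw [lintegral_indicator_one (hz hB), Measure.restrict_apply (hz hB), Set.inter_comm]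
    rw [← h2]
    refine h1.trans (lintegral_congr fun ω => ?_)
    rw [← lintegral_indicator hB]
    refine lintegral_congr fun v => ?_
    by_cases hv : v ∈ B <;> simp [hv]

/-- Conditional densities of functions of the parameters. -/
theorem HasPosterior.hasCondDensity {Q : Measure Ω} [IsFiniteMeasure Q] (hm : F0 ≤ mΩ)
    (hw : Measurable[F0] w) (hz : Measurable z) {Θ : Ω → J → Par n l p} (hΘ : Measurable Θ)
    (h : HasPosterior F0 Q H σ w z J Θ) {Z E : Type*} [mZ : MeasurableSpace Z]
    [MeasurableSpace E] {c : (J → Par n l p) → Z} (hc : Measurable c) {X : (J → Par n l p) → E}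
    (hX : Measurable X) {ρ : Measure E} [SFinite ρ]
    {g : Init n l p t × (Fin t → Fin n → ℝ) → Z → E → ℝ}
    (hg : Measurable fun q : ((Init n l p t × (Fin t → Fin n → ℝ)) × Z) × E => g q.1.1 q.1.2 q.2)
    (hg0 : ∀ q a e, 0 ≤ g q a e)
    (hκ : ∀ q C B, MeasurableSet C → MeasurableSet B →
      Measure.pi (fun j : J => postMeasure H (smp q) σ j) (c ⁻¹' C ∩ X ⁻¹' B) =
        ∫⁻ θ in c ⁻¹' C, ∫⁻ x in B, ENNReal.ofReal (g q (c θ) x) ∂ρ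
          ∂Measure.pi fun j : J => postMeasure H (smp q) σ j) :
    HasCondDensity Q (F0 ⊔ MeasurableSpace.comap z inferInstance ⊔
        mZ.comap fun ω => c (Θ ω)) (fun ω => X (Θ ω)) ρ
      (fun ω => g (w ω, z ω) (c (Θ ω))) := by
  have hzc : Measurable fun ω => (z ω, c (Θ ω)) := hz.prodMk (hc.comp hΘ)
  have hg' : Measurable fun q : (Init n l p t × ((Fin t → Fin n → ℝ) × Z)) × E =>
      g (q.1.1, q.1.2.1) q.1.2.2 q.2 := by
    have h1 : Measurable fun q : (Init n l p t × ((Fin t → Fin n → ℝ) × Z)) × E =>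
        (((q.1.1, q.1.2.1), q.1.2.2), q.2) := by fun_prop
    exact hg.comp h1
  have hQ := hasCondDensity_of_measure_inter (Q := Q) hm hw hzc (hX.comp hΘ) (ρ := ρ)
    (g := fun a b e => g (a, b.1) b.2 e) hg' (fun _ _ _ => hg0 _ _ _) ?_
  · have e : MeasurableSpace.comap (fun ω => (z ω, c (Θ ω))) Prod.instMeasurableSpace =
        MeasurableSpace.comap z inferInstance ⊔ mZ.comap fun ω => c (Θ ω) :=
      MeasurableSpace.comap_prodMk _ _
    rw [e, ← sup_assoc] at hQ
    exact hQ
  · intro A C B hA hC hB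
    have hXB : MeasurableSet ((X ∘ Θ) ⁻¹' B) := (hX.comp hΘ) hB
    have hk : Measurable fun q : (Init n l p t × (Fin t → Fin n → ℝ)) × Z =>
        ∫⁻ x in B, ENNReal.ofReal (g q.1 q.2 x) ∂ρ := hg.ennreal_ofReal.lintegral_prod_right'
    have hD : Measurable fun q : (Init n l p t × (Fin t → Fin n → ℝ)) × (J → Par n l p) =>
        (q.1.2, c q.2) := measurable_fst.snd.prodMk (hc.comp measurable_snd)
    have h1 := h A hA (fun q => C.indicator 1 (q.1.2, c q.2) * B.indicator 1 (X q.2))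
      (((measurable_one.indicator hC).comp hD).mul
        ((measurable_one.indicator hB).comp (hX.comp measurable_snd)))
    have h2 := h A hA (fun q => C.indicator 1 (q.1.2, c q.2) *
        ∫⁻ x in B, ENNReal.ofReal (g q.1 (c q.2) x) ∂ρ)
      (((measurable_one.indicator hC).comp hD).mul
        (hk.comp (measurable_fst.prodMk (hc.comp measurable_snd))))
    have h3 : ∀ f : Ω → ℝ≥0∞,
        ∫⁻ ω in A, C.indicator (1 : (Fin t → Fin n → ℝ) × Z → ℝ≥0∞) (z ω, c (Θ ω)) * f ω ∂Q =
          ∫⁻ ω in A ∩ (fun ω => (z ω, c (Θ ω))) ⁻¹' C, f ω ∂Q := by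
      intro f
      rw [Set.inter_comm, ← Measure.restrict_restrict (hzc hC), ← lintegral_indicator (hzc hC)]
      refine lintegral_congr fun ω => ?_
      by_cases hω : (z ω, c (Θ ω)) ∈ C <;> simp [Set.indicator, hω]
    rw [h3] at h1 h2
    have h4 : ∫⁻ ω in A ∩ (fun ω => (z ω, c (Θ ω))) ⁻¹' C,
        B.indicator (1 : E → ℝ≥0∞) (X (Θ ω)) ∂Q =
          Q (A ∩ (fun ω => (z ω, c (Θ ω))) ⁻¹' C ∩ (X ∘ Θ) ⁻¹' B) := by
      have h5 : ∀ ω, B.indicator (1 : E → ℝ≥0∞) (X (Θ ω)) = ((X ∘ Θ) ⁻¹' B).indicator 1 ω :=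
        fun ω => rfl
      simp only [h5]
      rw [lintegral_indicator_one hXB, Measure.restrict_apply hXB, Set.inter_comm]
    rw [← h4, h1]
    refine Eq.trans ?_ h2.symm
    refine lintegral_congr fun ω => lintegral_congr fun v => ?_
    congr 1
    -- With the observation fixed at v, the event on (z, c(Θ)) becomes its slice, and the
    -- disintegration `hκ` is applied fibre by fibre.
    have hCv : MeasurableSet (Prod.mk v ⁻¹' C) := measurable_prodMk_left hC
    have h6 := hκ (w ω, v) (Prod.mk v ⁻¹' C) B hCv hB
    have h7 : ∀ f : (J → Par n l p) → ℝ≥0∞,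
        ∫⁻ θ, C.indicator (1 : (Fin t → Fin n → ℝ) × Z → ℝ≥0∞) (v, c θ) * f θ
          ∂(Measure.pi fun j : J => postMeasure H (smp (w ω, v)) σ j) =
        ∫⁻ θ in c ⁻¹' (Prod.mk v ⁻¹' C), f θ
          ∂(Measure.pi fun j : J => postMeasure H (smp (w ω, v)) σ j) := by
      intro f
      rw [← lintegral_indicator (hc hCv)]
      refine lintegral_congr fun θ => ?_
      by_cases hθ : (v, c θ) ∈ C <;> simp [Set.indicator, hθ]
    rw [h7, h7, ← h6]
    have h8 : ∀ θ, B.indicator (1 : E → ℝ≥0∞) (X θ) = (X ⁻¹' B).indicator 1 θ := fun θ => rfl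
    simp only [h8]
    rw [lintegral_indicator_one (hX hB), Measure.restrict_apply (hX hB), Set.inter_comm]

theorem HasCondDensity.congr {Ω E : Type*} {m mΩ : MeasurableSpace Ω} [MeasurableSpace E]
    {Q : Measure Ω} {X : Ω → E} {ρ : Measure E} {f f' : Ω → E → ℝ} (hff' : ∀ᵐ ω ∂Q, f ω = f' ω)
    (h : HasCondDensity Q m X ρ f) : HasCondDensity Q m X ρ f' := by
  refine ⟨?_, fun B hB => (h.2 B hB).trans ?_⟩
  · filter_upwards [h.1, hff'] with ω h1 h2
    rwa [← h2]
  · filter_upwards [hff'] with ω h2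
    rw [h2]

end HasPosterior
-- Independent families of normal-inverse-Wishart laws.
section NiwFamily

variable {n l p : ℕ} {J : Type*} [Fintype J]

theorem measurable_coefs : Measurable fun (θ : J → Par n l p) j => (θ j).1 := by fun_prop

theorem measurable_covs : Measurable fun (θ : J → Par n l p) j => (θ j).2 := by fun_prop

/-- The image of a product measure under a coordinatewise map is the product of the images, here the
inverse-Wishart marginals. -/
theorem pi_niwMeasure_covs (m : J → CoefVec n l p) {K : J → Matrix (Reg n l p) (Reg n l p) ℝ}
    (hK : ∀ j, (K j).PosDef) {ν : J → ℝ} (hν : ∀ j, (n : ℝ) - 1 < ν j)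
    {V : J → Matrix (Fin n) (Fin n) ℝ} (hV : ∀ j, (V j).PosDef) :
    (Measure.pi fun j => niwMeasure (m j) (K j) (ν j) (V j)).map (fun θ j => (θ j).2) =
      (Measure.pi fun _ : J => symVolume n).withDensity
        fun S => ∏ j, ENNReal.ofReal (iwPdf n (ν j) (V j) (S j)) := by
  have i1 : ∀ j, IsProbabilityMeasure (niwMeasure (m j) (K j) (ν j) (V j)) := fun j =>
    isProbabilityMeasure_niwMeasure _ (hK j) (hν j) (hV j)
  have i2 : ∀ j, SigmaFinite ((symVolume n).withDensity fun S =>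
      ENNReal.ofReal (iwPdf n (ν j) (V j) S)) := fun j => by
    have := isProbabilityMeasure_invWishart (hν j) (hV j)
    change SigmaFinite (invWishart n (ν j) (V j))
    infer_instance
  have i3 : ∀ j, SigmaFinite ((niwMeasure (m j) (K j) (ν j) (V j)).map Prod.snd) := fun j => by
    rw [map_snd_niwMeasure _ (hK j) (ν j) (V j)]; exact i2 j
  rw [Measure.pi_map_pi (f := fun _ => Prod.snd) fun j => measurable_snd.aemeasurable]
  simp only [map_snd_niwMeasure _ (hK _) _ _]
  exact pi_withDensity (fun j S => ENNReal.ofReal (iwPdf n (ν j) (V j) S))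
    fun j => (measurable_iwPdf _ measurable_const measurable_id).ennreal_ofReal

theorem pi_niwMeasure_coefs (C : J → Matrix (Fin n) (Reg n l p) ℝ)
    {L : J → Matrix (Reg n l p) (Reg n l p) ℝ}
    (hL : ∀ j, (L j).PosDef) {ν : J → ℝ} (hν : ∀ j, (n : ℝ) - 1 < ν j)
    {V : J → Matrix (Fin n) (Fin n) ℝ} (hV : ∀ j, (V j).PosDef) (hst : ∀ j,
      Measurable fun v => studentPdf (C j) (L j) (ν j) (V j) v) :
    (Measure.pi fun j => niwMeasure (C j).vec (L j)⁻¹ (ν j) (V j)).map (fun θ j => (θ j).1) =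
      (volume : Measure (J → CoefVec n l p)).withDensity
        fun v => ∏ j, ENNReal.ofReal (studentPdf (C j) (L j) (ν j) (V j) (v j)) := by
  have i1 : ∀ j, IsProbabilityMeasure (niwMeasure (C j).vec (L j)⁻¹ (ν j) (V j)) := fun j =>
    isProbabilityMeasure_niwMeasure _ (hL j).inv (hν j) (hV j)
  have i3 : ∀ j, IsProbabilityMeasure ((niwMeasure (C j).vec (L j)⁻¹ (ν j) (V j)).map Prod.fst) :=
    fun j => Measure.isProbabilityMeasure_map measurable_fst.aemeasurable
  have i2 : ∀ j, SigmaFinite ((volume : Measure (CoefVec n l p)).withDensity fun v =>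
      ENNReal.ofReal (studentPdf (C j) (L j) (ν j) (V j) v)) := fun j => by
    rw [← map_fst_niwMeasure _ (hL j) (hν j) (hV j)]; infer_instance
  rw [Measure.pi_map_pi (f := fun _ => Prod.fst) fun j => measurable_fst.aemeasurable]
  simp only [map_fst_niwMeasure _ (hL _) (hν _) (hV _)]
  exact pi_withDensity (fun j v => ENNReal.ofReal (studentPdf (C j) (L j) (ν j) (V j) v))
    fun j => (hst j).ennreal_ofReal

/-- Disintegration of a family of normal-inverse-Wishart laws along the covariances. -/
theorem pi_niwMeasure_inter (m : J → CoefVec n l p) {K : J → Matrix (Reg n l p) (Reg n l p) ℝ}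
    (hK : ∀ j, (K j).PosDef) {ν : J → ℝ} (hν : ∀ j, (n : ℝ) - 1 < ν j)
    {V : J → Matrix (Fin n) (Fin n) ℝ} (hV : ∀ j, (V j).PosDef)
    {C : Set (J → Matrix (Fin n) (Fin n) ℝ)} (hC : MeasurableSet C)
    {B : Set (J → CoefVec n l p)} (hB : MeasurableSet B) :
    Measure.pi (fun j => niwMeasure (m j) (K j) (ν j) (V j))
        ((fun θ j => (θ j).2) ⁻¹' C ∩ (fun θ j => (θ j).1) ⁻¹' B) =
      ∫⁻ θ in (fun θ j => (θ j).2) ⁻¹' C,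
          (∫⁻ v in B, ENNReal.ofReal (∏ j, |gaussPdf (m j) (K j ⊗ₖ (θ j).2) (v j)|))
        ∂Measure.pi fun j => niwMeasure (m j) (K j) (ν j) (V j) := by
  have i1 : ∀ j, IsProbabilityMeasure (niwMeasure (m j) (K j) (ν j) (V j)) := fun j =>
    isProbabilityMeasure_niwMeasure _ (hK j) (hν j) (hV j)
  have hgp : Measurable fun q : (J → Matrix (Fin n) (Fin n) ℝ) × (J → CoefVec n l p) =>
      ENNReal.ofReal (∏ j, |gaussPdf (m j) (K j ⊗ₖ q.1 j) (q.2 j)|) := by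
    refine (Finset.measurable_prod _ fun j _ => ?_).ennreal_ofReal
    have h1 : Measurable fun q : (J → Matrix (Fin n) (Fin n) ℝ) × (J → CoefVec n l p) =>
        gaussPdf (m j) (K j ⊗ₖ q.1 j) (q.2 j) :=
      measurable_gaussPdf measurable_const (measurable_matrix_kronecker measurable_const
        ((measurable_pi_apply j).comp measurable_fst)) ((measurable_pi_apply j).comp measurable_snd)
    exact h1.abs
  have hg : Measurable fun S : J → Matrix (Fin n) (Fin n) ℝ =>
      ∫⁻ v in B, ENNReal.ofReal (∏ j, |gaussPdf (m j) (K j ⊗ₖ S j) (v j)|) :=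
    hgp.lintegral_prod_right'
  have hiw : Measurable fun S : J → Matrix (Fin n) (Fin n) ℝ =>
      ∏ j, ENNReal.ofReal (iwPdf n (ν j) (V j) (S j)) :=
    Finset.measurable_prod _ fun j _ =>
      (measurable_iwPdf _ measurable_const (measurable_pi_apply j)).ennreal_ofReal
  have hCB : MeasurableSet ((fun (θ : J → Par n l p) j => (θ j).2) ⁻¹' C ∩
      (fun (θ : J → Par n l p) j => (θ j).1) ⁻¹' B) :=
    (measurable_covs hC).inter (measurable_coefs hB)
  have hmp := measurePreserving_arrowProdEquivProdArrow (CoefVec n l p)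
    (Matrix (Fin n) (Fin n) ℝ) J (fun _ => volume) (fun _ => symVolume n)
  let G : (J → CoefVec n l p) × (J → Matrix (Fin n) (Fin n) ℝ) → ℝ≥0∞ := fun q =>
    (∏ j, ENNReal.ofReal (niwPdf (m j) (K j) (ν j) (V j) (q.1 j) (q.2 j))) *
      (C.indicator 1 q.2 * B.indicator 1 q.1)
  have hG : Measurable G := by
    refine (Finset.measurable_prod _ fun j _ => ?_).mul
      (((measurable_one.indicator hC).comp measurable_snd).mul
        ((measurable_one.indicator hB).comp measurable_fst))
    exact (measurable_niwPdf (ν j) measurable_const measurable_const measurable_const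
      ((measurable_pi_apply j).comp measurable_fst)
      ((measurable_pi_apply j).comp measurable_snd)).ennreal_ofReal
  calc Measure.pi (fun j => niwMeasure (m j) (K j) (ν j) (V j))
        ((fun θ j => (θ j).2) ⁻¹' C ∩ (fun θ j => (θ j).1) ⁻¹' B)
      = ∫⁻ θ, G (fun j => (θ j).1, fun j => (θ j).2)
          ∂Measure.pi fun _ : J => volume.prod (symVolume n) := by
        rw [← lintegral_indicator_one hCB,
          lintegral_pi_niwMeasure _ _ _ _ (measurable_one.indicator hCB)]
        refine lintegral_congr fun θ => ?_
        simp only [G]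
        congr 1
        rw [Set.inter_indicator_one]
        rfl
    _ = ∫⁻ q, G q ∂(Measure.pi fun _ : J => volume).prod (Measure.pi fun _ : J => symVolume n) :=
        hmp.lintegral_comp hG
    _ = ∫⁻ S, ∫⁻ v, G (v, S) ∂volume ∂(Measure.pi fun _ : J => symVolume n) := by
        rw [lintegral_prod_symm' _ hG]; rfl
    _ = ∫⁻ S, (∏ j, ENNReal.ofReal (iwPdf n (ν j) (V j) (S j))) *
          C.indicator (fun S => ∫⁻ v in B,
            ENNReal.ofReal (∏ j, |gaussPdf (m j) (K j ⊗ₖ S j) (v j)|)) S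
          ∂(Measure.pi fun _ : J => symVolume n) := by
        refine lintegral_congr fun S => ?_
        by_cases hS : S ∈ C
        · rw [Set.indicator_of_mem hS, ← lintegral_indicator hB, ← lintegral_const_mul' _ _
            (ENNReal.prod_ne_top fun j _ => ENNReal.ofReal_ne_top)]
          refine lintegral_congr fun v => ?_
          by_cases hv : v ∈ B
          · simp only [G, Set.indicator_of_mem hS, Set.indicator_of_mem hv, Pi.one_apply, mul_one]
            rw [ENNReal.ofReal_prod_of_nonneg fun _ _ => abs_nonneg _, ← Finset.prod_mul_distrib]
            refine Finset.prod_congr rfl fun j _ => ?_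
            -- The absolute value makes the density nonnegative at every S. It is redundant at
            -- positive definite S, and elsewhere the inverse-Wishart factor is zero.
            by_cases hj : (S j).PosDef
            · rw [abs_of_nonneg (gaussPdf_nonneg _ ((hK j).kronecker hj) _), niwPdf, mul_comm,
                ENNReal.ofReal_mul (iwPdf_nonneg (hν j) (hV j) _)]
            · simp [niwPdf, iwPdf_of_not_posDef _ _ hj]
          · simp [G, hv]
        · simp [G, hS]
    _ = ∫⁻ S in C, (∫⁻ v in B, ENNReal.ofReal (∏ j, |gaussPdf (m j) (K j ⊗ₖ S j) (v j)|))
          ∂(Measure.pi fun j => niwMeasure (m j) (K j) (ν j) (V j)).map (fun θ j => (θ j).2) := by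
        rw [pi_niwMeasure_covs m hK hν hV, ← lintegral_indicator hC,
          lintegral_withDensity_eq_lintegral_mul _ hiw (hg.indicator hC)]
        rfl
    _ = _ := by
        rw [setLIntegral_map hC hg measurable_covs]

end NiwFamily

/-- Conditional densities of functions of the parameters given the observations. -/
theorem HasPosterior.hasCondDensity_marginal {Ω : Type*} {F0 : MeasurableSpace Ω}
    [mΩ : MeasurableSpace Ω] {n l p t N : ℕ} {H : Fin N → Hyper n l p} {σ : Fin t → Fin N}
    {w : Ω → Init n l p t} {z : Ω → Fin t → Fin n → ℝ} {J : Finset (Fin N)} {Q : Measure Ω}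
    [IsFiniteMeasure Q] (hm : F0 ≤ mΩ)
    (hw : Measurable[F0] w) (hz : Measurable z) {Θ : Ω → J → Par n l p} (hΘ : Measurable Θ)
    (h : HasPosterior F0 Q H σ w z J Θ) {E : Type*}
    [MeasurableSpace E] {X : (J → Par n l p) → E}
    (hX : Measurable X) {ρ : Measure E} [SFinite ρ]
    {g : Init n l p t × (Fin t → Fin n → ℝ) → E → ℝ}
    (hg : Measurable fun q : (Init n l p t × (Fin t → Fin n → ℝ)) × E => g q.1 q.2)
    (hg0 : ∀ q e, 0 ≤ g q e)
    (hκ : ∀ q, (Measure.pi fun j : J => postMeasure H (smp q) σ j).map X =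
      ρ.withDensity fun x => ENNReal.ofReal (g q x)) :
    HasCondDensity Q (F0 ⊔ MeasurableSpace.comap z inferInstance) (fun ω => X (Θ ω)) ρ
      (fun ω => g (w ω, z ω)) := by
  have hg' : Measurable fun q : ((Init n l p t × (Fin t → Fin n → ℝ)) × Unit) × E =>
      g q.1.1 q.2 := hg.comp (measurable_fst.fst.prodMk measurable_snd)
  have h1 := h.hasCondDensity hm hw hz hΘ (measurable_const : Measurable fun _ => ()) hX
    (ρ := ρ) (g := fun q _ => g q) hg' (fun q _ e => hg0 q e) ?_
  · simpa only [MeasurableSpace.comap_const, sup_bot_eq] using h1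
  · intro q C B hC hB
    by_cases hc : () ∈ C
    · have hC1 : (fun _ : J → Par n l p => ()) ⁻¹' C = Set.univ := Set.eq_univ_of_forall fun _ => hc
      rw [hC1, Set.univ_inter, ← Measure.map_apply hX hB, hκ q, withDensity_apply _ hB,
        setLIntegral_const, measure_univ, mul_one]
    · have hC1 : (fun _ : J → Par n l p => ()) ⁻¹' C = ∅ := Set.eq_empty_of_forall_notMem fun _ => hc
      simp [hC1]

/-! ### Regularity of the closed forms. -/

section Densities

variable {n l p t N : ℕ} (H : Fin N → Hyper n l p) (σ : Fin t → Fin N)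

theorem measurable_seenPdf {X : Type*} [MeasurableSpace X]
    {q : X → Init n l p t × (Fin t → Fin n → ℝ)} {v : X → CoefVec n l p} (hq : Measurable q)
    (hv : Measurable v) (j : Fin N) : Measurable fun x => seenPdf H (smp (q x)) σ j (v x) := by
  have hL := (measurable_LamPost H σ j).comp hq
  have hV := measurable_matrix_add ((measurable_Bbar H σ j).comp hq)
    (measurable_const (a := (H j).V0))
  have hC := measurable_matrix_sub (measurable_circ hv) ((measurable_Cmat H σ j).comp hq)
  refine Measurable.mul (((((measurable_matrix_det hL).pow_const _).mul
    ((measurable_matrix_det hV).pow_const _)).mul_const _).div_const _) ?_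
  exact (measurable_matrix_det (measurable_matrix_add measurable_const
    (measurable_matrix_mul (measurable_matrix_mul (measurable_matrix_mul
      (measurable_matrix_inv hV) hC) hL) (measurable_matrix_transpose hC)))).pow_const _

theorem measurable_covPdf :
    Measurable fun q : (Init n l p t × (Fin t → Fin n → ℝ)) ×
        (regimes σ → Matrix (Fin n) (Fin n) ℝ) => covPdf H (smp q.1) σ q.2 := by
  simp only [covPdf_eq]
  exact Finset.measurable_prod _ fun j _ => measurable_iwPdf _
    (measurable_matrix_add ((measurable_Bbar H σ j).comp measurable_fst) measurable_const)
    ((measurable_pi_apply j).comp measurable_snd)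

theorem covPdf_nonneg (x : Sample n l p t) (S : regimes σ → Matrix (Fin n) (Fin n) ℝ) :
    0 ≤ covPdf H x σ S := by
  rw [covPdf_eq]
  exact Finset.prod_nonneg fun j _ => iwPdf_nonneg (nuPost_gt H σ j) (Bbar_add_posDef H x σ j) _

end Densities

/-! ### The four conditional densities. -/

section Model

variable {Ω : Type*} {F0 : MeasurableSpace Ω} [mΩ : MeasurableSpace Ω] {P : Measure Ω}
  [IsProbabilityMeasure P] {n l p T N : ℕ} {H : Fin N → Hyper n l p} {s : Fin T → Ω → Fin N}
  {ψ : Fin T → Ω → Fin l → ℝ} {y0 : Fin p → Ω → Fin n → ℝ} {y ε : Fin T → Ω → Fin n → ℝ}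
  {Pi : Fin N → Ω → Matrix (Fin n) (Reg n l p) ℝ} {Sig : Fin N → Ω → Matrix (Fin n) (Fin n) ℝ}
  {t : ℕ}

theorem IsBayesianMSVAR.measurableSet_firstPart (hM : IsBayesianMSVAR F0 P H s ψ y0 y ε Pi Sig)
    (ht : t ≤ T) (σ : Fin t → Fin N) :
    MeasurableSet {ω | firstPart ht (fun u => s u ω) = σ} :=
  (measurable_pi_lambda (fun ω u => s (Fin.castLE ht u) ω) fun _ => hM.measurable_s _)
    (measurableSet_singleton σ)

theorem IsCholeskyFactor.posDef {L S : Matrix (Fin n) (Fin n) ℝ} (h : IsCholeskyFactor L S) :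
    S.PosDef := by
  rw [← h.2.2]
  have h1 : (L * Lᵀ).PosSemidef := by
    simpa using Matrix.posSemidef_self_mul_conjTranspose L
  refine h1.posDef_iff_det_ne_zero.2 ?_
  rw [Matrix.det_mul, Matrix.det_transpose]
  exact mul_ne_zero h.det_ne_zero h.det_ne_zero

/-- A regime of σ is in force at some time up to t, and the dynamics supply a Cholesky factor of its
covariance there. Needed because the closed form of the coefficient density is identified only at
positive definite covariances. -/
theorem IsBayesianMSVAR.ae_posDef (hM : IsBayesianMSVAR F0 P H s ψ y0 y ε Pi Sig)
    (ht : t ≤ T) (σ : Fin t → Fin N) :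
    ∀ᵐ ω ∂P[|{ω | firstPart ht (fun u => s u ω) = σ}], ∀ j : regimes σ, (Sig j ω).PosDef := by
  have h1 : ∀ᵐ ω ∂P[|{ω | firstPart ht (fun u => s u ω) = σ}],
      ω ∈ {ω | firstPart ht (fun u => s u ω) = σ} := ae_cond_mem (hM.measurableSet_firstPart ht σ)
  have h2 := (cond_absolutelyContinuous (μ := P)
    (s := {ω | firstPart ht (fun u => s u ω) = σ})).ae_le hM.dynamics
  filter_upwards [h1, h2] with ω hω1 hω2 j
  obtain ⟨u, -, hu⟩ := Finset.mem_image.1 j.2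
  obtain ⟨L, hL, -⟩ := hω2 (Fin.castLE ht u)
  have h3 : s (Fin.castLE ht u) ω = j := (congrFun hω1 u).trans hu
  rw [h3] at hL
  exact hL.posDef

/-- The event splits into finitely many disjoint full regime paths extending σ. Each has the same
formula after restriction to the regimes of σ, so the formula survives the union. -/
theorem IsBayesianMSVAR.hasPosterior_firstPart
    (hM : IsBayesianMSVAR F0 P H s ψ y0 y ε Pi Sig) (ht : t ≤ T) (σ : Fin t → Fin N) :
    HasPosterior F0 P[|{ω | firstPart ht (fun u => s u ω) = σ}] H σ (initOf ψ y0 ht)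
      (fun ω => firstPart ht fun u => y u ω) (regimes σ) (params Pi Sig (regimes σ)) := by
  have h1 : {ω | firstPart ht (fun u => s u ω) = σ} =
      ⋃ τ ∈ Finset.univ.filter (fun τ : Fin T → Fin N => firstPart ht τ = σ),
        {ω | (fun u => s u ω) = τ} := by
    ext ω
    simp
  rw [h1]
  refine HasPosterior.biUnion hM.F0_le (fun τ _ => hM.measurableSet_regimes τ) ?_ ?_
  · intro τ _ τ' _ hne
    refine Set.disjoint_left.2 fun ω (hω : (fun u => s u ω) = τ) hω' => hne ?_
    exact hω.symm.trans hω'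
  · intro τ hτ
    have hτ' : firstPart ht τ = σ := (Finset.mem_filter.1 hτ).2
    have h2 := hM.hasPosterior ht τ
    rw [hτ'] at h2
    refine HasPosterior.mono (hτ' ▸ regimes_firstPart_subset ht τ)
      (θ := fun j ω => ((Pi j ω).vec, Sig j ω)) h2

theorem IsBayesianMSVAR.hasCondDensity_obs
    (hM : IsBayesianMSVAR F0 P H s ψ y0 y ε Pi Sig) (ht : t ≤ T) (σ : Fin t → Fin N) :
    HasCondDensity P[|{ω | firstPart ht (fun u => s u ω) = σ}] F0
      (fun ω => firstPart ht fun u => y u ω) volume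
      (fun ω v => obsPdf H (smp (initOf ψ y0 ht ω, v)) σ) :=
  (hM.hasPosterior_firstPart ht σ).hasCondDensity_obs hM.F0_le (hM.measurable_initOf ht)
    (hM.measurable_firstPart_y ht)

theorem IsBayesianMSVAR.hasCondDensity_coef
    (hM : IsBayesianMSVAR F0 P H s ψ y0 y ε Pi Sig) (ht : t ≤ T) (σ : Fin t → Fin N) :
    HasCondDensity P[|{ω | firstPart ht (fun u => s u ω) = σ}]
      (infoField F0 y ht ⊔ MeasurableSpace.comap (fun ω (j : regimes σ) => Sig j ω) inferInstance)
      (fun ω (j : regimes σ) => (Pi j ω).vec) volume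
      (fun ω => coefPdf H (smp (initOf ψ y0 ht ω, firstPart ht fun u => y u ω)) σ
        (fun j => Sig j ω)) := by
  have hg : Measurable fun q : ((Init n l p t × (Fin t → Fin n → ℝ)) ×
      (regimes σ → Matrix (Fin n) (Fin n) ℝ)) × (regimes σ → CoefVec n l p) =>
      ∏ j : regimes σ, |gaussPdf (Cmat H (smp q.1.1) σ j).vec
        ((LamPost H (smp q.1.1) σ j)⁻¹ ⊗ₖ q.1.2 j) (q.2 j)| := by
    refine Finset.measurable_prod _ fun j _ => ?_
    have h1 : Measurable fun q : ((Init n l p t × (Fin t → Fin n → ℝ)) ×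
        (regimes σ → Matrix (Fin n) (Fin n) ℝ)) × (regimes σ → CoefVec n l p) =>
        gaussPdf (Cmat H (smp q.1.1) σ j).vec
          ((LamPost H (smp q.1.1) σ j)⁻¹ ⊗ₖ q.1.2 j) (q.2 j) :=
      measurable_gaussPdf (measurable_vec ((measurable_Cmat H σ j).comp measurable_fst.fst))
        (measurable_matrix_kronecker
          (measurable_matrix_inv ((measurable_LamPost H σ j).comp measurable_fst.fst))
          ((measurable_pi_apply j).comp measurable_fst.snd))
        ((measurable_pi_apply j).comp measurable_snd)
    exact h1.abs
  have h1 := (hM.hasPosterior_firstPart ht σ).hasCondDensity hM.F0_le (hM.measurable_initOf ht)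
    (hM.measurable_firstPart_y ht) (hM.measurable_params _) measurable_covs measurable_coefs
    (ρ := volume) (g := fun q S v => ∏ j : regimes σ, |gaussPdf (Cmat H (smp q) σ j).vec
        ((LamPost H (smp q) σ j)⁻¹ ⊗ₖ S j) (v j)|) hg
    (fun _ _ _ => Finset.prod_nonneg fun _ _ => abs_nonneg _)
    (fun q C B hC hB => pi_niwMeasure_inter _
      (fun j : regimes σ => (LamPost_posDef H (smp q) σ j).inv)
      (fun j : regimes σ => nuPost_gt H σ j)
      (fun j : regimes σ => Bbar_add_posDef H (smp q) σ j) hC hB)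
  -- The product of absolute values used so far equals the closed form wherever the covariances are
  -- positive definite, hence almost surely.
  refine HasCondDensity.congr ?_ h1
  filter_upwards [hM.ae_posDef ht σ] with ω hω
  funext v
  rw [coefPdf_eq H _ σ hω]
  refine Finset.prod_congr rfl fun j _ => ?_
  exact abs_of_nonneg (gaussPdf_nonneg _ ((LamPost_posDef H _ σ j).inv.kronecker (hω j)) _)

theorem IsBayesianMSVAR.hasCondDensity_cov
    (hM : IsBayesianMSVAR F0 P H s ψ y0 y ε Pi Sig) (ht : t ≤ T) (σ : Fin t → Fin N) :
    HasCondDensity P[|{ω | firstPart ht (fun u => s u ω) = σ}] (infoField F0 y ht)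
      (fun ω (j : regimes σ) => Sig j ω) (Measure.pi fun _ : regimes σ => symVolume n)
      (fun ω => covPdf H (smp (initOf ψ y0 ht ω, firstPart ht fun u => y u ω)) σ) := by
  refine (hM.hasPosterior_firstPart ht σ).hasCondDensity_marginal hM.F0_le
    (hM.measurable_initOf ht) (hM.measurable_firstPart_y ht) (hM.measurable_params _)
    measurable_covs (g := fun q => covPdf H (smp q) σ) (measurable_covPdf H σ)
    (fun q => covPdf_nonneg H σ _) fun q => ?_
  refine (pi_niwMeasure_covs _ (fun j : regimes σ => (LamPost_posDef H (smp q) σ j).inv)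
    (fun j => nuPost_gt H σ j) (fun j => Bbar_add_posDef H (smp q) σ j)).trans ?_
  congr 1
  funext S
  rw [covPdf_eq, ENNReal.ofReal_prod_of_nonneg]
  exact fun j _ => iwPdf_nonneg (nuPost_gt H σ j) (Bbar_add_posDef H _ σ j) _

/-- The full path is fixed here, so the posterior covers all its regimes, including those appearing
only after t; β is a subset of them. -/
theorem IsBayesianMSVAR.hasCondDensity_futureCoef
    (hM : IsBayesianMSVAR F0 P H s ψ y0 y ε Pi Sig) (ht : t ≤ T) (τ : Fin T → Fin N) :
    HasCondDensity P[|{ω | (fun u => s u ω) = τ}] (infoField F0 y ht)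
      (fun ω (j : futureRegimes t τ) => (Pi j ω).vec) volume
      (fun ω => futureCoefPdf H (smp (initOf ψ y0 ht ω, firstPart ht fun u => y u ω)) ht τ) := by
  have hsub : futureRegimes t τ ⊆ regimes τ := Finset.image_subset_image (Finset.filter_subset _ _)
  have h1 : HasPosterior F0 P[|{ω | (fun u => s u ω) = τ}] H (firstPart ht τ) (initOf ψ y0 ht)
      (fun ω => firstPart ht fun u => y u ω) (futureRegimes t τ)
      (params Pi Sig (futureRegimes t τ)) :=
    HasPosterior.mono hsub (θ := fun j ω => ((Pi j ω).vec, Sig j ω)) (hM.hasPosterior ht τ)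
  have hg : Measurable fun q : (Init n l p t × (Fin t → Fin n → ℝ)) ×
      (futureRegimes t τ → CoefVec n l p) => futureCoefPdf H (smp q.1) ht τ q.2 := by
    simp only [futureCoefPdf_eq]
    exact Finset.measurable_prod _ fun j _ => measurable_seenPdf H _ measurable_fst
      ((measurable_pi_apply j).comp measurable_snd) j
  refine h1.hasCondDensity_marginal hM.F0_le
    (hM.measurable_initOf ht) (hM.measurable_firstPart_y ht) (hM.measurable_params _)
    measurable_coefs (g := fun q => futureCoefPdf H (smp q) ht τ) hg (fun q v => ?_) fun q => ?_
  · rw [futureCoefPdf_eq]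
    exact Finset.prod_nonneg fun j _ => seenPdf_nonneg _ _ _ _ _
  · refine (pi_niwMeasure_coefs _
      (fun j : futureRegimes t τ => LamPost_posDef H (smp q) (firstPart ht τ) j)
      (fun j => nuPost_gt H _ j) (fun j => Bbar_add_posDef H (smp q) _ j) fun j =>
        measurable_seenPdf H (firstPart ht τ) measurable_const measurable_id j).trans ?_
    congr 1
    funext v
    rw [futureCoefPdf_eq, ENNReal.ofReal_prod_of_nonneg fun j _ => seenPdf_nonneg _ _ _ _ _]
    rfl

end Model
end MSVAR

theorem proposition2 {Ω : Type*} (F0 : MeasurableSpace Ω) [mΩ : MeasurableSpace Ω] (P : Measure Ω)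
    [IsProbabilityMeasure P] {n l p T N : ℕ} (H : Fin N → MSVAR.Hyper n l p)
    (s : Fin T → Ω → Fin N) (ψ : Fin T → Ω → Fin l → ℝ) (y0 : Fin p → Ω → Fin n → ℝ)
    (y ε : Fin T → Ω → Fin n → ℝ) (Pi : Fin N → Ω → Matrix (Fin n) (MSVAR.Reg n l p) ℝ)
    (Sig : Fin N → Ω → Matrix (Fin n) (Fin n) ℝ)
    (hM : MSVAR.IsBayesianMSVAR F0 P H s ψ y0 y ε Pi Sig)
    (t : ℕ) (ht1 : 1 ≤ t) (htT : t < T) :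
    -- `B̄` is positive semidefinite and has a second expression
    (∀ (x : MSVAR.Sample n l p t) (σ : Fin t → Fin N) (j : Fin N),
      (MSVAR.Bbar H x σ j).PosSemidef ∧
      MSVAR.Bbar H x σ j =
        (MSVAR.obsMat x σ j - MSVAR.circ (H j).pi0 * MSVAR.regMat x σ j) *
          (1 + (MSVAR.regMat x σ j)ᵀ * (H j).Lam0 * MSVAR.regMat x σ j)⁻¹ *
          (MSVAR.obsMat x σ j - MSVAR.circ (H j).pi0 * MSVAR.regMat x σ j)ᵀ) ∧
    (∀ σ : Fin t → Fin N,
      -- density of `ȳ_t` given `s̄_t = σ` and `F_0`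
      MSVAR.HasCondDensity
        P[|{ω | MSVAR.firstPart htT.le (fun u => s u ω) = σ}] F0
        (fun ω => MSVAR.firstPart htT.le fun u => y u ω) volume
        (fun ω v => MSVAR.obsPdf H
          ⟨MSVAR.firstPart htT.le fun u => ψ u ω, fun i => y0 i ω, v⟩ σ) ∧
      -- density of `π_α` given `Σ_α`, `s̄_t = σ` and `F_t`
      MSVAR.HasCondDensity
        P[|{ω | MSVAR.firstPart htT.le (fun u => s u ω) = σ}]
        (MSVAR.infoField F0 y htT.le ⊔
          MeasurableSpace.comap (fun ω (j : MSVAR.regimes σ) => Sig j ω) inferInstance)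
        (fun ω (j : MSVAR.regimes σ) => (Pi j ω).vec) volume
        (fun ω => MSVAR.coefPdf H
          ⟨MSVAR.firstPart htT.le fun u => ψ u ω, fun i => y0 i ω,
            MSVAR.firstPart htT.le fun u => y u ω⟩ σ (fun j => Sig j ω)) ∧
      -- density of `Σ_α` given `s̄_t = σ` and `F_t`
      MSVAR.HasCondDensity
        P[|{ω | MSVAR.firstPart htT.le (fun u => s u ω) = σ}] (MSVAR.infoField F0 y htT.le)
        (fun ω (j : MSVAR.regimes σ) => Sig j ω)
        (Measure.pi fun _ : MSVAR.regimes σ => MSVAR.symVolume n)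
        (fun ω => MSVAR.covPdf H
          ⟨MSVAR.firstPart htT.le fun u => ψ u ω, fun i => y0 i ω,
            MSVAR.firstPart htT.le fun u => y u ω⟩ σ)) ∧
    -- density of `π_β` given `s = σ` and `F_t`
    (∀ σ : Fin T → Fin N,
      MSVAR.HasCondDensity
        P[|{ω | (fun u => s u ω) = σ}] (MSVAR.infoField F0 y htT.le)
        (fun ω (j : MSVAR.futureRegimes t σ) => (Pi j ω).vec) volume
        (fun ω => MSVAR.futureCoefPdf H
          ⟨MSVAR.firstPart htT.le fun u => ψ u ω, fun i => y0 i ω,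
            MSVAR.firstPart htT.le fun u => y u ω⟩ htT.le σ)) := by
  refine ⟨fun x σ j => ⟨MSVAR.Bbar_posSemidef H x σ j, MSVAR.Bbar_eq H x σ j⟩, fun σ => ⟨?_, ?_, ?_⟩,
    fun σ => ?_⟩
  · exact hM.hasCondDensity_obs htT.le σ
  · exact hM.hasCondDensity_coef htT.le σ
  · exact hM.hasCondDensity_cov htT.le σ
  · exact hM.hasCondDensity_futureCoef htT.le σ
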